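/- Let $M$ be a smooth manifold and $(G,H,t,m)$ a Lie crossed module: $G,H$ are finite-dimensional real Lie groups with Lie algebras $\mathfrak g,\mathfrak h$, $t:H\to G$ is a smooth homomorphism and $m$ a smooth action of $G$ on $H$ by automorphisms, with $t(m(a)(A))=a\,t(A)\,a^{-1}$ and $m(t(A))(B)=ABA^{-1}$. Write $\dot t:\mathfrak h\to\mathfrak g$ for the differential of $t$ at $1_H$ and $\dot m(a):\mathfrak h\to\mathfrak h$ for the differential of $m(a)$ at $1_H$. Let $(\theta,\Upsilon)\in\Omega^1(M,\mathfrak g)\times\Omega^2(M,\mathfrak h)$ be a connection doublet, i.e. smooth forms with $d\theta+\tfrac12[\theta,\theta]-\dot t(\Upsilon)=0$. A curve $\gamma:p_0\to p_1$ is a smooth map $\gamma:\mathbb R\to M$ with $\gamma(x)=p_0$ for $x<\epsilon$ and $\gamma(x)=p_1$ for $x>1-\epsilon$, for some $0<\epsilon<1/2$. A surface $\Sigma:\gamma_0\Rightarrow\gamma_1$ between curves $\gamma_0,\gamma_1:p_0\to p_1$ is a smooth map $\Sigma:\mathbb R^2\to M$ such that, for some $0<\epsilon<1/2$, $\Sigma(x,y)$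 equals $p_0$ for $x<\epsilon$, $p_1$ for $x>1-\epsilon$, $\gamma_0(x)$ for $y<\epsilon$ and $\gamma_1(x)$ for $y>1-\epsilon$. The unit surface $I_\gamma:\gamma\Rightarrow\gamma$ is $I_\gamma(x,y)=\gamma(x)$. A $(G,H)$-cocycle is a triple of smooth maps $f(x',x;y)\in G$, $g(x;y',y)\in G$, $W(x',x;y',y)\in H$ of real variables with $$t(W(x',x;y',y))=g(x;y',y)^{-1}f(x',x;y')^{-1}g(x';y',y)f(x',x;y),$$ $$f(x'',x;y)=f(x'',x';y)f(x',x;y),\qquad g(x;y'',y)=g(x;y'',y')g(x;y',y),$$ $$W(x'',x;y',y)=W(x',x;y',y)\,m(f(x',x;y)^{-1})(W(x'',x';y',y)),$$ $$W(x',x;y'',y)=m(g(x;y',y)^{-1})(W(x',x;y'',y'))\,W(x',x;y',y).$$ The cocycle associated with forms $a\in\Omega^1(\mathbb R^2,\mathfrak g)$, $B\in\Omega^2(\mathbb R^2,\mathfrak h)$ is the cocycle $(f_{a,B},g_{a,B},W_{a,B})=(f,g,W)$ with $$\partial_xf(x,x_0;y)\,f(x,x_0;y)^{-1}=-a_x(x,y),\quad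 f(x_0,x_0;y)=1_G,$$ $$\partial_yg(x;y,y_0)\,g(x;y,y_0)^{-1}=-a_y(x,y),\quad g(x;y_0,y_0)=1_G,$$ $$\partial_x\bigl(\partial_yW(x,x_0;y,y_0)\,W(x,x_0;y,y_0)^{-1}\bigr)=-\dot m\bigl(g(x_0;y,y_0)^{-1}f(x,x_0;y)^{-1}\bigr)(B_{xy}(x,y)),$$ $$W(x_0,x_0;y,y_0)=W(x,x_0;y_0,y_0)=1_H.$$ Put $$F(\gamma)=f_{I_\gamma^*\theta,I_\gamma^*\Upsilon}(1,0;y)\ \text{ (any } y\in\mathbb R),\qquad F(\Sigma)=W_{\Sigma^*\theta,\Sigma^*\Upsilon}(0,1;1,0).$$ The Schreiber–Waldorf transports are as follows. $F_{SW}(\gamma)=u(1)$, where $u:\mathbb R\to G$ is the smooth solution of $$u'(x)u(x)^{-1}=-(\gamma^*\theta)_x(x),\qquad u(0)=1_G.$$ For a surface, fix a smooth $\varphi:\mathbb R\to\mathbb R$ with $\varphi(x)=0$ for $x<\epsilon$ and $\varphi(x)=1$ for $x>1-\epsilon$ (some $0<\epsilon<1/2$), let $\gamma_{\Sigma\,\xi,y}:\Sigma(\xi,y)\to\Sigma(1,y)$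 be the curve $x\mapsto\Sigma(\xi+(1-\xi)\varphi(x),y)$, and put $F_{SW}(\Sigma)=E(1)$, where $E:\mathbb R\to H$ is the smooth solution of $$E'(y)E(y)^{-1}=\int_0^1\dot m\bigl(F_{SW}(\gamma_{\Sigma\,\xi,y})\bigr)\bigl((\Sigma^*\Upsilon)_{xy}(\xi,y)\bigr)\,d\xi,\qquad E(0)=1_H.$$ Then all these objects are well defined: for every surface $\Sigma$ (in particular every $I_\gamma$) there is exactly one cocycle associated with $(\Sigma^*\theta,\Sigma^*\Upsilon)$, the two Schreiber–Waldorf problems have exactly one smooth solution, and the integrand is integrable in $\xi$. Moreover, for every curve $\gamma$ and every $y$, $$F_{SW}(\gamma)=f_{I_\gamma^*\theta,I_\gamma^*\Upsilon}(1,0;y)=F(\gamma);$$ for every surface $\Sigma:\gamma_0\Rightarrow\gamma_1$ one also has $F_{SW}(\gamma_i)=f_{\Sigma^*\theta,\Sigma^*\Upsilon}(1,0;i)$ for $i=0,1$; and for every surface $\Sigma$ and every choice of $\varphi$, $$F_{SW}(\Sigma)=F(\Sigma).$$ -/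

import Mathlib

open scoped Manifold ContDiff

namespace HigherTransport

/-! Throughout, a manifold is modelled on a finite-dimensional real normed space `E` (it has no
boundary), smooth means `C^∞`, and the tangent space `TangentSpace 𝓘(ℝ, E) p` is, as a vector space,
the model space `E` (through the preferred chart at `p`). In particular, the Lie algebra
`T₁ G` of a Lie group `G` modelled on `EG` has underlying normed space `EG`. -/

section LieGroups

variable {EG : Type*} [NormedAddCommGroup EG] [NormedSpace ℝ EG]
  {G : Type*} [TopologicalSpace G] [ChartedSpace EG G] [Group G]

variable (G) in
/-- The bracket of the Lie algebra `T₁ G`. -/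
noncomputable def lieBr (v w : EG) : EG :=
  let v' : GroupLieAlgebra 𝓘(ℝ, EG) G := v
  let w' : GroupLieAlgebra 𝓘(ℝ, EG) G := w
  let r : GroupLieAlgebra 𝓘(ℝ, EG) G := ⁅v', w'⁆
  r

variable (EG) in
/-- `u'(x) u(x)⁻¹ ∈ T₁ G` for a differentiable `u : ℝ → G`: the velocity at `s = x` of the curve
`s ↦ u(s) u(x)⁻¹`, which passes through `1` at `s = x`. -/
noncomputable def rightLogDeriv (u : ℝ → G) (x : ℝ) : EG :=
  mfderiv 𝓘(ℝ, ℝ) 𝓘(ℝ, EG) (fun s => u s * (u x)⁻¹) x (1 : ℝ)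

end LieGroups

/-- A Lie crossed module `(G, H, t, m)`: Lie groups `G`, `H`, a smooth homomorphism `t : H → G` and
a smooth action `m` of `G` on `H` by automorphisms, subject to equivariance and to the
Peiffer identity. -/
structure LieCrossedModule
    (EG : Type*) [NormedAddCommGroup EG] [NormedSpace ℝ EG]
    (EH : Type*) [NormedAddCommGroup EH] [NormedSpace ℝ EH]
    (G : Type*) [TopologicalSpace G] [ChartedSpace EG G] [Group G]
    (H : Type*) [TopologicalSpace H] [ChartedSpace EH H] [Group H] where
  t : H →* G
  m : G →* MulAut H
  smooth_t : ContMDiff 𝓘(ℝ, EH) 𝓘(ℝ, EG) ∞ t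
  smooth_m : ContMDiff (𝓘(ℝ, EG).prod 𝓘(ℝ, EH)) 𝓘(ℝ, EH) ∞ (fun p : G × H => m p.1 p.2)
  equivariance : ∀ (a : G) (A : H), t (m a A) = a * t A * a⁻¹
  peiffer : ∀ A B : H, m (t A) B = A * B * A⁻¹

section Forms

/-- A smooth differential `n`-form on the manifold `M` with values in the vector space `F`;
smoothness is tested in charts. -/
structure DiffForm (n : ℕ)
    (E : Type*) [NormedAddCommGroup E] [NormedSpace ℝ E]
    (M : Type*) [TopologicalSpace M] [ChartedSpace E M]
    (F : Type*) [NormedAddCommGroup F] [NormedSpace ℝ F] where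
  toFun : ∀ p : M, TangentSpace 𝓘(ℝ, E) p [⋀^Fin n]→L[ℝ] F
  smooth : ∀ p : M, ContDiffOn ℝ ∞
    (fun e : E => ((toFun ((chartAt E p).symm e)).compContinuousLinearMap
      (mfderiv 𝓘(ℝ, E) 𝓘(ℝ, E) (chartAt E p).symm e) : E [⋀^Fin n]→L[ℝ] F))
    (chartAt E p).target

variable {n : ℕ}
  {E : Type*} [NormedAddCommGroup E] [NormedSpace ℝ E]
  {M : Type*} [TopologicalSpace M] [ChartedSpace E M]
  {F : Type*} [NormedAddCommGroup F] [NormedSpace ℝ F]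

/-- The pull-back of a form on `M` by a smooth map `h : V → M` from a vector space `V`. -/
noncomputable def DiffForm.pullback (α : DiffForm n E M F)
    {V : Type*} [NormedAddCommGroup V] [NormedSpace ℝ V] (h : V → M) (x : V) :
    V [⋀^Fin n]→L[ℝ] F :=
  (α.toFun (h x)).compContinuousLinearMap (mfderiv 𝓘(ℝ, V) 𝓘(ℝ, E) h x)

/-- The exterior derivative at `p`, computed in the preferred chart at `p`; tangent vectors at `p`
are read in the same chart. -/
noncomputable def DiffForm.extDerivAt (α : DiffForm n E M F) (p : M) : E [⋀^Fin (n + 1)]→L[ℝ] F :=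
  extDeriv
    (fun e : E => ((α.toFun ((chartAt E p).symm e)).compContinuousLinearMap
      (mfderiv 𝓘(ℝ, E) 𝓘(ℝ, E) (chartAt E p).symm e) : E [⋀^Fin n]→L[ℝ] F))
    (chartAt E p p)

end Forms

section CrossedModule

variable {EG : Type*} [NormedAddCommGroup EG] [NormedSpace ℝ EG]
  {EH : Type*} [NormedAddCommGroup EH] [NormedSpace ℝ EH]
  {G : Type*} [TopologicalSpace G] [ChartedSpace EG G] [Group G]
  {H : Type*} [TopologicalSpace H] [ChartedSpace EH H] [Group H]

/-- `ṫ : T₁ H → T₁ G`, the differential of `t` at `1`. -/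
noncomputable def LieCrossedModule.tDot (X : LieCrossedModule EG EH G H) (Y : EH) : EG :=
  mfderiv 𝓘(ℝ, EH) 𝓘(ℝ, EG) X.t 1 Y

/-- `ṁ(a) : T₁ H → T₁ H`, the differential at `1` of the automorphism `m(a)`, for `a ∈ G`. -/
noncomputable def LieCrossedModule.mDot (X : LieCrossedModule EG EH G H) (a : G) (Y : EH) : EH :=
  mfderiv 𝓘(ℝ, EH) 𝓘(ℝ, EH) (X.m a) 1 Y

/-- A `(G, H)`-cocycle: smooth maps `f(x', x; y)`, `g(x; y', y)` to `G` and `W(x', x; y', y)`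
to `H` subject to the target matching condition and to the cocycle relations. -/
@[ext]
structure Cocycle (X : LieCrossedModule EG EH G H) where
  /-- `f x' x y` is `f(x', x; y)` -/
  f : ℝ → ℝ → ℝ → G
  /-- `g x y' y` is `g(x; y', y)` -/
  g : ℝ → ℝ → ℝ → G
  /-- `W x' x y' y` is `W(x', x; y', y)` -/
  W : ℝ → ℝ → ℝ → ℝ → H
  smooth_f : ContMDiff 𝓘(ℝ, ℝ × ℝ × ℝ) 𝓘(ℝ, EG) ∞ (fun p : ℝ × ℝ × ℝ => f p.1 p.2.1 p.2.2)
  smooth_g : ContMDiff 𝓘(ℝ, ℝ × ℝ × ℝ) 𝓘(ℝ, EG) ∞ (fun p : ℝ × ℝ × ℝ => g p.1 p.2.1 p.2.2)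
  smooth_W : ContMDiff 𝓘(ℝ, ℝ × ℝ × ℝ × ℝ) 𝓘(ℝ, EH) ∞
    (fun p : ℝ × ℝ × ℝ × ℝ => W p.1 p.2.1 p.2.2.1 p.2.2.2)
  target_matching : ∀ x' x y' y,
    X.t (W x' x y' y) = (g x y' y)⁻¹ * (f x' x y')⁻¹ * g x' y' y * f x' x y
  f_mul : ∀ x'' x' x y, f x'' x y = f x'' x' y * f x' x y
  g_mul : ∀ x y'' y' y, g x y'' y = g x y'' y' * g x y' y
  W_horizontal : ∀ x'' x' x y' y,
    W x'' x y' y = W x' x y' y * X.m (f x' x y)⁻¹ (W x'' x' y' y)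
  W_vertical : ∀ x' x y'' y' y,
    W x' x y'' y = X.m (g x y' y)⁻¹ (W x' x y'' y') * W x' x y' y

instance (X : LieCrossedModule EG EH G H) : Inhabited (Cocycle X) where
  default :=
    { f := fun _ _ _ => 1
      g := fun _ _ _ => 1
      W := fun _ _ _ _ => 1
      smooth_f := contMDiff_const
      smooth_g := contMDiff_const
      smooth_W := contMDiff_const
      target_matching := by simp
      f_mul := by simp
      g_mul := by simp
      W_horizontal := by simp
      W_vertical := by simp }

/-- The cocycle `(f, g, W)` is the one associated with the pair of forms `a ∈ Ω¹(ℝ², T₁ G)`,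
`B ∈ Ω²(ℝ², T₁ H)`: it solves
* `∂ₓ f(x, x₀; y) f(x, x₀; y)⁻¹ = - aₓ(x, y)`, `f(x₀, x₀; y) = 1`;
* `∂_y g(x; y, y₀) g(x; y, y₀)⁻¹ = - a_y(x, y)`, `g(x; y₀, y₀) = 1`;
* `∂ₓ (∂_y W(x, x₀; y, y₀) W(x, x₀; y, y₀)⁻¹) = - ṁ(g(x₀; y, y₀)⁻¹ f(x, x₀; y)⁻¹)(B_{xy}(x, y))`,
  `W(x₀, x₀; y, y₀) = W(x, x₀; y₀, y₀) = 1`. -/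
structure Cocycle.IsAssociated {X : LieCrossedModule EG EH G H} (c : Cocycle X)
    (a : ℝ × ℝ → (ℝ × ℝ) [⋀^Fin 1]→L[ℝ] EG) (B : ℝ × ℝ → (ℝ × ℝ) [⋀^Fin 2]→L[ℝ] EH) :
    Prop where
  f_eq : ∀ x₀ y x, rightLogDeriv EG (fun s => c.f s x₀ y) x = -(a (x, y) ![(1, 0)])
  f_init : ∀ x₀ y, c.f x₀ x₀ y = 1
  g_eq : ∀ x y₀ y, rightLogDeriv EG (fun s => c.g x s y₀) y = -(a (x, y) ![(0, 1)])
  g_init : ∀ x y₀, c.g x y₀ y₀ = 1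
  W_eq : ∀ x₀ y₀ x y,
    HasDerivAt (fun s => rightLogDeriv EH (fun r => c.W s x₀ r y₀) y)
      (-(X.mDot ((c.g x₀ y y₀)⁻¹ * (c.f x x₀ y)⁻¹) (B (x, y) ![(1, 0), (0, 1)]))) x
  W_init_x : ∀ x₀ y y₀, c.W x₀ x₀ y y₀ = 1
  W_init_y : ∀ x x₀ y₀, c.W x x₀ y₀ y₀ = 1

/-- The cocycle `(f_{a,B}, g_{a,B}, W_{a,B})` associated with `(a, B)` (an arbitrary cocycle if there
were none). -/
noncomputable def Cocycle.of (X : LieCrossedModule EG EH G H)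
    (a : ℝ × ℝ → (ℝ × ℝ) [⋀^Fin 1]→L[ℝ] EG) (B : ℝ × ℝ → (ℝ × ℝ) [⋀^Fin 2]→L[ℝ] EH) :
    Cocycle X :=
  Classical.epsilon fun c : Cocycle X => c.IsAssociated a B

/-- A `(G, H)`-connection doublet `(θ, Υ) ∈ Ω¹(M, T₁ G) × Ω²(M, T₁ H)` with zero fake curvature
`dθ + ½ [θ, θ] - ṫ(Υ) = 0`; note that `½ [θ, θ](v, w) = [θ(v), θ(w)]`. -/
structure ConnectionDoublet (X : LieCrossedModule EG EH G H)
    (E : Type*) [NormedAddCommGroup E] [NormedSpace ℝ E]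
    (M : Type*) [TopologicalSpace M] [ChartedSpace E M] where
  θ : DiffForm 1 E M EG
  Υ : DiffForm 2 E M EH
  fake_curvature : ∀ (p : M) (v w : TangentSpace 𝓘(ℝ, E) p),
    θ.extDerivAt p ![v, w] + lieBr G (θ.toFun p ![v]) (θ.toFun p ![w])
      - X.tDot (Υ.toFun p ![v, w]) = 0

end CrossedModule

section CurvesSurfaces

variable (E : Type*) [NormedAddCommGroup E] [NormedSpace ℝ E]
  {M : Type*} [TopologicalSpace M] [ChartedSpace E M]

/-- A curve `γ : p₀ → p₁` with sitting instants. -/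
structure Curve (p₀ p₁ : M) where
  toFun : ℝ → M
  smooth : ContMDiff 𝓘(ℝ, ℝ) 𝓘(ℝ, E) ∞ toFun
  sitting : ∃ ε : ℝ, 0 < ε ∧ ε < 1 / 2 ∧
    (∀ x < ε, toFun x = p₀) ∧ (∀ x > 1 - ε, toFun x = p₁)

variable {E}

/-- A surface `Σ : γ₀ ⇒ γ₁` with sitting instants. -/
structure Surface {p₀ p₁ : M} (γ₀ γ₁ : Curve E p₀ p₁) where
  toFun : ℝ × ℝ → M
  smooth : ContMDiff 𝓘(ℝ, ℝ × ℝ) 𝓘(ℝ, E) ∞ toFun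
  sitting : ∃ ε : ℝ, 0 < ε ∧ ε < 1 / 2 ∧
    (∀ x y, x < ε → toFun (x, y) = p₀) ∧ (∀ x y, x > 1 - ε → toFun (x, y) = p₁) ∧
    (∀ x y, y < ε → toFun (x, y) = γ₀.toFun x) ∧ (∀ x y, y > 1 - ε → toFun (x, y) = γ₁.toFun x)

/-- The unit surface `I_γ : γ ⇒ γ`, `I_γ(x, y) = γ(x)`. -/
def Curve.unitSurface {p₀ p₁ : M} (γ : Curve E p₀ p₁) : Surface γ γ where
  toFun := fun p => γ.toFun p.1
  smooth := γ.smooth.comp contDiff_fst.contMDiff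
  sitting := by
    obtain ⟨ε, h0, h1, h2, h3⟩ := γ.sitting
    exact ⟨ε, h0, h1, fun x _ hx => h2 x hx, fun x _ hx => h3 x hx, fun _ _ _ => rfl,
      fun _ _ _ => rfl⟩

/-- A smooth `φ : ℝ → ℝ` with `φ = 0` on `(-∞, ε)` and `φ = 1` on `(1 - ε, ∞)`, for a small
`ε > 0`. -/
structure Cutoff where
  toFun : ℝ → ℝ
  smooth : ContDiff ℝ ∞ toFun
  sitting : ∃ ε : ℝ, 0 < ε ∧ ε < 1 / 2 ∧
    (∀ x < ε, toFun x = 0) ∧ (∀ x > 1 - ε, toFun x = 1)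

/-- The curve `γ_{Σ ξ,y} : Σ(ξ, y) → Σ(1, y)`, `γ_{Σ ξ,y}(x) = Σ(ξ + (1 - ξ) φ(x), y)`. -/
def Surface.tailCurve {p₀ p₁ : M} {γ₀ γ₁ : Curve E p₀ p₁} (S : Surface γ₀ γ₁) (φ : Cutoff)
    (ξ y : ℝ) : Curve E (S.toFun (ξ, y)) (S.toFun (1, y)) where
  toFun := fun x => S.toFun (ξ + (1 - ξ) * φ.toFun x, y)
  smooth := S.smooth.comp (ContDiff.contMDiff
    ((contDiff_const.add (contDiff_const.mul φ.smooth)).prodMk contDiff_const))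
  sitting := by
    obtain ⟨ε, h0, h1, h2, h3⟩ := φ.sitting
    refine ⟨ε, h0, h1, fun x hx => ?_, fun x hx => ?_⟩
    · simp [h2 x hx]
    · simp [h3 x hx]

end CurvesSurfaces

section Transport

variable {EG : Type*} [NormedAddCommGroup EG] [NormedSpace ℝ EG]
  {EH : Type*} [NormedAddCommGroup EH] [NormedSpace ℝ EH]
  {G : Type*} [TopologicalSpace G] [ChartedSpace EG G] [Group G]
  {H : Type*} [TopologicalSpace H] [ChartedSpace EH H] [Group H]
  {X : LieCrossedModule EG EH G H}
  {E : Type*} [NormedAddCommGroup E] [NormedSpace ℝ E]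
  {M : Type*} [TopologicalSpace M] [ChartedSpace E M]
  {p₀ p₁ : M} {γ₀ γ₁ : Curve E p₀ p₁}

namespace ConnectionDoublet

/-- `c` is the cocycle associated with the doublet `(Σ^*θ, Σ^*Υ)` on `ℝ²`. -/
def IsCocycleOf (D : ConnectionDoublet X E M) (S : Surface γ₀ γ₁) (c : Cocycle X) : Prop :=
  c.IsAssociated (D.θ.pullback S.toFun) (D.Υ.pullback S.toFun)

/-- The cocycle associated with the doublet `(Σ^*θ, Σ^*Υ)` on `ℝ²`. -/
noncomputable def cocycle (D : ConnectionDoublet X E M) (S : Surface γ₀ γ₁) : Cocycle X :=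
  Cocycle.of X (D.θ.pullback S.toFun) (D.Υ.pullback S.toFun)

/-- The cocycle `1`-parallel transport `F(γ) = f_{I_γ^*θ, I_γ^*Υ | y}(1, 0)`, computed at
height `y`. -/
noncomputable def transport₁ (D : ConnectionDoublet X E M) (γ : Curve E p₀ p₁) (y : ℝ) : G :=
  (D.cocycle γ.unitSurface).f 1 0 y

/-- The cocycle `2`-parallel transport `F(Σ) = W_{Σ^*θ, Σ^*Υ}(0, 1; 1, 0)`. -/
noncomputable def transport₂ (D : ConnectionDoublet X E M) (S : Surface γ₀ γ₁) : H :=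
  (D.cocycle S).W 0 1 1 0

/-- `u : ℝ → G` is a smooth solution of `u'(x) u(x)⁻¹ = - (γ^*θ)ₓ(x)`, `u(0) = 1`. -/
structure IsSWSolution₁ (D : ConnectionDoublet X E M) (γ : Curve E p₀ p₁) (u : ℝ → G) :
    Prop where
  smooth : ContMDiff 𝓘(ℝ, ℝ) 𝓘(ℝ, EG) ∞ u
  eq : ∀ x, rightLogDeriv EG u x = -(D.θ.pullback γ.toFun x ![1])
  init : u 0 = 1

/-- The Schreiber-Waldorf `1`-parallel transport `F_SW(γ) = u(1)`. -/
noncomputable def swTransport₁ (D : ConnectionDoublet X E M) (γ : Curve E p₀ p₁) : G :=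
  Classical.epsilon (fun u : ℝ → G => D.IsSWSolution₁ γ u) 1

/-- `Z : ℝ → H` is a smooth solution of
`Z'(y) Z(y)⁻¹ = ∫₀¹ ṁ(F_SW(γ_{Σ ξ,y}))((Σ^*Υ)_{xy}(ξ, y)) dξ`, `Z(0) = 1`. -/
structure IsSWSolution₂ (D : ConnectionDoublet X E M) (φ : Cutoff) (S : Surface γ₀ γ₁)
    (Z : ℝ → H) : Prop where
  smooth : ContMDiff 𝓘(ℝ, ℝ) 𝓘(ℝ, EH) ∞ Z
  eq : ∀ y, rightLogDeriv EH Z y =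
    ∫ ξ in (0 : ℝ)..1, X.mDot (D.swTransport₁ (S.tailCurve φ ξ y))
      (D.Υ.pullback S.toFun (ξ, y) ![(1, 0), (0, 1)])
  init : Z 0 = 1

/-- The Schreiber-Waldorf `2`-parallel transport `F_SW(Σ) = Z(1)`. -/
noncomputable def swTransport₂ (D : ConnectionDoublet X E M) (φ : Cutoff) (S : Surface γ₀ γ₁) : H :=
  Classical.epsilon (fun Z : ℝ → H => D.IsSWSolution₂ φ S Z) 1

end ConnectionDoublet

end Transport

end HigherTransport

open HigherTransport

open HigherTransport

/-! Both surface transports solve one and the same differential equation in `H`. Write `a`, `b` for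
the pull-backs of `θ`, `Υ` along `Σ`. Integrating the equation for `W` once in `x`, from `x₀ = 1` to
`x = 0`, gives `∂_y W(0,1;y,0) W(0,1;y,0)⁻¹ = ∫₀¹ ṁ(g(1;y,0)⁻¹ f(ξ,1;y)⁻¹)(b_{xy}(ξ,y)) dξ`; the
order of the arguments `0, 1` absorbs the minus sign. The edge `x = 1` of `Σ` is constant, so
`a_y(1,y) = 0` and `g(1;y,0) = 1`. Transport along a line is invariant under reparametrisation, so
the Schreiber–Waldorf transport along the tail curve at `(ξ,y)` is `f(1,ξ;y) = f(ξ,1;y)⁻¹`. Hence `y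
↦ W(0,1;y,0)` solves the Schreiber–Waldorf problem, and uniqueness concludes
(`swTransport₁_tailCurve`, `planeDoublet_ay_one`, `isSWSolution₂_W`).

Most of the work is in showing that the associated cocycle exists. The maps `f`, `g`, `W` come from
smooth solutions of `u' u⁻¹ = A` in a Lie group, depending smoothly on parameters
(`exists_solution`). Each cocycle relation is then proved by comparing right logarithmic derivatives
and one value (`eq_of_rightLogDeriv_eq`). Target matching is where zero fake curvature enters:
together with the Maurer–Cartan equation for `f` it says that the `x`-derivative of `Ad(f⁻¹)(∂_y f
f⁻¹ + a_y)` is `Ad(f⁻¹)(ṫ b)`. The horizontal relation for `W` then follows from target matching and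
the Peiffer identity. Uniqueness of the cocycle is the same comparison, made for `f` and `g` before
`W`.

Smooth dependence on parameters rests on the implicit function theorem applied to the integral
equation in `C([-1,1], V)`. Local solutions in `G` extend to the whole line because right
multiplication by a constant preserves the equation: a solution starting at `1` yields one from any
starting value, on the same time interval. The Lie bracket is computed in the chart at `1` as the
antisymmetrised mixed second derivative of the multiplication. -/

namespace HigherTransport

open Set Filter
open scoped Topology

/-! ### Composition operators on spaces of continuous functions -/

section Composition

universe u
variable {K : Type*} [TopologicalSpace K] [CompactSpace K]

/-- The pointwise application of a continuous family of operators to a continuous function. -/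
noncomputable def pointwiseApply (K : Type*) [TopologicalSpace K] [CompactSpace K]
    (V W : Type*) [NormedAddCommGroup V] [NormedSpace ℝ V]
    [NormedAddCommGroup W] [NormedSpace ℝ W] :
    C(K, V →L[ℝ] W) →L[ℝ] C(K, V) →L[ℝ] C(K, W) :=
  LinearMap.mkContinuous₂
    (LinearMap.mk₂ ℝ (fun (A : C(K, V →L[ℝ] W)) (h : C(K, V)) =>
      (⟨fun t => A t (h t), A.continuous.clm_apply h.continuous⟩ : C(K, W)))
      (fun _ _ _ => by ext; simp) (fun _ _ _ => by ext; simp)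
      (fun _ _ _ => by ext; simp) (fun _ _ _ => by ext; simp)) 1
    (fun A h => by
      rw [one_mul, ContinuousMap.norm_le _ (by positivity)]
      intro t
      exact ((A t).le_opNorm _).trans (mul_le_mul (A.norm_coe_le_norm t) (h.norm_coe_le_norm t)
        (norm_nonneg _) (norm_nonneg A)))

/-- Composition with a `C¹` map is differentiable on spaces of continuous functions. -/
theorem hasFDerivAt_postcomp {V W : Type*} [NormedAddCommGroup V] [NormedSpace ℝ V]
    [NormedAddCommGroup W] [NormedSpace ℝ W] {F : V → W} (hF : ContDiff ℝ 1 F) (u : C(K, V)) :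
    HasFDerivAt (fun u : C(K, V) => (⟨F, hF.continuous⟩ : C(V, W)).comp u)
      (pointwiseApply K V W
        ((⟨fderiv ℝ F, hF.continuous_fderiv one_ne_zero⟩ : C(V, V →L[ℝ] W)).comp u)) u := by
  rw [hasFDerivAt_iff_isLittleO_nhds_zero, Asymptotics.isLittleO_iff]
  intro ε hε
  have hc : Continuous fun u : C(K, V) =>
      (⟨fderiv ℝ F, hF.continuous_fderiv one_ne_zero⟩ : C(V, V →L[ℝ] W)).comp u :=
    ContinuousMap.continuous_postcomp _
  obtain ⟨δ, hδ, h⟩ := (Metric.continuous_iff (α := C(K, V)) (β := C(K, V →L[ℝ] W))).1 hc u ε hε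
  filter_upwards [Metric.ball_mem_nhds (0 : C(K, V)) hδ] with k hk
  rw [ContinuousMap.norm_le _ (by positivity)]
  intro t
  have key := (convex_ball (u t) δ).norm_image_sub_le_of_norm_hasFDerivWithin_le' (f := F)
    (f' := fderiv ℝ F) (φ := fderiv ℝ F (u t)) (C := ε) (x := u t) (y := u t + k t)
    (fun y _ => ((hF.differentiable one_ne_zero) y).hasFDerivAt.hasFDerivWithinAt)
    (fun y hy => ?_) (Metric.mem_ball_self hδ) ?_
  · simp only [add_sub_cancel_left] at key
    refine key.trans (mul_le_mul_of_nonneg_left (k.norm_coe_le_norm t) hε.le)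
  -- Shifting `u` by the constant `y - u t` produces a function within `δ` of `u` with value `y` at
  -- `t`. Continuity of composition with `fderiv ℝ F`, in the sup norm, thus bounds `F'(y) - F'(u
  -- t)` by an `ε` that does not depend on `t`.
  · have hy' : dist (u + ContinuousMap.const K (y - u t)) u < δ := by
      rw [dist_eq_norm, add_sub_cancel_left]
      refine lt_of_le_of_lt ((ContinuousMap.norm_le _ (norm_nonneg (y - u t))).2 (fun s => le_rfl))
        ?_
      simpa [dist_eq_norm] using hy
    have := (ContinuousMap.dist_lt_iff hε).1 (h _ hy') t
    simpa [dist_eq_norm] using this.le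
  · have : ‖k‖ < δ := by simpa using hk
    simpa using (k.norm_coe_le_norm t).trans_lt this

/-- Induction on `n`: the derivative of composition with `F` is composition with `fderiv ℝ F`,
followed by the continuous linear map `pointwiseApply`. The target changes from `W` to `V →L[ℝ] W`
at each step, so `W` is quantified inside the induction; a common universe for `V` and `W` keeps the
new target in range. -/
theorem contDiff_postcomp_nat {V : Type u} [NormedAddCommGroup V] [NormedSpace ℝ V] (n : ℕ) :
    ∀ {W : Type u} [NormedAddCommGroup W] [NormedSpace ℝ W] {F : V → W} (hF : ContDiff ℝ n F),
    ContDiff ℝ n (fun u : C(K, V) => (⟨F, hF.continuous⟩ : C(V, W)).comp u) := by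
  induction n with
  | zero =>
    intro W _ _ F hF
    exact contDiff_zero.2 (ContinuousMap.continuous_postcomp _)
  | succ n ih =>
    intro W _ _ F hF
    have h1 : ContDiff ℝ 1 F := hF.of_le (by norm_cast; omega)
    refine (contDiff_succ_iff_hasFDerivAt (n := n)).2 ⟨_, ?_, fun u => hasFDerivAt_postcomp h1 u⟩
    exact (pointwiseApply K V W).contDiff.comp
      (ih (F := fderiv ℝ F) (hF.fderiv_right (m := n) (by norm_cast)))

/-- Composition with a smooth map is smooth on spaces of continuous functions. -/
theorem contDiff_postcomp {V W : Type u} [NormedAddCommGroup V] [NormedSpace ℝ V]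
    [NormedAddCommGroup W] [NormedSpace ℝ W] {F : V → W} (hF : ContDiff ℝ ∞ F) :
    ContDiff ℝ ∞ (fun u : C(K, V) => (⟨F, hF.continuous⟩ : C(V, W)).comp u) :=
  contDiff_infty.2 fun n => contDiff_postcomp_nat n (contDiff_infty.1 hF n)

end Composition

/-! ### The primitive as a bounded operator -/

section Primitive

variable {V : Type*} [NormedAddCommGroup V] [NormedSpace ℝ V]

/-- The interval `[-1, 1]`. -/
abbrev UnitBall : Set ℝ := Icc (-1 : ℝ) 1

/-- A continuous function on `[-1, 1]`, extended to the line by constants. -/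
noncomputable def extendLine (u : C(UnitBall, V)) (t : ℝ) : V :=
  IccExtend (by norm_num : (-1 : ℝ) ≤ 1) u t

omit [NormedSpace ℝ V] in
theorem continuous_extendLine (u : C(UnitBall, V)) : Continuous (extendLine u) :=
  u.continuous.Icc_extend'

omit [NormedSpace ℝ V] in
theorem extendLine_of_mem (u : C(UnitBall, V)) {t : ℝ} (ht : t ∈ UnitBall) :
    extendLine u t = u ⟨t, ht⟩ := IccExtend_of_mem _ _ ht

omit [NormedSpace ℝ V] in
theorem norm_extendLine_le (u : C(UnitBall, V)) (t : ℝ) : ‖extendLine u t‖ ≤ ‖u‖ :=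
  u.norm_coe_le_norm _

variable (V) in
/-- The primitive vanishing at `0`, as a continuous operator on `C([-1, 1], V)`. -/
noncomputable def primitive : C(UnitBall, V) →L[ℝ] C(UnitBall, V) :=
  LinearMap.mkContinuous
    { toFun := fun u => ⟨fun t => ∫ τ in (0 : ℝ)..t, extendLine u τ,
        (intervalIntegral.continuous_primitive
          (fun a b => (continuous_extendLine u).intervalIntegrable a b) 0).comp
          continuous_subtype_val⟩
      map_add' := fun u v => by
        ext t
        simp only [ContinuousMap.coe_mk, ContinuousMap.add_apply]
        rw [← intervalIntegral.integral_add ((continuous_extendLine u).intervalIntegrable _ _)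
          ((continuous_extendLine v).intervalIntegrable _ _)]
        rfl
      map_smul' := fun c u => by
        ext t
        simp only [ContinuousMap.coe_mk, ContinuousMap.smul_apply, RingHom.id_apply]
        rw [← intervalIntegral.integral_smul]
        rfl } 1
    (fun u => by
      rw [one_mul, ContinuousMap.norm_le _ (norm_nonneg _)]
      intro t
      refine (intervalIntegral.norm_integral_le_of_norm_le_const
        (fun x _ => norm_extendLine_le u x)).trans ?_
      have h1 := t.2.1
      have h2 := t.2.2
      have : |(t : ℝ) - 0| ≤ 1 := by rw [sub_zero]; exact abs_le.2 ⟨h1, h2⟩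
      exact mul_le_of_le_one_right (norm_nonneg _) this)

end Primitive

/-! ### Smoothness of implicit functions near the base point -/

section Implicit

variable {E₁ E₂ F : Type*} [NormedAddCommGroup E₁] [NormedSpace ℝ E₁] [CompleteSpace E₁]
  [NormedAddCommGroup E₂] [NormedSpace ℝ E₂] [CompleteSpace E₂]
  [NormedAddCommGroup F] [NormedSpace ℝ F] [CompleteSpace F]

/-- The implicit function of a smooth equation is smooth in a neighbourhood of the base point. -/
theorem eventually_contDiffAt_implicitFunction {f : E₁ × E₂ → F} (hf : ContDiff ℝ ∞ f)
    {u : E₁ × E₂} (hi : (fderiv ℝ f u ∘L .inr ℝ E₁ E₂).IsInvertible) (hu : f u = 0) :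
    ∀ᶠ x in 𝓝 u.1, ContDiffAt ℝ ∞ (hf.contDiffAt.implicitFunction (by simp) hi) x := by
  set ψ := (hf.contDiffAt (x := u)).implicitFunction (by simp) hi with hψ
  have h0 : ψ u.1 = u.2 := hf.contDiffAt.implicitFunction_apply_self (by simp) hi
  have hs : ContDiffAt ℝ ∞ ψ u.1 := hf.contDiffAt.contDiffAt_implicitFunction (by simp) hi
  have h1 : ∀ᶠ x in 𝓝 u.1, ContDiffAt ℝ 1 ψ x := (hs.of_le (by simp)).eventually (by simp)
  have h2 : ∀ᶠ x in 𝓝 u.1, f (x, ψ x) = 0 := by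
    filter_upwards [hf.contDiffAt.eventually_apply_implicitFunction (u := u) (by simp) hi] with x hx
    rw [← hu]; exact hx
  have h3 : ∀ᶠ x in 𝓝 u.1, (fderiv ℝ f (x, ψ x) ∘L .inr ℝ E₁ E₂).IsInvertible := by
    have hc : ContinuousAt (fun x => fderiv ℝ f (x, ψ x) ∘L .inr ℝ E₁ E₂) u.1 := by
      have h4 : ContinuousAt (fun x => fderiv ℝ f (x, ψ x)) u.1 :=
        (hf.continuous_fderiv (by simp)).continuousAt.comp
          (continuousAt_id.prodMk hs.continuousAt)
      exact h4.clm_comp continuousAt_const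
    obtain ⟨e, he⟩ := hi
    have hn : ContinuousAt (fun x => fderiv ℝ f (x, ψ x) ∘L .inr ℝ E₁ E₂) u.1 := hc
    have hm : range ((↑) : (E₂ ≃L[ℝ] F) → E₂ →L[ℝ] F) ∈
        𝓝 (fderiv ℝ f (u.1, ψ u.1) ∘L .inr ℝ E₁ E₂) := by
      rw [h0]
      rw [show fderiv ℝ f (u.1, u.2) ∘L .inr ℝ E₁ E₂ = (e : E₂ →L[ℝ] F) from he.symm]
      exact e.nhds
    filter_upwards [hn.eventually hm] with x hx
    exact hx
  -- Being `C^∞` at `u.1` only gives, for each finite `n`, a neighbourhood where `ψ` is `C^n`. To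
  -- obtain one neighbourhood for all orders, the implicit function theorem is applied afresh at
  -- `(x, ψ x)`; by local uniqueness the new implicit function coincides with `ψ` near `x`.
  filter_upwards [h1, h2.eventually_nhds, h3] with x hx1 hx2 hx3
  have hs' := hf.contDiffAt.contDiffAt_implicitFunction (u := (x, ψ x)) (by simp) hx3
  refine hs'.congr_of_eventuallyEq ?_
  have := hf.contDiffAt.eventually_apply_eq_iff_implicitFunction (u := (x, ψ x)) (by simp) hx3
  have ht : Tendsto (fun y => (y, ψ y)) (𝓝 x) (𝓝 (x, ψ x)) :=
    continuousAt_id.prodMk hx1.continuousAt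
  filter_upwards [ht.eventually this, hx2] with y hy1 hy2
  exact (hy1.1 (hy2.trans hx2.self_of_nhds.symm)).symm

end Implicit

/-! ### Smooth local flows from the implicit function theorem -/

section LocalFlow

universe u
variable {V : Type u} [NormedAddCommGroup V] [NormedSpace ℝ V]

variable (V) in
/-- The constant functions, as a continuous linear map into `C([-1, 1], V)`. -/
noncomputable def constBall : V →L[ℝ] C(UnitBall, V) :=
  LinearMap.mkContinuous
    { toFun := fun v => ContinuousMap.const _ v
      map_add' := fun _ _ => by ext; simp
      map_smul' := fun _ _ => by ext; simp } 1
    (fun v => by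
      rw [one_mul]
      exact (ContinuousMap.norm_le _ (norm_nonneg v)).2 fun t => le_rfl)

@[simp]
theorem constBall_apply (v : V) (t : UnitBall) : constBall V v t = v := rfl

/-- The defect of the integral equation `u(t) = v + s ∫₀ᵗ X(u(τ)) dτ`. -/
noncomputable def picardDefect (X : C(V, V)) (q : (ℝ × V) × C(UnitBall, V)) : C(UnitBall, V) :=
  q.2 - constBall V q.1.2 - q.1.1 • primitive V (X.comp q.2)

theorem contDiff_picardDefect {X : C(V, V)} (hX : ContDiff ℝ ∞ X) :
    ContDiff ℝ ∞ (picardDefect X) := by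
  have h1 : ContDiff ℝ ∞ (fun u : C(UnitBall, V) => X.comp u) := contDiff_postcomp hX
  have h2 : ContDiff ℝ ∞ (fun q : (ℝ × V) × C(UnitBall, V) => primitive V (X.comp q.2)) :=
    (primitive V).contDiff.comp (h1.comp contDiff_snd)
  exact (contDiff_snd.sub ((constBall V).contDiff.comp (contDiff_snd.comp contDiff_fst))).sub
    ((contDiff_fst.comp contDiff_fst).smul h2)

theorem picardDefect_eq_zero_iff (X : C(V, V)) (s : ℝ) (v : V) (u : C(UnitBall, V)) :
    picardDefect X ((s, v), u) = 0 ↔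
      ∀ t : UnitBall, u t = v + s • ∫ τ in (0 : ℝ)..t, X (extendLine u τ) := by
  rw [ContinuousMap.ext_iff]
  refine forall_congr' fun t => ?_
  have : primitive V (X.comp u) t = ∫ τ in (0 : ℝ)..t, X (extendLine u τ) := rfl
  simp only [picardDefect, ContinuousMap.sub_apply, ContinuousMap.smul_apply, constBall_apply,
    ContinuousMap.zero_apply, this]
  rw [sub_sub, sub_eq_zero]

/-- For `s = 0` the vector field drops out and the defect is `u - v`, whose derivative in `u` is the
identity. Carrying the time scale `s` as a parameter is what makes the implicit function theorem
applicable. -/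
theorem picardDefect_fderiv_invertible {X : C(V, V)} (hX : ContDiff ℝ ∞ X) (v : V) :
    (fderiv ℝ (picardDefect X) ((0, v), constBall V v) ∘L
      .inr ℝ (ℝ × V) C(UnitBall, V)).IsInvertible := by
  have h1 : HasFDerivAt (fun u : C(UnitBall, V) => picardDefect X ((0, v), u))
      (fderiv ℝ (picardDefect X) ((0, v), constBall V v) ∘L .inr ℝ (ℝ × V) C(UnitBall, V))
      (constBall V v) :=
    (((contDiff_picardDefect hX).differentiable (by simp)) _).hasFDerivAt.comp _
      (hasFDerivAt_prodMk_right _ _)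
  have h2 : (fun u : C(UnitBall, V) => picardDefect X ((0, v), u)) =
      fun u => u - constBall V v := by
    ext1 u
    simp [picardDefect]
  rw [h2] at h1
  have h3 := h1.unique ((hasFDerivAt_id (constBall V v)).sub_const (constBall V v))
  rw [h3]
  exact ⟨ContinuousLinearEquiv.refl ℝ _, rfl⟩

variable [CompleteSpace V]

/-- The local flow of a smooth vector field exists and is smooth. -/
theorem exists_smooth_localFlow {X : V → V} (hX : ContDiff ℝ ∞ X) (v₀ : V) :
    ∃ ε > 0, ∃ U ∈ 𝓝 v₀, ∃ φ : ℝ × V → V,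
      (∀ s ∈ Ioo (-ε) ε, ∀ v ∈ U, ContDiffAt ℝ ∞ φ (s, v) ∧
        HasDerivAt (fun σ => φ (σ, v)) (X (φ (s, v))) s) ∧ ∀ v ∈ U, φ (0, v) = v := by
  set X' : C(V, V) := ⟨X, hX.continuous⟩ with hX'
  have hX2 : ContDiff ℝ ∞ X' := hX
  have hΦ := contDiff_picardDefect hX2
  have hinv := picardDefect_fderiv_invertible hX2 v₀
  have h0 : picardDefect X' ((0, v₀), constBall V v₀) = 0 := by simp [picardDefect]
  set ψ := (hΦ.contDiffAt (x := ((0, v₀), constBall V v₀))).implicitFunction (by simp) hinv with hψ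
  have hsm : ∀ᶠ x in 𝓝 ((0 : ℝ), v₀), ContDiffAt ℝ ∞ ψ x :=
    eventually_contDiffAt_implicitFunction hΦ hinv h0
  have hψ0 : ψ (0, v₀) = constBall V v₀ :=
    hΦ.contDiffAt.implicitFunction_apply_self (u := ((0, v₀), constBall V v₀)) (by simp) hinv
  have hz : ∀ᶠ x in 𝓝 ((0 : ℝ), v₀), picardDefect X' (x, ψ x) = 0 := by
    filter_upwards [hΦ.contDiffAt.eventually_apply_implicitFunction
      (u := ((0, v₀), constBall V v₀)) (by simp) hinv] with x hx
    rw [← h0]; exact hx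
  have hiff : ∀ᶠ q in 𝓝 (((0 : ℝ), v₀), constBall V v₀), picardDefect X' q = 0 ↔ ψ q.1 = q.2 := by
    filter_upwards [hΦ.contDiffAt.eventually_apply_eq_iff_implicitFunction
      (u := ((0, v₀), constBall V v₀)) (by simp) hinv] with q hq
    rw [← hq, h0]
  rw [nhds_prod_eq, eventually_prod_iff] at hiff
  obtain ⟨p1, hp1, p2, hp2, hiff⟩ := hiff
  obtain ⟨δ, hδ, hp2⟩ := Metric.eventually_nhds_iff_ball.1 hp2
  have hnear : ∀ᶠ x in 𝓝 ((0 : ℝ), v₀), ψ x ∈ Metric.ball (constBall V v₀) δ := by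
    have hc := hsm.self_of_nhds.continuousAt
    exact hc.eventually (by rw [hψ0]; exact Metric.ball_mem_nhds _ hδ)
  have hall := (hsm.and hz).and (hp1.and hnear)
  rw [nhds_prod_eq, eventually_prod_iff] at hall
  obtain ⟨q1, hq1, q2, hq2, hall⟩ := hall
  obtain ⟨ε, hε, hq1⟩ := Metric.eventually_nhds_iff_ball.1 hq1
  have hball : ∀ s : ℝ, |s| < ε → q1 s := fun s hs => hq1 s (by simpa using hs)
  have hfix : ∀ s : ℝ, |s| < ε → ∀ v, q2 v → ∀ t : UnitBall,
      ψ (s, v) t = v + s • ∫ τ in (0 : ℝ)..t, X (extendLine (ψ (s, v)) τ) := fun s hs v hv =>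
    (picardDefect_eq_zero_iff X' s v _).1 (hall (hball s hs) hv).1.2
  -- The rescaled curve `t ↦ ψ (s, v) (τ t)` solves the integral equation with time scale `τ s`. It
  -- stays in the `δ`-ball around the constant `v₀`, since it takes no values other than those of `ψ
  -- (s, v)`; uniqueness identifies it with `ψ (τ s, v)`. So the end value of `ψ (s, v)`, as a
  -- function of `s`, is an integral curve.
  have hscale : ∀ s : ℝ, |s| < ε → ∀ v, q2 v → ∀ τ : UnitBall,
      ψ (τ * s, v) ⟨1, by norm_num⟩ = ψ (s, v) τ := by
    intro s hs v hv τ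
    have hτ : |(τ : ℝ)| ≤ 1 := abs_le.2 ⟨τ.2.1, τ.2.2⟩
    have hm : ∀ t : ℝ, |t| ≤ 1 → (τ : ℝ) * t ∈ UnitBall := fun t ht => by
      refine abs_le.1 ?_
      rw [abs_mul]
      exact mul_le_one₀ hτ (abs_nonneg _) ht
    let r : C(UnitBall, UnitBall) :=
      ⟨fun t => ⟨τ * t, hm _ (abs_le.2 ⟨t.2.1, t.2.2⟩)⟩, by fun_prop⟩
    set w : C(UnitBall, V) := (ψ (s, v)).comp r with hw
    have hτs : |(τ : ℝ) * s| < ε := by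
      rw [abs_mul]
      exact (mul_le_of_le_one_left (abs_nonneg _) hτ).trans_lt hs
    have hwball : p2 w := by
      refine hp2 _ ?_
      have := (hall (hball s hs) hv).2.2
      rw [Metric.mem_ball, ContinuousMap.dist_lt_iff hδ] at this ⊢
      exact fun t => this (r t)
    have hwz : picardDefect X' ((τ * s, v), w) = 0 := by
      rw [picardDefect_eq_zero_iff]
      intro t
      have ht : |(t : ℝ)| ≤ 1 := abs_le.2 ⟨t.2.1, t.2.2⟩
      have e1 : w t = ψ (s, v) (r t) := rfl
      rw [e1, hfix s hs v hv (r t)]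
      congr 1
      have e2 : ((r t : UnitBall) : ℝ) = τ * t := rfl
      rw [e2, mul_comm (τ : ℝ) s, mul_smul]
      congr 1
      have e3 : ∫ x in (0 : ℝ)..t, X' (extendLine w x) =
          ∫ x in (0 : ℝ)..t, X (extendLine (ψ (s, v)) (τ * x)) := by
        refine intervalIntegral.integral_congr fun x hx => ?_
        have hx1 : |x| ≤ 1 := by
          have := abs_sub_left_of_mem_uIcc hx
          simp only [sub_zero] at this
          exact this.trans ht
        change X _ = X _
        rw [extendLine_of_mem _ (hm x hx1), extendLine_of_mem _ (abs_le.1 hx1)]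
        rfl
      rw [e3, intervalIntegral.smul_integral_comp_mul_left (fun x => X (extendLine (ψ (s, v)) x)),
        mul_zero]
    have h5 := (hiff (hall (hball _ hτs) hv).2.1 hwball).1 hwz
    change ψ (τ * s, v) = w at h5
    rw [h5]
    change ψ (s, v) _ = _
    congr 1
    exact Subtype.ext (mul_one _)
  refine ⟨ε, hε, {v | q2 v}, hq2, fun x => ψ x ⟨1, by norm_num⟩, ?_, ?_⟩
  · intro s hs v hv
    have hs' : |s| < ε := abs_lt.2 hs
    refine ⟨?_, ?_⟩
    · exact ((ContinuousMap.evalCLM ℝ (⟨1, by norm_num⟩ : UnitBall)).contDiff.contDiffAt).comp _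
        (hall (hball s hs') hv).1.1
    -- With a fixed scale `c > |s|`, the flow at all times `σ` near `s` is read off the single curve
    -- `ψ (c, v)` at `σ / c`. Its integral equation can then be differentiated in the upper limit;
    -- the factor `c` cancels the `1 / c` of the chain rule.
    · obtain ⟨c, hc1, hc2⟩ := exists_between hs'
      have hc0 : 0 < c := (abs_nonneg s).trans_lt hc1
      have hcε : |c| < ε := by rwa [abs_of_pos hc0]
      have hmem : ∀ σ : ℝ, |σ| < c → σ / c ∈ UnitBall := fun σ hσ => by
        refine abs_le.1 ?_
        rw [abs_div, abs_of_pos hc0]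
        exact (div_le_one hc0).2 hσ.le
      have hval : ∀ σ : ℝ, ∀ hσ : |σ| < c,
          ψ (σ, v) ⟨1, by norm_num⟩ = ψ (c, v) ⟨σ / c, hmem σ hσ⟩ := fun σ hσ => by
        rw [← hscale c hcε v hv ⟨σ / c, hmem σ hσ⟩]
        simp only [div_mul_cancel₀ _ hc0.ne']
      have hev : (fun σ => ψ (σ, v) ⟨1, by norm_num⟩) =ᶠ[𝓝 s]
          fun σ => v + c • ∫ τ in (0 : ℝ)..(σ / c), X (extendLine (ψ (c, v)) τ) := by
        filter_upwards [(isOpen_lt continuous_abs continuous_const).mem_nhds hc1] with σ hσ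
        rw [hval σ hσ, hfix c hcε v hv]
      refine HasDerivAt.congr_of_eventuallyEq ?_ hev
      have hcont : Continuous fun τ => X (extendLine (ψ (c, v)) τ) :=
        hX.continuous.comp (continuous_extendLine _)
      have hd := (intervalIntegral.integral_hasDerivAt_right (hcont.intervalIntegrable 0 (s / c))
        (hcont.stronglyMeasurableAtFilter _ _) hcont.continuousAt).scomp s
        ((hasDerivAt_id s).div_const c)
      have hd2 := (hd.const_smul c).const_add v
      refine hd2.congr_deriv ?_
      change _ = X (ψ (s, v) _)
      rw [hval s hc1, extendLine_of_mem _ (hmem s hc1), smul_smul, mul_one_div_cancel hc0.ne',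
        one_smul]
  · intro v hv
    change ψ (0, v) _ = v
    rw [hfix 0 (by simpa using hε) v hv, zero_smul, add_zero]

end LocalFlow

/-! ### Integrals depending smoothly on parameters and endpoints -/

section ParametricIntegral

universe u
variable {P : Type} [NormedAddCommGroup P] [NormedSpace ℝ P]
  {W : Type u} [NormedAddCommGroup W] [NormedSpace ℝ W]

/-- An interval integral depending smoothly on parameters, as a function of the parameters and of
the endpoints, is smooth. -/
theorem contDiff_parametric_intervalIntegral {B : P × ℝ → W} (hB : ContDiff ℝ ∞ B) :
    ContDiff ℝ ∞ (fun q : P × ℝ × ℝ => ∫ t in q.2.1..q.2.2, B (q.1, t)) := by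
  -- The unused factor `W` in the domain only places domain and target in one universe, as
  -- `contDiff_postcomp` requires.
  let F : P × ℝ × W → W := fun x => B (x.1, x.2.1)
  have hF : ContDiff ℝ ∞ F :=
    hB.comp (contDiff_fst.prodMk (contDiff_fst.comp contDiff_snd))
  let e : C(UnitBall, P × ℝ × W) := ⟨fun t => (0, (t : ℝ), 0), by fun_prop⟩
  -- `Q (p, a, b)` is the affine path `t ↦ (p, a + (b - a) t, 0)`. The integral becomes `(b - a) ∫₀¹
  -- B(p, a + (b - a) τ) dτ`, which depends on `Q` through composition with `F`, the primitive, and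
  -- evaluation at `1`.
  let Q : P × ℝ × ℝ → C(UnitBall, P × ℝ × W) := fun q =>
    constBall (P × ℝ × W) (q.1, q.2.1, 0) + (q.2.2 - q.2.1) • e
  have hl : ContDiff ℝ ∞ fun q : P × ℝ × ℝ => q.2.2 - q.2.1 := by fun_prop
  have hQ : ContDiff ℝ ∞ Q := by
    refine ((constBall (P × ℝ × W)).contDiff.comp ?_).add (hl.smul contDiff_const)
    exact contDiff_fst.prodMk ((contDiff_fst.comp contDiff_snd).prodMk contDiff_const)
  have h1 := (ContinuousMap.evalCLM ℝ (⟨1, by norm_num⟩ : UnitBall)).contDiff.comp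
    ((primitive W).contDiff.comp ((contDiff_postcomp (K := UnitBall) hF).comp hQ))
  have h2 := hl.smul h1
  convert h2 using 1
  funext q
  obtain ⟨p, a, b⟩ := q
  change _ = (b - a) • ∫ τ in (0 : ℝ)..1,
    extendLine ((⟨F, hF.continuous⟩ : C(P × ℝ × W, W)).comp (Q (p, a, b))) τ
  have e3 : ∀ f : C(UnitBall, W), (∀ τ : UnitBall, f τ = B (p, a + (b - a) * τ)) →
      ∫ τ in (0 : ℝ)..1, extendLine f τ = ∫ τ in (0 : ℝ)..1, B (p, a + (b - a) * τ) := by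
    intro f hf
    refine intervalIntegral.integral_congr fun x hx => ?_
    rw [uIcc_of_le zero_le_one] at hx
    have hx1 : x ∈ UnitBall := ⟨by linarith [hx.1], hx.2⟩
    change extendLine f x = _
    rw [extendLine_of_mem _ hx1, hf]
  rw [e3, intervalIntegral.smul_integral_comp_add_mul (fun t => B (p, t))]
  · simp
  · intro τ
    simp [F, Q, e]

end ParametricIntegral

/-! ### Logarithmic derivatives in the chart at the identity -/

section LieGroupCalculus

variable {EG : Type*} [NormedAddCommGroup EG] [NormedSpace ℝ EG]
  {G : Type*} [TopologicalSpace G] [ChartedSpace EG G] [Group G]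

variable (EG G) in
/-- The preferred chart at the identity. -/
abbrev oneChart : OpenPartialHomeomorph G EG := chartAt EG (1 : G)

variable (EG G) in
/-- The coordinates of the identity in the preferred chart. -/
abbrev oneCoord : EG := oneChart EG G 1

omit [NormedSpace ℝ EG] in
theorem one_mem_oneChart : (1 : G) ∈ (oneChart EG G).source := mem_chart_source EG 1

omit [NormedSpace ℝ EG] in
theorem oneCoord_mem : oneCoord EG G ∈ (oneChart EG G).target := mem_chart_target EG 1

omit [NormedSpace ℝ EG] in
@[simp]
theorem oneChart_symm_oneCoord : (oneChart EG G).symm (oneCoord EG G) = 1 :=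
  (oneChart EG G).left_inv one_mem_oneChart

variable (EG G) in
/-- The multiplication in the preferred chart at the identity. -/
noncomputable def chartMul (q : EG × EG) : EG :=
  oneChart EG G ((oneChart EG G).symm q.1 * (oneChart EG G).symm q.2)

omit [NormedSpace ℝ EG] in
theorem chartMul_oneCoord_left {v : EG} (hv : v ∈ (oneChart EG G).target) :
    chartMul EG G (oneCoord EG G, v) = v := by
  simp [chartMul, (oneChart EG G).right_inv hv]

omit [NormedSpace ℝ EG] in
theorem chartMul_oneCoord_right {v : EG} (hv : v ∈ (oneChart EG G).target) :
    chartMul EG G (v, oneCoord EG G) = v := by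
  simp [chartMul, (oneChart EG G).right_inv hv]

section Smooth

variable {P : Type*} [NormedAddCommGroup P] [NormedSpace ℝ P]

theorem contDiffAt_oneChart_comp [IsManifold 𝓘(ℝ, EG) ∞ G] {F : P → G} {p : P}
    (hF : ContMDiffAt 𝓘(ℝ, P) 𝓘(ℝ, EG) ∞ F p) (hs : F p ∈ (oneChart EG G).source) :
    ContDiffAt ℝ ∞ (fun q => oneChart EG G (F q)) p := by
  rw [← contMDiffAt_iff_contDiffAt]
  have h : ContMDiffAt 𝓘(ℝ, EG) 𝓘(ℝ, EG) ∞ (oneChart EG G) (F p) :=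
    contMDiffOn_chart.contMDiffAt ((oneChart EG G).open_source.mem_nhds hs)
  exact h.comp p hF

theorem contMDiffAt_oneChart_symm [IsManifold 𝓘(ℝ, EG) ∞ G] {v : EG}
    (hv : v ∈ (oneChart EG G).target) :
    ContMDiffAt 𝓘(ℝ, EG) 𝓘(ℝ, EG) ∞ (oneChart EG G).symm v :=
  contMDiffOn_chart_symm.contMDiffAt ((oneChart EG G).open_target.mem_nhds hv)

theorem ContMDiffAt.eventually_mem_oneChart {F : P → G} {p : P}
    (hF : ContMDiffAt 𝓘(ℝ, P) 𝓘(ℝ, EG) ∞ F p) (hs : F p ∈ (oneChart EG G).source) :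
    ∀ᶠ q in 𝓝 p, F q ∈ (oneChart EG G).source :=
  hF.continuousAt.eventually ((oneChart EG G).open_source.mem_nhds hs)

end Smooth

variable [LieGroup 𝓘(ℝ, EG) ∞ G]

instance : IsManifold 𝓘(ℝ, EG) ∞ G := (inferInstance : ContMDiffMul 𝓘(ℝ, EG) ∞ G).toIsManifold

theorem contDiffAt_chartMul {q : EG × EG} (h1 : q.1 ∈ (oneChart EG G).target)
    (h2 : q.2 ∈ (oneChart EG G).target)
    (h : (oneChart EG G).symm q.1 * (oneChart EG G).symm q.2 ∈ (oneChart EG G).source) :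
    ContDiffAt ℝ ∞ (chartMul EG G) q := by
  refine contDiffAt_oneChart_comp (F := fun q : EG × EG =>
    (oneChart EG G).symm q.1 * (oneChart EG G).symm q.2) ?_ h
  exact ((contMDiffAt_oneChart_symm h1).comp q contDiff_fst.contMDiff.contMDiffAt).mul
    ((contMDiffAt_oneChart_symm h2).comp q contDiff_snd.contMDiff.contMDiffAt)

theorem contDiffAt_chartMul_left {v : EG} (hv : v ∈ (oneChart EG G).target) :
    ContDiffAt ℝ ∞ (chartMul EG G) (oneCoord EG G, v) :=
  contDiffAt_chartMul oneCoord_mem hv (by simpa using (oneChart EG G).map_target hv)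

theorem contDiffAt_chartMul_right {v : EG} (hv : v ∈ (oneChart EG G).target) :
    ContDiffAt ℝ ∞ (chartMul EG G) (v, oneCoord EG G) :=
  contDiffAt_chartMul hv oneCoord_mem (by simpa using (oneChart EG G).map_target hv)

/-- The derivative of the multiplication at `(1, 1)` is the addition. -/
theorem hasFDerivAt_chartMul_one :
    HasFDerivAt (chartMul EG G) (.fst ℝ EG EG + .snd ℝ EG EG)
      (oneCoord EG G, oneCoord EG G) := by
  have h := ((contDiffAt_chartMul_left (EG := EG) (G := G) oneCoord_mem).differentiableAt
    (by simp)).hasFDerivAt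
  set L := fderiv ℝ (chartMul EG G) (oneCoord EG G, oneCoord EG G)
  have h1 : L ∘L .inl ℝ EG EG = .id ℝ EG := by
    refine (HasFDerivAt.comp (f := fun e => (e, oneCoord EG G)) (oneCoord EG G) h
      (hasFDerivAt_prodMk_left (oneCoord EG G) (oneCoord EG G))).unique
      ((hasFDerivAt_id _).congr_of_eventuallyEq ?_)
    filter_upwards [(oneChart EG G).open_target.mem_nhds oneCoord_mem] with v hv
    exact chartMul_oneCoord_right hv
  have h2 : L ∘L .inr ℝ EG EG = .id ℝ EG := by
    refine (HasFDerivAt.comp (f := fun e => (oneCoord EG G, e)) (oneCoord EG G) h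
      (hasFDerivAt_prodMk_right (oneCoord EG G) (oneCoord EG G))).unique
      ((hasFDerivAt_id _).congr_of_eventuallyEq ?_)
    filter_upwards [(oneChart EG G).open_target.mem_nhds oneCoord_mem] with v hv
    exact chartMul_oneCoord_left hv
  have hL : ContinuousLinearMap.fst ℝ EG EG + ContinuousLinearMap.snd ℝ EG EG = L := by
    refine ContinuousLinearMap.ext fun q : EG × EG => ?_
    have e1 : L (q.1, 0) = q.1 := DFunLike.congr_fun h1 q.1
    have e2 : L (0, q.2) = q.2 := DFunLike.congr_fun h2 q.2
    calc q.1 + q.2 = L (q.1, 0) + L (0, q.2) := by rw [e1, e2]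
      _ = L q := by rw [← map_add]; simp
  rw [hL]
  exact h

variable (EG G) in
/-- The differential at the identity of the right translation by the element with coordinates `v`,
in the preferred chart. -/
noncomputable def rightTrans (v : EG) : EG →L[ℝ] EG :=
  fderiv ℝ (fun a => chartMul EG G (a, v)) (oneCoord EG G)

theorem hasFDerivAt_rightTrans {v : EG} (hv : v ∈ (oneChart EG G).target) :
    HasFDerivAt (fun a => chartMul EG G (a, v)) (rightTrans EG G v) (oneCoord EG G) := by
  refine DifferentiableAt.hasFDerivAt ?_
  exact DifferentiableAt.comp (f := fun a => (a, v)) (oneCoord EG G)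
    ((contDiffAt_chartMul_left hv).differentiableAt (by simp))
    (differentiableAt_id.prodMk (differentiableAt_const v))

theorem rightTrans_eq {v : EG} (hv : v ∈ (oneChart EG G).target) :
    rightTrans EG G v = fderiv ℝ (chartMul EG G) (oneCoord EG G, v) ∘L .inl ℝ EG EG :=
  (HasFDerivAt.comp (f := fun a => (a, v)) (oneCoord EG G)
    ((contDiffAt_chartMul_left hv).differentiableAt (by simp)).hasFDerivAt
    (hasFDerivAt_prodMk_left (oneCoord EG G) v)).fderiv

theorem contDiffAt_rightTrans {v : EG} (hv : v ∈ (oneChart EG G).target) :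
    ContDiffAt ℝ ∞ (rightTrans EG G) v := by
  refine ContDiffAt.fderiv (f := fun v a => chartMul EG G (a, v)) (n := ∞) ?_ contDiffAt_const
    (by simp)
  exact (contDiffAt_chartMul_left hv).comp (v, oneCoord EG G)
    (contDiff_snd.prodMk contDiff_fst).contDiffAt

theorem rightTrans_oneCoord : rightTrans EG G (oneCoord EG G) = .id ℝ EG := by
  rw [rightTrans_eq oneCoord_mem, hasFDerivAt_chartMul_one.fderiv]
  ext; simp

/-- Right translation by the inverse element undoes right translation, so in the chart its
derivative is a left inverse of `rightTrans EG G v`. -/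
theorem rightTrans_injective {v : EG} (hv : v ∈ (oneChart EG G).target) :
    Function.Injective (rightTrans EG G v) := by
  let τ : EG → EG := fun b => oneChart EG G ((oneChart EG G).symm b * ((oneChart EG G).symm v)⁻¹)
  have hτ : ContDiffAt ℝ ∞ τ v := by
    refine contDiffAt_oneChart_comp ((contMDiffAt_oneChart_symm hv).mul contMDiffAt_const) ?_
    simp
  have h1 := (hτ.differentiableAt (by simp)).hasFDerivAt
  rw [← chartMul_oneCoord_left hv] at h1
  have h2 := HasFDerivAt.comp (f := fun a => chartMul EG G (a, v)) (oneCoord EG G) h1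
    (hasFDerivAt_rightTrans hv)
  have h3 : τ ∘ (fun a => chartMul EG G (a, v)) =ᶠ[𝓝 (oneCoord EG G)] id := by
    have hc : ContMDiffAt 𝓘(ℝ, EG) 𝓘(ℝ, EG) ∞
        (fun a => (oneChart EG G).symm a * (oneChart EG G).symm v) (oneCoord EG G) :=
      (contMDiffAt_oneChart_symm oneCoord_mem).mul contMDiffAt_const
    filter_upwards [(oneChart EG G).open_target.mem_nhds oneCoord_mem,
      ContMDiffAt.eventually_mem_oneChart hc (by simpa using (oneChart EG G).map_target hv)]
      with a ha ha2
    simp only [τ, chartMul, Function.comp, id]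
    rw [(oneChart EG G).left_inv ha2, mul_inv_cancel_right, (oneChart EG G).right_inv ha]
  have h4 := h2.unique ((hasFDerivAt_id _).congr_of_eventuallyEq h3)
  intro a b hab
  have ea := DFunLike.congr_fun h4 a
  have eb := DFunLike.congr_fun h4 b
  simp only [ContinuousLinearMap.comp_apply, ContinuousLinearMap.id_apply] at ea eb
  rw [← ea, ← eb, hab]

section Velocity

variable {EH : Type*} [NormedAddCommGroup EH] [NormedSpace ℝ EH]
  {H : Type*} [TopologicalSpace H] [ChartedSpace EH H] [Group H] [LieGroup 𝓘(ℝ, EH) ∞ H]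
  {EK : Type*} [NormedAddCommGroup EK] [NormedSpace ℝ EK]
  {K : Type*} [TopologicalSpace K] [ChartedSpace EK K] [Group K] [LieGroup 𝓘(ℝ, EK) ∞ K]

omit [LieGroup 𝓘(ℝ, EG) ∞ G] in
variable (EG EH) in
/-- The differential at the identity of a homomorphism of Lie groups. -/
noncomputable def dHom (θ : G →* H) : EG →L[ℝ] EH :=
  fderiv ℝ (fun a => oneChart EH H (θ ((oneChart EG G).symm a))) (oneCoord EG G)

theorem hasFDerivAt_dHom {θ : G →* H} (hθ : ContMDiff 𝓘(ℝ, EG) 𝓘(ℝ, EH) ∞ θ) :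
    HasFDerivAt (fun a => oneChart EH H (θ ((oneChart EG G).symm a))) (dHom EG EH θ)
      (oneCoord EG G) := by
  refine (ContDiffAt.differentiableAt (n := ∞) ?_ (by simp)).hasFDerivAt
  refine contDiffAt_oneChart_comp (F := fun a => θ ((oneChart EG G).symm a))
    (hθ.contMDiffAt.comp _ (contMDiffAt_oneChart_symm oneCoord_mem)) ?_
  simp

/-- Since `θ 1 = 1`, the preferred chart used by `mfderiv` at the target is again the chart at the
identity. -/
theorem mfderiv_one_eq_dHom {θ : G →* H} (hθ : ContMDiff 𝓘(ℝ, EG) 𝓘(ℝ, EH) ∞ θ) (Y : EG) :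
    (mfderiv 𝓘(ℝ, EG) 𝓘(ℝ, EH) θ 1 Y : EH) = dHom EG EH θ Y := by
  have h : MDifferentiableAt 𝓘(ℝ, EG) 𝓘(ℝ, EH) θ 1 := hθ.mdifferentiable (by simp) 1
  have h2 : HasFDerivAt (𝕜 := ℝ) (E := EG) (F := EH)
      (fun a => chartAt EH (θ 1) (θ ((oneChart EG G).symm a)))
      (mfderiv 𝓘(ℝ, EG) 𝓘(ℝ, EH) θ 1 : EG →L[ℝ] EH) (oneCoord EG G) :=
    h.hasMFDerivAt.2.hasFDerivAt (by simp)
  rw [map_one] at h2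
  have h3 := HasFDerivAt.unique (𝕜 := ℝ) (E := EG) (F := EH) h2 (hasFDerivAt_dHom hθ)
  exact congrArg (fun L : EG →L[ℝ] EH => L Y) h3

omit [LieGroup 𝓘(ℝ, EG) ∞ G] in
theorem mfderiv_curve_one {c : ℝ → G} {x : ℝ} (hc : ContMDiffAt 𝓘(ℝ, ℝ) 𝓘(ℝ, EG) ∞ c x)
    (h1 : c x = 1) :
    (mfderiv 𝓘(ℝ, ℝ) 𝓘(ℝ, EG) c x (1 : ℝ) : EG) = deriv (fun s => oneChart EG G (c s)) x := by
  have h : MDifferentiableAt 𝓘(ℝ, ℝ) 𝓘(ℝ, EG) c x := hc.mdifferentiableAt (by simp)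
  have h2 : HasFDerivAt (𝕜 := ℝ) (E := ℝ) (F := EG) (fun s => chartAt EG (c x) (c s))
      (mfderiv 𝓘(ℝ, ℝ) 𝓘(ℝ, EG) c x : ℝ →L[ℝ] EG) x :=
    h.hasMFDerivAt.2.hasFDerivAt (by simp)
  rw [h1] at h2
  have h3 : HasDerivAt (fun s => oneChart EG G (c s))
      (mfderiv 𝓘(ℝ, ℝ) 𝓘(ℝ, EG) c x (1 : ℝ) : EG) x := HasFDerivAt.hasDerivAt (F := EG) h2
  exact h3.deriv.symm

theorem contMDiffAt_mul_const {u : ℝ → G} {x : ℝ} (hu : ContMDiffAt 𝓘(ℝ, ℝ) 𝓘(ℝ, EG) ∞ u x)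
    (g : G) : ContMDiffAt 𝓘(ℝ, ℝ) 𝓘(ℝ, EG) ∞ (fun s => u s * g) x :=
  hu.mul contMDiffAt_const

/-- The logarithmic derivative, in the preferred chart at the identity. -/
theorem hasDerivAt_rightLogDeriv {u : ℝ → G} {x : ℝ}
    (hu : ContMDiffAt 𝓘(ℝ, ℝ) 𝓘(ℝ, EG) ∞ u x) :
    HasDerivAt (fun s => oneChart EG G (u s * (u x)⁻¹)) (rightLogDeriv EG u x) x := by
  have h := contMDiffAt_mul_const hu (u x)⁻¹
  rw [rightLogDeriv, mfderiv_curve_one h (by simp)]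
  exact ((contDiffAt_oneChart_comp h (by simp)).differentiableAt
    (by simp)).hasDerivAt

theorem rightLogDeriv_eq {u : ℝ → G} {x : ℝ} {a : EG}
    (hu : ContMDiffAt 𝓘(ℝ, ℝ) 𝓘(ℝ, EG) ∞ u x)
    (h : HasDerivAt (fun s => oneChart EG G (u s * (u x)⁻¹)) a x) :
    rightLogDeriv EG u x = a :=
  (hasDerivAt_rightLogDeriv hu).unique h

theorem hasDerivAt_oneChart_mul {c d : ℝ → G} {x : ℝ} {v w : EG}
    (hc : ContMDiffAt 𝓘(ℝ, ℝ) 𝓘(ℝ, EG) ∞ c x) (hd : ContMDiffAt 𝓘(ℝ, ℝ) 𝓘(ℝ, EG) ∞ d x)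
    (hc1 : c x = 1) (hd1 : d x = 1)
    (hv : HasDerivAt (fun s => oneChart EG G (c s)) v x)
    (hw : HasDerivAt (fun s => oneChart EG G (d s)) w x) :
    HasDerivAt (fun s => oneChart EG G (c s * d s)) (v + w) x := by
  have h0 := hasFDerivAt_chartMul_one (EG := EG) (G := G)
  have h : HasFDerivAt (chartMul EG G) (.fst ℝ EG EG + .snd ℝ EG EG)
      (oneChart EG G (c x), oneChart EG G (d x)) := by rw [hc1, hd1]; exact h0
  have h2 := h.comp_hasDerivAt x (hv.prodMk hw)
  refine (h2.congr_deriv (by simp)).congr_of_eventuallyEq ?_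
  filter_upwards [ContMDiffAt.eventually_mem_oneChart hc (by rw [hc1]; exact one_mem_oneChart),
    ContMDiffAt.eventually_mem_oneChart hd (by rw [hd1]; exact one_mem_oneChart)] with s hs1 hs2
  simp only [chartMul, Function.comp]
  rw [(oneChart EG G).left_inv hs1, (oneChart EG G).left_inv hs2]

theorem hasDerivAt_oneChart_hom {θ : G →* H} (hθ : ContMDiff 𝓘(ℝ, EG) 𝓘(ℝ, EH) ∞ θ)
    {c : ℝ → G} {x : ℝ} {v : EG} (hc : ContMDiffAt 𝓘(ℝ, ℝ) 𝓘(ℝ, EG) ∞ c x) (hc1 : c x = 1)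
    (hv : HasDerivAt (fun s => oneChart EG G (c s)) v x) :
    HasDerivAt (fun s => oneChart EH H (θ (c s))) (dHom EG EH θ v) x := by
  have h := hasFDerivAt_dHom hθ
  have h' : HasFDerivAt (fun a => oneChart EH H (θ ((oneChart EG G).symm a))) (dHom EG EH θ)
    (oneChart EG G (c x)) := by rw [hc1]; exact h
  refine (h'.comp_hasDerivAt x hv).congr_of_eventuallyEq ?_
  filter_upwards [ContMDiffAt.eventually_mem_oneChart hc (by rw [hc1]; exact one_mem_oneChart)]
    with s hs
  simp only [Function.comp]
  rw [(oneChart EG G).left_inv hs]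

theorem dHom_comp {θ : G →* H} (hθ : ContMDiff 𝓘(ℝ, EG) 𝓘(ℝ, EH) ∞ θ) {η : H →* K}
    (hη : ContMDiff 𝓘(ℝ, EH) 𝓘(ℝ, EK) ∞ η) (Y : EG) :
    dHom EG EK (η.comp θ) Y = dHom EH EK η (dHom EG EH θ Y) := by
  have h1 := hasFDerivAt_dHom hη
  have h1' : HasFDerivAt (fun a => oneChart EK K (η ((oneChart EH H).symm a))) (dHom EH EK η)
    (oneChart EH H (θ ((oneChart EG G).symm (oneCoord EG G)))) := by simpa using h1
  have h2 := HasFDerivAt.comp (f := fun a => oneChart EH H (θ ((oneChart EG G).symm a)))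
    (oneCoord EG G) h1' (hasFDerivAt_dHom hθ)
  have h3 : HasFDerivAt (fun a => oneChart EK K ((η.comp θ) ((oneChart EG G).symm a)))
      (dHom EH EK η ∘L dHom EG EH θ) (oneCoord EG G) := by
    refine h2.congr_of_eventuallyEq ?_
    have hc : ContMDiffAt 𝓘(ℝ, EG) 𝓘(ℝ, EH) ∞ (fun a => θ ((oneChart EG G).symm a))
        (oneCoord EG G) := hθ.contMDiffAt.comp _ (contMDiffAt_oneChart_symm oneCoord_mem)
    filter_upwards [ContMDiffAt.eventually_mem_oneChart hc (by simp)]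
      with a ha
    simp only [Function.comp, MonoidHom.comp_apply]
    rw [(oneChart EH H).left_inv ha]
  exact DFunLike.congr_fun ((hasFDerivAt_dHom (θ := η.comp θ) (hη.comp hθ)).unique h3) Y

theorem dHom_id : dHom EG EG (MonoidHom.id G) = .id ℝ EG := by
  refine (hasFDerivAt_dHom (θ := MonoidHom.id G) contMDiff_id).unique
    ((hasFDerivAt_id _).congr_of_eventuallyEq ?_)
  filter_upwards [(oneChart EG G).open_target.mem_nhds oneCoord_mem] with a ha
  exact (oneChart EG G).right_inv ha

/-- The differential of a smooth family of homomorphisms is smooth. -/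
theorem contDiffAt_dHom {P : Type*} [NormedAddCommGroup P] [NormedSpace ℝ P] {Θ : P → G →* H}
    {p : P} (hΘ : ContMDiffAt (𝓘(ℝ, P).prod 𝓘(ℝ, EG)) 𝓘(ℝ, EH) ∞
      (fun q : P × G => Θ q.1 q.2) (p, 1)) :
    ContDiffAt ℝ ∞ (fun p => dHom EG EH (Θ p)) p := by
  refine ContDiffAt.fderiv (f := fun p a => oneChart EH H (Θ p ((oneChart EG G).symm a)))
    (n := ∞) ?_ contDiffAt_const (by simp)
  refine contDiffAt_oneChart_comp (F := fun q : P × EG => Θ q.1 ((oneChart EG G).symm q.2)) ?_ ?_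
  · have h1 : ContMDiffAt 𝓘(ℝ, P × EG) (𝓘(ℝ, P).prod 𝓘(ℝ, EG)) ∞
        (fun q : P × EG => (q.1, (oneChart EG G).symm q.2)) (p, oneCoord EG G) :=
      contDiff_fst.contMDiff.contMDiffAt.prodMk
        (ContMDiffAt.comp (f := Prod.snd) (p, oneCoord EG G)
          (contMDiffAt_oneChart_symm oneCoord_mem) contDiff_snd.contMDiff.contMDiffAt)
    refine ContMDiffAt.comp (g := fun q : P × G => Θ q.1 q.2) _ ?_ h1
    rw [oneChart_symm_oneCoord]
    exact hΘ
  · simp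

variable (EG) in
/-- The adjoint action on the Lie algebra. -/
noncomputable def adj (g : G) : EG →L[ℝ] EG := dHom EG EG (MulAut.conj g).toMonoidHom

theorem contMDiff_conj (g : G) :
    ContMDiff 𝓘(ℝ, EG) 𝓘(ℝ, EG) ∞ (MulAut.conj g).toMonoidHom :=
  (contMDiff_const.mul contMDiff_id).mul contMDiff_const

theorem adj_mul (g h : G) (Y : EG) : adj EG (g * h) Y = adj EG g (adj EG h Y) := by
  rw [adj, adj, adj, ← dHom_comp (contMDiff_conj h) (contMDiff_conj g)]
  congr 2
  ext x
  simp [mul_assoc]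

theorem adj_one : adj EG (1 : G) = .id ℝ EG := by
  rw [adj, ← dHom_id (G := G)]
  congr 1
  ext x
  simp

theorem contDiffAt_adj {P : Type*} [NormedAddCommGroup P] [NormedSpace ℝ P] {u : P → G} {p : P}
    (hu : ContMDiffAt 𝓘(ℝ, P) 𝓘(ℝ, EG) ∞ u p) : ContDiffAt ℝ ∞ (fun p => adj EG (u p)) p := by
  refine contDiffAt_dHom (Θ := fun p => (MulAut.conj (u p)).toMonoidHom) ?_
  have h1 : ContMDiffAt (𝓘(ℝ, P).prod 𝓘(ℝ, EG)) 𝓘(ℝ, EG) ∞ (fun q : P × G => u q.1) (p, 1) :=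
    ContMDiffAt.comp (f := Prod.fst) (p, (1 : G)) hu contMDiffAt_fst
  exact (h1.mul contMDiffAt_snd).mul h1.inv

/-- The logarithmic derivative of a smooth family of curves is smooth. -/
theorem contDiff_rightLogDeriv {P : Type*} [NormedAddCommGroup P] [NormedSpace ℝ P]
    {u : P × ℝ → G} (hu : ContMDiff 𝓘(ℝ, P × ℝ) 𝓘(ℝ, EG) ∞ u) :
    ContDiff ℝ ∞ (fun q : P × ℝ => rightLogDeriv EG (fun s => u (q.1, s)) q.2) := by
  have h1 : ∀ q : P × ℝ, rightLogDeriv EG (fun s => u (q.1, s)) q.2 =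
      fderiv ℝ (fun s => oneChart EG G (u (q.1, s) * (u q)⁻¹)) q.2 1 := fun q =>
    (hasDerivAt_rightLogDeriv (u := fun s => u (q.1, s)) (x := q.2)
      (hu.comp (contDiff_const.prodMk contDiff_id).contMDiff).contMDiffAt).deriv.symm
  simp_rw [h1]
  refine contDiff_iff_contDiffAt.2 fun q => ContDiffAt.clm_apply ?_ contDiffAt_const
  refine ContDiffAt.fderiv (f := fun q s => oneChart EG G (u (q.1, s) * (u q)⁻¹)) (n := ∞)
    ?_ contDiffAt_snd (by simp)
  refine contDiffAt_oneChart_comp (F := fun r : (P × ℝ) × ℝ => u (r.1.1, r.2) * (u r.1)⁻¹) ?_ ?_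
  · have e1 : ContMDiff 𝓘(ℝ, (P × ℝ) × ℝ) 𝓘(ℝ, EG) ∞
        (fun r : (P × ℝ) × ℝ => u (r.1.1, r.2)) :=
      hu.comp ((contDiff_fst.comp contDiff_fst).prodMk contDiff_snd).contMDiff
    have e2 : ContMDiff 𝓘(ℝ, (P × ℝ) × ℝ) 𝓘(ℝ, EG) ∞ (fun r : (P × ℝ) × ℝ => u r.1) :=
      hu.comp contDiff_fst.contMDiff
    exact (e1.mul e2.inv).contMDiffAt
  · simp

/-- The curve `u(s) v(s) (u(x) v(x))⁻¹` factors as `u(s) u(x)⁻¹` times the conjugate by `u(x)` of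
`v(s) v(x)⁻¹`. Both factors pass through `1`, where the multiplication differentiates to addition.
-/
theorem rightLogDeriv_mul {u v : ℝ → G} {x : ℝ} (hu : ContMDiffAt 𝓘(ℝ, ℝ) 𝓘(ℝ, EG) ∞ u x)
    (hv : ContMDiffAt 𝓘(ℝ, ℝ) 𝓘(ℝ, EG) ∞ v x) :
    rightLogDeriv EG (fun s => u s * v s) x =
      rightLogDeriv EG u x + adj EG (u x) (rightLogDeriv EG v x) := by
  have hv1 := contMDiffAt_mul_const hv (v x)⁻¹
  have h := hasDerivAt_oneChart_mul (contMDiffAt_mul_const hu (u x)⁻¹)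
    ((contMDiff_conj (u x)).contMDiffAt.comp x hv1)
    (by simp) (by simp) (hasDerivAt_rightLogDeriv hu)
    (hasDerivAt_oneChart_hom (contMDiff_conj (u x)) hv1 (by simp) (hasDerivAt_rightLogDeriv hv))
  refine rightLogDeriv_eq (hu.mul hv) (h.congr_of_eventuallyEq (.of_forall fun s => ?_))
  simp [mul_assoc]

omit [LieGroup 𝓘(ℝ, EG) ∞ G] in
theorem rightLogDeriv_const (g : G) (x : ℝ) : rightLogDeriv EG (fun _ => g) x = 0 := by
  simp only [rightLogDeriv, mfderiv_const]
  rfl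

omit [LieGroup 𝓘(ℝ, EG) ∞ G] in
theorem rightLogDeriv_mul_const (u : ℝ → G) (g : G) (x : ℝ) :
    rightLogDeriv EG (fun s => u s * g) x = rightLogDeriv EG u x := by
  have : (fun s => u s * g * (u x * g)⁻¹) = fun s => u s * (u x)⁻¹ := by
    funext s
    group
  have h := congrArg (fun c : ℝ → G => (mfderiv 𝓘(ℝ, ℝ) 𝓘(ℝ, EG) c x (1 : ℝ) : EG)) this
  exact h

omit [LieGroup 𝓘(ℝ, EG) ∞ G] in
theorem rightLogDeriv_congr {u v : ℝ → G} {x : ℝ} (h : u =ᶠ[𝓝 x] v) :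
    rightLogDeriv EG u x = rightLogDeriv EG v x := by
  have : (fun s => u s * (u x)⁻¹) =ᶠ[𝓝 x] fun s => v s * (v x)⁻¹ := by
    filter_upwards [h] with s hs
    rw [hs, h.self_of_nhds]
  unfold rightLogDeriv
  have := this.mfderiv_eq (I := 𝓘(ℝ, ℝ)) (I' := 𝓘(ℝ, EG))
  exact DFunLike.congr_fun this (1 : ℝ)

theorem rightLogDeriv_inv {u : ℝ → G} {x : ℝ} (hu : ContMDiffAt 𝓘(ℝ, ℝ) 𝓘(ℝ, EG) ∞ u x) :
    rightLogDeriv EG (fun s => (u s)⁻¹) x = - adj EG (u x)⁻¹ (rightLogDeriv EG u x) := by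
  have h := rightLogDeriv_mul hu.inv hu
  simp only [inv_mul_cancel, rightLogDeriv_const] at h
  exact eq_neg_of_add_eq_zero_left h.symm

theorem rightLogDeriv_hom {θ : G →* H} (hθ : ContMDiff 𝓘(ℝ, EG) 𝓘(ℝ, EH) ∞ θ) {u : ℝ → G}
    {x : ℝ} (hu : ContMDiffAt 𝓘(ℝ, ℝ) 𝓘(ℝ, EG) ∞ u x) :
    rightLogDeriv EH (fun s => θ (u s)) x = dHom EG EH θ (rightLogDeriv EG u x) := by
  have h := hasDerivAt_oneChart_hom hθ (contMDiffAt_mul_const hu (u x)⁻¹) (by simp)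
    (hasDerivAt_rightLogDeriv hu)
  refine rightLogDeriv_eq (hθ.contMDiffAt.comp x hu)
    (h.congr_of_eventuallyEq (.of_forall fun s => ?_))
  simp

theorem rightLogDeriv_comp {u : ℝ → G} {k : ℝ → ℝ} {x k' : ℝ}
    (hu : ContMDiffAt 𝓘(ℝ, ℝ) 𝓘(ℝ, EG) ∞ u (k x)) (hk : ContDiffAt ℝ ∞ k x)
    (hk' : HasDerivAt k k' x) :
    rightLogDeriv EG (fun s => u (k s)) x = k' • rightLogDeriv EG u (k x) :=
  rightLogDeriv_eq (hu.comp x hk.contMDiffAt) ((hasDerivAt_rightLogDeriv hu).scomp x hk')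

/-- The relation between the derivative in the chart and the logarithmic derivative. -/
theorem hasDerivAt_oneChart {u : ℝ → G} {x : ℝ} (hu : ContMDiffAt 𝓘(ℝ, ℝ) 𝓘(ℝ, EG) ∞ u x)
    (hs : u x ∈ (oneChart EG G).source) :
    HasDerivAt (fun s => oneChart EG G (u s))
      (rightTrans EG G (oneChart EG G (u x)) (rightLogDeriv EG u x)) x := by
  have h := hasFDerivAt_rightTrans ((oneChart EG G).map_source hs)
  have h' : HasFDerivAt (fun a => chartMul EG G (a, oneChart EG G (u x)))
    (rightTrans EG G (oneChart EG G (u x))) (oneChart EG G (u x * (u x)⁻¹)) := by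
    rw [mul_inv_cancel]; exact h
  refine (h'.comp_hasDerivAt x (hasDerivAt_rightLogDeriv hu)).congr_of_eventuallyEq ?_
  filter_upwards [ContMDiffAt.eventually_mem_oneChart (contMDiffAt_mul_const hu (u x)⁻¹)
    (by simp)] with s hs1
  simp only [chartMul, Function.comp]
  rw [(oneChart EG G).left_inv hs, (oneChart EG G).left_inv hs1, inv_mul_cancel_right]

/-- The way back from an equation solved in the chart to the equation in the group, by injectivity
of `rightTrans`. -/
theorem rightLogDeriv_eq_of_hasDerivAt_oneChart {u : ℝ → G} {x : ℝ} {a : EG}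
    (hu : ContMDiffAt 𝓘(ℝ, ℝ) 𝓘(ℝ, EG) ∞ u x) (hs : u x ∈ (oneChart EG G).source)
    (h : HasDerivAt (fun s => oneChart EG G (u s))
      (rightTrans EG G (oneChart EG G (u x)) a) x) :
    rightLogDeriv EG u x = a :=
  rightTrans_injective ((oneChart EG G).map_source hs) ((hasDerivAt_oneChart hu hs).unique h)

/-- Near `x` the curve `w(s) w(x)⁻¹` stays in the chart at `1`, and its coordinate derivative is
`rightTrans` applied to `0`; the mean value inequality makes it constant. -/
theorem eventually_eq_of_rightLogDeriv_eq_zero {w : ℝ → G} {x : ℝ}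
    (hw : ∀ᶠ s in 𝓝 x, ContMDiffAt 𝓘(ℝ, ℝ) 𝓘(ℝ, EG) ∞ w s)
    (h0 : ∀ᶠ s in 𝓝 x, rightLogDeriv EG w s = 0) : ∀ᶠ s in 𝓝 x, w s = w x := by
  have hc := ContMDiffAt.eventually_mem_oneChart
    (contMDiffAt_mul_const hw.self_of_nhds (w x)⁻¹) (by simp)
  obtain ⟨δ, hδ, h⟩ := Metric.eventually_nhds_iff_ball.1 ((hw.and h0).and hc)
  have hd : ∀ s ∈ Metric.ball x δ,
      HasDerivWithinAt (fun s => oneChart EG G (w s * (w x)⁻¹)) 0 (Metric.ball x δ) s := by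
    intro s hs
    have := hasDerivAt_oneChart (contMDiffAt_mul_const (h s hs).1.1 (w x)⁻¹) (h s hs).2
    rw [rightLogDeriv_mul_const, (h s hs).1.2, map_zero] at this
    exact this.hasDerivWithinAt
  filter_upwards [Metric.ball_mem_nhds x hδ] with s hs
  have key := (convex_ball x δ).norm_image_sub_le_of_norm_hasDerivWithin_le hd
    (fun _ _ => norm_zero.le) (Metric.mem_ball_self hδ) hs
  rw [zero_mul, norm_le_zero_iff, sub_eq_zero] at key
  have := (oneChart EG G).injOn (h s hs).2 (h x (Metric.mem_ball_self hδ)).2 key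
  simpa [mul_inv_eq_one] using this

/-- A curve in a Lie group is determined by its logarithmic derivative and one value. -/
theorem eqOn_of_rightLogDeriv_eq {u v : ℝ → G} {J : Set ℝ} (hJ : IsOpen J)
    (hJc : IsPreconnected J) (hu : ∀ s ∈ J, ContMDiffAt 𝓘(ℝ, ℝ) 𝓘(ℝ, EG) ∞ u s)
    (hv : ∀ s ∈ J, ContMDiffAt 𝓘(ℝ, ℝ) 𝓘(ℝ, EG) ∞ v s)
    (h : ∀ s ∈ J, rightLogDeriv EG u s = rightLogDeriv EG v s) {x : ℝ} (hx : x ∈ J)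
    (hx1 : u x = v x) : EqOn u v J := by
  -- Right logarithmic derivatives ignore constant right factors, so the quotient to consider is
  -- `v⁻¹ u`: its logarithmic derivative is `Ad(v⁻¹)` of the difference of those of `u` and `v`,
  -- which is zero. It is therefore locally constant, and constant because `J` is connected.
  have hw : ∀ s ∈ J, ∀ᶠ r in 𝓝[J] s, (v s)⁻¹ * u s = (v r)⁻¹ * u r := by
    intro s hs
    refine Filter.Eventually.filter_mono nhdsWithin_le_nhds ?_
    have := eventually_eq_of_rightLogDeriv_eq_zero (EG := EG) (w := fun r => (v r)⁻¹ * u r) (x := s)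
      (by filter_upwards [hJ.mem_nhds hs] with r hr using (hv r hr).inv.mul (hu r hr))
      (by
        filter_upwards [hJ.mem_nhds hs] with r hr
        rw [rightLogDeriv_mul (hv r hr).inv (hu r hr), rightLogDeriv_inv (hv r hr), h r hr]
        simp)
    filter_upwards [this] with r hr using hr.symm
  intro y hy
  have := hJc.induction₂ (fun s r => (v s)⁻¹ * u s = (v r)⁻¹ * u r) hw
    (fun _ _ _ _ _ _ h1 h2 => h1.trans h2) (fun _ _ _ _ h1 => h1.symm) hx hy
  rw [hx1, inv_mul_cancel] at this
  exact (inv_mul_eq_one.1 this.symm).symm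

theorem eq_of_rightLogDeriv_eq {u v : ℝ → G} (hu : ContMDiff 𝓘(ℝ, ℝ) 𝓘(ℝ, EG) ∞ u)
    (hv : ContMDiff 𝓘(ℝ, ℝ) 𝓘(ℝ, EG) ∞ v)
    (h : ∀ s, rightLogDeriv EG u s = rightLogDeriv EG v s) {x : ℝ} (hx : u x = v x) : u = v :=
  funext fun y => eqOn_of_rightLogDeriv_eq isOpen_univ isPreconnected_univ
    (fun _ _ => hu.contMDiffAt) (fun _ _ => hv.contMDiffAt) (fun s _ => h s) (mem_univ x) hx
    (mem_univ y)

end Velocity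

end LieGroupCalculus

theorem two_le_infty : (2 : WithTop ℕ∞) ≤ ∞ := WithTop.coe_le_coe.2 le_top

/-! ### The Lie bracket as a second derivative of the multiplication -/

section Bracket

variable {EG : Type*} [NormedAddCommGroup EG] [NormedSpace ℝ EG]
  {G : Type*} [TopologicalSpace G] [ChartedSpace EG G] [Group G] [LieGroup 𝓘(ℝ, EG) ∞ G]

variable (EG G) in
/-- The differential at the identity of the left translation by the element with coordinates `v`,
in the preferred chart. -/
noncomputable def leftTrans (v : EG) : EG →L[ℝ] EG :=
  fderiv ℝ (fun a => chartMul EG G (v, a)) (oneCoord EG G)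

variable (EG G) in
/-- The second derivative of the multiplication at `(1, 1)`, in the preferred chart. -/
noncomputable def chartMulSnd : EG × EG →L[ℝ] EG × EG →L[ℝ] EG :=
  fderiv ℝ (fderiv ℝ (chartMul EG G)) (oneCoord EG G, oneCoord EG G)

theorem hasFDerivAt_fderiv_chartMul :
    HasFDerivAt (fderiv ℝ (chartMul EG G)) (chartMulSnd EG G) (oneCoord EG G, oneCoord EG G) := by
  refine DifferentiableAt.hasFDerivAt (ContDiffAt.differentiableAt (n := ∞) ?_ (by simp))
  exact (contDiffAt_chartMul_left oneCoord_mem).fderiv_right (by simp)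

theorem chartMulSnd_symm (a b : EG × EG) : chartMulSnd EG G a b = chartMulSnd EG G b a :=
  ((contDiffAt_chartMul_left (EG := EG) (G := G) oneCoord_mem).isSymmSndFDerivAt
    (by simpa using two_le_infty)).eq a b

theorem hasFDerivAt_leftTrans {v : EG} (hv : v ∈ (oneChart EG G).target) :
    HasFDerivAt (fun a => chartMul EG G (v, a)) (leftTrans EG G v) (oneCoord EG G) := by
  refine DifferentiableAt.hasFDerivAt ?_
  exact DifferentiableAt.comp (f := fun a => (v, a)) (oneCoord EG G)
    ((contDiffAt_chartMul_right hv).differentiableAt (by simp))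
    ((differentiableAt_const v).prodMk differentiableAt_id)

theorem leftTrans_eq {v : EG} (hv : v ∈ (oneChart EG G).target) :
    leftTrans EG G v = fderiv ℝ (chartMul EG G) (v, oneCoord EG G) ∘L .inr ℝ EG EG :=
  (HasFDerivAt.comp (f := fun a => (v, a)) (oneCoord EG G)
    ((contDiffAt_chartMul_right hv).differentiableAt (by simp)).hasFDerivAt
    (hasFDerivAt_prodMk_right v (oneCoord EG G))).fderiv

theorem leftTrans_oneCoord : leftTrans EG G (oneCoord EG G) = .id ℝ EG := by
  rw [leftTrans_eq oneCoord_mem, hasFDerivAt_chartMul_one.fderiv]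
  ext; simp

theorem hasFDerivAt_leftTrans_apply (w : EG) :
    HasFDerivAt (fun v => leftTrans EG G v w)
      (((chartMulSnd EG G).flip (0, w)) ∘L .inl ℝ EG EG) (oneCoord EG G) := by
  have h := (HasFDerivAt.comp (f := fun v : EG => (v, oneCoord EG G)) (oneCoord EG G)
    (hasFDerivAt_fderiv_chartMul (G := G))
    (hasFDerivAt_prodMk_left (oneCoord EG G) (oneCoord EG G))).clm_apply
      (hasFDerivAt_const ((0 : EG), w) _)
  refine (h.congr_of_eventuallyEq ?_).congr_fderiv ?_
  · filter_upwards [(oneChart EG G).open_target.mem_nhds oneCoord_mem] with v hv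
    rw [leftTrans_eq hv]
    rfl
  · ext v
    simp

theorem hasFDerivAt_rightTrans_apply (w : EG) :
    HasFDerivAt (fun v => rightTrans EG G v w)
      (((chartMulSnd EG G).flip (w, 0)) ∘L .inr ℝ EG EG) (oneCoord EG G) := by
  have h := (HasFDerivAt.comp (f := fun v : EG => (oneCoord EG G, v)) (oneCoord EG G)
    (hasFDerivAt_fderiv_chartMul (G := G))
    (hasFDerivAt_prodMk_right (oneCoord EG G) (oneCoord EG G))).clm_apply
      (hasFDerivAt_const (w, (0 : EG)) _)
  refine (h.congr_of_eventuallyEq ?_).congr_fderiv ?_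
  · filter_upwards [(oneChart EG G).open_target.mem_nhds oneCoord_mem] with v hv
    rw [rightTrans_eq hv]
    rfl
  · ext v
    simp

/-- In the chart, left translation by the point with coordinates `x` is `a ↦ chartMul EG G (x, a)`.
Differentiating this identity at `1` on both sides of the inverse chart relates the invariant field
to `leftTrans`, and invertibility of the derivative of the inverse chart allows it to be cancelled.
-/
theorem mpullbackWithin_mulInvariantVectorField (v : EG) {x : EG}
    (hx : x ∈ (oneChart EG G).target) :
    VectorField.mpullbackWithin 𝓘(ℝ, EG) 𝓘(ℝ, EG) (extChartAt 𝓘(ℝ, EG) (1 : G)).symm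
      (mulInvariantVectorField (I := 𝓘(ℝ, EG)) (G := G) v) (range 𝓘(ℝ, EG)) x =
      leftTrans EG G x v := by
  have hT : ∀ y ∈ (oneChart EG G).target,
      HasMFDerivAt 𝓘(ℝ, EG) 𝓘(ℝ, EG) (extChartAt 𝓘(ℝ, EG) (1 : G)).symm y
        (mfderivWithin 𝓘(ℝ, EG) 𝓘(ℝ, EG) (extChartAt 𝓘(ℝ, EG) (1 : G)).symm
          (range 𝓘(ℝ, EG)) y) := by
    intro y hy
    have := (mdifferentiableWithinAt_extChartAt_symm (I := 𝓘(ℝ, EG)) (x := (1 : G)) (z := y)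
      (by simpa using hy)).hasMFDerivWithinAt
    exact this.hasMFDerivAt (by simp)
  have hinv : ∀ T : EG →L[ℝ] EG, T.IsInvertible → ∀ Y Y' : EG, Y = T Y' → T.inverse Y = Y' := by
    rintro _ ⟨e, rfl⟩ Y Y' rfl
    simp
  refine hinv _ (isInvertible_mfderivWithin_extChartAt_symm (by simpa using hx)) _ _ ?_
  obtain ⟨T, hTx, hTe⟩ : ∃ T : EG →L[ℝ] EG,
      HasMFDerivAt 𝓘(ℝ, EG) 𝓘(ℝ, EG) (extChartAt 𝓘(ℝ, EG) (1 : G)).symm x T ∧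
      T = (mfderivWithin 𝓘(ℝ, EG) 𝓘(ℝ, EG) (extChartAt 𝓘(ℝ, EG) (1 : G)).symm
          (range 𝓘(ℝ, EG)) x) := ⟨_, hT x hx, rfl⟩
  obtain ⟨M, hM, hMe⟩ : ∃ M : EG →L[ℝ] EG,
      HasMFDerivAt 𝓘(ℝ, EG) 𝓘(ℝ, EG) (fun g : G => (oneChart EG G).symm x * g) 1 M ∧
      M v = mulInvariantVectorField (I := 𝓘(ℝ, EG)) (G := G) v ((oneChart EG G).symm x) :=
    ⟨_, ((contMDiff_mul_left (I := 𝓘(ℝ, EG)) (n := ∞)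
      (a := (oneChart EG G).symm x)).mdifferentiable (by simp) 1).hasMFDerivAt, rfl⟩
  have hz : HasMFDerivAt 𝓘(ℝ, EG) 𝓘(ℝ, EG) (extChartAt 𝓘(ℝ, EG) (1 : G)).symm
      (oneCoord EG G) (ContinuousLinearMap.id ℝ EG) := by
    have h := hT _ oneCoord_mem
    have h2 := mfderivWithin_range_extChartAt_symm (I := 𝓘(ℝ, EG)) (x := (1 : G))
    exact h2 ▸ h
  have hM' : HasMFDerivAt 𝓘(ℝ, EG) 𝓘(ℝ, EG) (fun g : G => (oneChart EG G).symm x * g)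
      ((extChartAt 𝓘(ℝ, EG) (1 : G)).symm (oneCoord EG G)) M := by
    have : (extChartAt 𝓘(ℝ, EG) (1 : G)).symm (oneCoord EG G) = 1 := by simp
    rw [this]
    exact hM
  have hA := hM'.comp _ hz
  have hT' : HasMFDerivAt 𝓘(ℝ, EG) 𝓘(ℝ, EG) (extChartAt 𝓘(ℝ, EG) (1 : G)).symm
      (chartMul EG G (x, oneCoord EG G)) T := by
    rw [chartMul_oneCoord_right hx]
    exact hTx
  have hB := HasMFDerivAt.comp (f := fun a => chartMul EG G (x, a)) _ hT'
    (hasFDerivAt_leftTrans hx).hasMFDerivAt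
  have hev : (fun g : G => (oneChart EG G).symm x * g) ∘ (extChartAt 𝓘(ℝ, EG) (1 : G)).symm
      =ᶠ[𝓝 (oneCoord EG G)]
      (extChartAt 𝓘(ℝ, EG) (1 : G)).symm ∘ (fun a => chartMul EG G (x, a)) := by
    have hc : ContMDiffAt 𝓘(ℝ, EG) 𝓘(ℝ, EG) ∞
        (fun a => (oneChart EG G).symm x * (oneChart EG G).symm a) (oneCoord EG G) :=
      contMDiffAt_const.mul (contMDiffAt_oneChart_symm oneCoord_mem)
    filter_upwards [ContMDiffAt.eventually_mem_oneChart hc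
      (by simpa using (oneChart EG G).map_target hx)] with a ha
    exact ((oneChart EG G).left_inv ha).symm
  have huniq := hasMFDerivAt_unique hA (hB.congr_of_eventuallyEq hev)
  have e1 : (M ∘L ContinuousLinearMap.id ℝ EG) v = (T ∘L leftTrans EG G x) v :=
    congrArg (fun L : EG →L[ℝ] EG => L v) huniq
  refine Eq.trans hMe.symm ?_
  rw [← hTe]
  exact e1

/-- The bracket is that of left-invariant fields, evaluated at `1`. In the chart these are `x ↦
leftTrans EG G x v` and `x ↦ leftTrans EG G x w`, with values `v` and `w` at the identity, and the
bracket of fields `V`, `W` on a vector space is `DW(V) - DV(W)`. -/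
theorem lieBr_eq (v w : EG) :
    lieBr G v w = chartMulSnd EG G (v, 0) (0, w) - chartMulSnd EG G (w, 0) (0, v) := by
  have h1 : ∀ u : EG, (VectorField.mpullbackWithin 𝓘(ℝ, EG) 𝓘(ℝ, EG)
      (extChartAt 𝓘(ℝ, EG) (1 : G)).symm
      (mulInvariantVectorField (I := 𝓘(ℝ, EG)) (G := G) u) (range 𝓘(ℝ, EG)) : EG → EG) =ᶠ[
        𝓝 (oneCoord EG G)] fun x => leftTrans EG G x u := by
    intro u
    filter_upwards [(oneChart EG G).open_target.mem_nhds oneCoord_mem] with x hx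
    exact mpullbackWithin_mulInvariantVectorField u hx
  have h2 : lieBr G v w = VectorField.lieBracket ℝ
      (VectorField.mpullbackWithin 𝓘(ℝ, EG) 𝓘(ℝ, EG)
      (extChartAt 𝓘(ℝ, EG) (1 : G)).symm
      (mulInvariantVectorField (I := 𝓘(ℝ, EG)) (G := G) v) (range 𝓘(ℝ, EG)) : EG → EG)
      (VectorField.mpullbackWithin 𝓘(ℝ, EG) 𝓘(ℝ, EG)
      (extChartAt 𝓘(ℝ, EG) (1 : G)).symm
      (mulInvariantVectorField (I := 𝓘(ℝ, EG)) (G := G) w) (range 𝓘(ℝ, EG)) : EG → EG)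
      (oneCoord EG G) := by
    have := VectorField.mlieBracketWithin_apply (I := 𝓘(ℝ, EG)) (M := G)
      (V := mulInvariantVectorField (I := 𝓘(ℝ, EG)) (G := G) v)
      (W := mulInvariantVectorField (I := 𝓘(ℝ, EG)) (G := G) w) (s := univ) (x₀ := 1)
    rw [VectorField.mlieBracketWithin_univ] at this
    refine Eq.trans this ?_
    have hr : (extChartAt 𝓘(ℝ, EG) (1 : G)).symm ⁻¹' univ ∩ range 𝓘(ℝ, EG) = univ := by simp
    have hid : ∀ T : EG →L[ℝ] EG, T = .id ℝ EG → ∀ Y Y' : EG, Y = Y' → T.inverse Y = Y' := by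
      rintro _ rfl Y _ rfl
      simp
    refine hid _ mfderiv_extChartAt_self _ _ ?_
    rw [hr]
    exact congrFun VectorField.lieBracketWithin_univ _
  rw [h2, (h1 v).lieBracket_vectorField_eq (h1 w), VectorField.lieBracket_eq]
  simp only
  rw [(hasFDerivAt_leftTrans_apply w).fderiv, (hasFDerivAt_leftTrans_apply v).fderiv,
    leftTrans_oneCoord]
  simp

/-- Differentiate `g a = (g a g⁻¹) g` in `a` at the identity. -/
theorem leftTrans_eq_rightTrans_comp_adj {v : EG} (hv : v ∈ (oneChart EG G).target) :
    leftTrans EG G v = rightTrans EG G v ∘L adj EG ((oneChart EG G).symm v) := by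
  have h1 := hasFDerivAt_dHom (contMDiff_conj (EG := EG) ((oneChart EG G).symm v))
  have h2 : HasFDerivAt (fun a => chartMul EG G (a, v)) (rightTrans EG G v)
      (oneChart EG G ((MulAut.conj ((oneChart EG G).symm v)).toMonoidHom
        ((oneChart EG G).symm (oneCoord EG G)))) := by
    simpa using hasFDerivAt_rightTrans hv
  refine (hasFDerivAt_leftTrans hv).unique ((HasFDerivAt.comp (f := fun a =>
    oneChart EG G ((MulAut.conj ((oneChart EG G).symm v)).toMonoidHom
      ((oneChart EG G).symm a))) _ h2 h1).congr_of_eventuallyEq ?_)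
  have hc : ContMDiffAt 𝓘(ℝ, EG) 𝓘(ℝ, EG) ∞
      (fun a => (MulAut.conj ((oneChart EG G).symm v)).toMonoidHom ((oneChart EG G).symm a))
      (oneCoord EG G) :=
    (contMDiff_conj ((oneChart EG G).symm v)).contMDiffAt.comp _
      (contMDiffAt_oneChart_symm oneCoord_mem)
  filter_upwards [ContMDiffAt.eventually_mem_oneChart hc (by simp)] with a ha
  simp only [chartMul, Function.comp]
  rw [(oneChart EG G).left_inv ha]
  simp

theorem hasFDerivAt_rightTrans_oneCoord :
    HasFDerivAt (rightTrans EG G) (fderiv ℝ (rightTrans EG G) (oneCoord EG G))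
      (oneCoord EG G) :=
  ((contDiffAt_rightTrans oneCoord_mem).differentiableAt (by simp)).hasFDerivAt

theorem fderiv_rightTrans_apply (v w : EG) :
    fderiv ℝ (rightTrans EG G) (oneCoord EG G) v w = chartMulSnd EG G (w, 0) (0, v) := by
  have h1 := (hasFDerivAt_rightTrans_oneCoord (EG := EG) (G := G)).clm_apply
    (hasFDerivAt_const w (oneCoord EG G))
  have h2 := DFunLike.congr_fun (h1.unique (hasFDerivAt_rightTrans_apply w)) v
  rw [chartMulSnd_symm]
  simpa using h2

/-- The derivative of the adjoint action at the identity is the bracket. -/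
theorem hasDerivAt_adj {c : ℝ → G} {x : ℝ} {v : EG}
    (hc : ContMDiffAt 𝓘(ℝ, ℝ) 𝓘(ℝ, EG) ∞ c x) (hc1 : c x = 1)
    (hv : HasDerivAt (fun s => oneChart EG G (c s)) v x) (w : EG) :
    HasDerivAt (fun s => adj EG (c s) w) (lieBr G v w) x := by
  have h1 : ContDiffAt ℝ ∞ (fun a => adj EG ((oneChart EG G).symm a) w) (oneCoord EG G) :=
    (contDiffAt_adj (contMDiffAt_oneChart_symm oneCoord_mem)).clm_apply contDiffAt_const
  -- The identity `L = R ∘ Ad` for left and right translations is now differentiated at `1` in the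
  -- direction `v`. As `R` and `Ad` are the identity there, the derivative of `Ad` is the difference
  -- of those of `L` and `R`, which is the formula of `lieBr_eq`.
  have h2 := (h1.differentiableAt (by simp)).hasFDerivAt
  have h3 := (hasFDerivAt_rightTrans_oneCoord (EG := EG) (G := G)).clm_apply h2
  have h4 := (h3.congr_of_eventuallyEq (f₁ := fun a => leftTrans EG G a w) (by
    filter_upwards [(oneChart EG G).open_target.mem_nhds oneCoord_mem] with a ha
    rw [leftTrans_eq_rightTrans_comp_adj ha]
    rfl)).unique (hasFDerivAt_leftTrans_apply w)
  have h5 := DFunLike.congr_fun h4 v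
  simp only [rightTrans_oneCoord, oneChart_symm_oneCoord, adj_one,
    _root_.add_apply, ContinuousLinearMap.comp_apply,
    ContinuousLinearMap.id_apply, ContinuousLinearMap.flip_apply,
    ContinuousLinearMap.inl_apply, fderiv_rightTrans_apply] at h5
  have h6 : HasFDerivAt (fun a => adj EG ((oneChart EG G).symm a) w)
      (fderiv ℝ (fun a => adj EG ((oneChart EG G).symm a) w) (oneCoord EG G))
      (oneChart EG G (c x)) := by rw [hc1]; exact h2
  have h7 := h6.comp_hasDerivAt x hv
  refine (h7.congr_deriv ?_).congr_of_eventuallyEq ?_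
  · rw [lieBr_eq, ← h5, add_sub_cancel_right]
  · filter_upwards [ContMDiffAt.eventually_mem_oneChart hc (by rw [hc1]; exact one_mem_oneChart)]
      with s hs
    simp only [Function.comp]
    rw [(oneChart EG G).left_inv hs]

end Bracket

/-! ### The Maurer–Cartan equation -/

section MaurerCartan

variable {EG : Type*} [NormedAddCommGroup EG] [NormedSpace ℝ EG]
  {G : Type*} [TopologicalSpace G] [ChartedSpace EG G] [Group G] [LieGroup 𝓘(ℝ, EG) ∞ G]

/-- The Maurer-Cartan equation for the logarithmic derivatives of a smooth map from the plane. -/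
theorem maurer_cartan {f : ℝ × ℝ → G} (hf : ContMDiff 𝓘(ℝ, ℝ × ℝ) 𝓘(ℝ, EG) ∞ f)
    {α φ : ℝ × ℝ → EG} (hα : ∀ x y, rightLogDeriv EG (fun s => f (s, y)) x = α (x, y))
    (hφ : ∀ x y, rightLogDeriv EG (fun s => f (x, s)) y = φ (x, y)) {x y : ℝ} {α' φ' : EG}
    (hα' : HasDerivAt (fun s => α (x, s)) α' y) (hφ' : HasDerivAt (fun s => φ (s, y)) φ' x) :
    φ' - α' = lieBr G (α (x, y)) (φ (x, y)) := by
  -- Right translation moves `f (x, y)` to `1` without changing logarithmic derivatives. The partial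
  -- derivatives of `V` are then `rightTrans` applied to `α` and `φ`; symmetry of the second
  -- derivative of `V` at `(x, y)` gives the equation, the derivatives of `rightTrans` contributing
  -- the bracket.
  set V : ℝ × ℝ → EG := fun q => oneChart EG G (f q * (f (x, y))⁻¹) with hV
  have hF : ContMDiff 𝓘(ℝ, ℝ × ℝ) 𝓘(ℝ, EG) ∞ (fun q => f q * (f (x, y))⁻¹) :=
    hf.mul contMDiff_const
  have hVs : ContDiffAt ℝ ∞ V (x, y) := contDiffAt_oneChart_comp hF.contMDiffAt (by simp)
  have hV0 : V (x, y) = oneCoord EG G := by simp [hV]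
  have hmem : ∀ᶠ q in 𝓝 (x, y), f q * (f (x, y))⁻¹ ∈ (oneChart EG G).source :=
    ContMDiffAt.eventually_mem_oneChart hF.contMDiffAt (by simp)
  have hdiff : ∀ q, f q * (f (x, y))⁻¹ ∈ (oneChart EG G).source →
      HasFDerivAt V (fderiv ℝ V q) q := fun q hq =>
    ((contDiffAt_oneChart_comp hF.contMDiffAt hq).differentiableAt (by simp)).hasFDerivAt
  have hVx : ∀ᶠ q in 𝓝 (x, y), fderiv ℝ V q (1, 0) = rightTrans EG G (V q) (α q) := by
    filter_upwards [hmem] with q hq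
    have e1 := (hdiff q hq).comp_hasDerivAt q.1
      ((hasDerivAt_id q.1).prodMk (hasDerivAt_const q.1 q.2))
    have e2 := hasDerivAt_oneChart (u := fun s => f (s, q.2) * (f (x, y))⁻¹) (x := q.1)
      (hF.comp (contDiff_id.prodMk contDiff_const).contMDiff).contMDiffAt hq
    rw [rightLogDeriv_mul_const, hα] at e2
    exact e1.unique e2
  have hVy : ∀ᶠ q in 𝓝 (x, y), fderiv ℝ V q (0, 1) = rightTrans EG G (V q) (φ q) := by
    filter_upwards [hmem] with q hq
    have e1 := (hdiff q hq).comp_hasDerivAt q.2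
      ((hasDerivAt_const q.2 q.1).prodMk (hasDerivAt_id q.2))
    have e2 := hasDerivAt_oneChart (u := fun s => f (q.1, s) * (f (x, y))⁻¹) (x := q.2)
      (hF.comp (contDiff_const.prodMk contDiff_id).contMDiff).contMDiffAt hq
    rw [rightLogDeriv_mul_const, hφ] at e2
    exact e1.unique e2
  have hxc : HasDerivAt (fun s : ℝ => (s, y)) (1, 0) x :=
    (hasDerivAt_id x).prodMk (hasDerivAt_const x y)
  have hyc : HasDerivAt (fun s : ℝ => (x, s)) (0, 1) y :=
    (hasDerivAt_const y x).prodMk (hasDerivAt_id y)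
  have hV2 : HasFDerivAt (fderiv ℝ V) (fderiv ℝ (fderiv ℝ V) (x, y)) (x, y) :=
    ((hVs.fderiv_right (m := ∞) (by simp)).differentiableAt (by simp)).hasFDerivAt
  have hsymm := (hVs.isSymmSndFDerivAt
    (by simpa using two_le_infty)).eq
    (0, 1) (1, 0)
  have hr : HasFDerivAt (rightTrans EG G) (fderiv ℝ (rightTrans EG G) (oneCoord EG G))
      (V (x, y)) := by rw [hV0]; exact hasFDerivAt_rightTrans_oneCoord
  have hd0 := hdiff (x, y) hmem.self_of_nhds
  have ex : fderiv ℝ V (x, y) (1, 0) = α (x, y) := by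
    rw [hVx.self_of_nhds, hV0, rightTrans_oneCoord]; rfl
  have ey : fderiv ℝ V (x, y) (0, 1) = φ (x, y) := by
    rw [hVy.self_of_nhds, hV0, rightTrans_oneCoord]; rfl
  have m1 : HasDerivAt (fun s => fderiv ℝ V (x, s) (1, 0))
      (fderiv ℝ (fderiv ℝ V) (x, y) (0, 1) (1, 0)) y :=
    ((ContinuousLinearMap.apply ℝ EG ((1 : ℝ), (0 : ℝ))).hasFDerivAt).comp_hasDerivAt y
      (hV2.comp_hasDerivAt y hyc)
  have m2 : HasDerivAt (fun s => fderiv ℝ V (s, y) (0, 1))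
      (fderiv ℝ (fderiv ℝ V) (x, y) (1, 0) (0, 1)) x :=
    ((ContinuousLinearMap.apply ℝ EG ((0 : ℝ), (1 : ℝ))).hasFDerivAt).comp_hasDerivAt x
      (hV2.comp_hasDerivAt x hxc)
  have r1 : HasDerivAt (fun s => rightTrans EG G (V (x, s)))
      (fderiv ℝ (rightTrans EG G) (oneCoord EG G) (φ (x, y))) y :=
    ey ▸ HasFDerivAt.comp_hasDerivAt (l := rightTrans EG G) (f := fun s => V (x, s)) y hr
      (hd0.comp_hasDerivAt y hyc)
  have r2 : HasDerivAt (fun s => rightTrans EG G (V (s, y)))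
      (fderiv ℝ (rightTrans EG G) (oneCoord EG G) (α (x, y))) x :=
    ex ▸ HasFDerivAt.comp_hasDerivAt (l := rightTrans EG G) (f := fun s => V (s, y)) x hr
      (HasFDerivAt.comp_hasDerivAt (l := V) (f := fun s => (s, y)) x hd0 hxc)
  have k1 := m1.unique ((r1.clm_apply hα').congr_of_eventuallyEq
    (hyc.continuousAt.eventually hVx))
  have k2 := m2.unique ((r2.clm_apply hφ').congr_of_eventuallyEq
    (hxc.continuousAt.eventually hVy))
  simp only [hV0, rightTrans_oneCoord, ContinuousLinearMap.id_apply,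
    fderiv_rightTrans_apply] at k1 k2
  rw [lieBr_eq]
  rw [k1, k2] at hsymm
  rw [sub_eq_sub_iff_add_eq_add, add_comm φ', ← hsymm, add_comm]

end MaurerCartan

/-- A map which is smooth near a point agrees near this point with a globally smooth map. -/
theorem exists_contDiff_eventuallyEq {E F : Type*} [NormedAddCommGroup E] [NormedSpace ℝ E]
    [FiniteDimensional ℝ E] [NormedAddCommGroup F] [NormedSpace ℝ F] {f : E → F} {z : E}
    (hf : ∀ᶠ x in 𝓝 z, ContDiffAt ℝ ∞ f x) : ∃ g : E → F, ContDiff ℝ ∞ g ∧ g =ᶠ[𝓝 z] f := by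
  obtain ⟨r, hr, h⟩ := Metric.eventually_nhds_iff_ball.1 hf
  let χ : ContDiffBump z := ⟨r / 4, r / 2, by positivity, by linarith⟩
  refine ⟨fun x => χ x • f x, contDiff_iff_contDiffAt.2 fun x => ?_, ?_⟩
  · by_cases hx : x ∈ Metric.ball z r
    · exact χ.contDiff.contDiffAt.smul (h x hx)
    · have hx2 : x ∈ (tsupport χ)ᶜ := by
        rw [χ.tsupport_eq]
        intro hx3
        exact hx (lt_of_le_of_lt (Metric.mem_closedBall.1 hx3) (by change r / 2 < r; linarith))
      refine contDiffAt_const (c := (0 : F)) |>.congr_of_eventuallyEq ?_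
      filter_upwards [(isClosed_tsupport χ).isOpen_compl.mem_nhds hx2] with y hy
      rw [image_eq_zero_of_notMem_tsupport hy, zero_smul]
  · filter_upwards [χ.eventuallyEq_one] with x hx
    rw [hx]
    exact one_smul ℝ _

/-! ### From local to arbitrary intervals -/

section IntervalGluing

/-- A gluing principle for properties of open intervals. -/
theorem forall_Ioo_of_local {Q : ℝ → ℝ → Prop}
    (hmono : ∀ a b c d, a ≤ c → d ≤ b → Q a b → Q c d)
    (hglue : ∀ a b c d, a ≤ c → c < b → b ≤ d → Q a b → Q c d → Q a d)
    (hloc : ∀ t, ∃ ε > 0, Q (t - ε) (t + ε)) (a b : ℝ) : Q a b := by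
  rcases le_or_gt b a with hab | hab
  · obtain ⟨ε, hε, h⟩ := hloc a
    exact hmono _ _ _ _ (by linarith) (by linarith) h
  obtain ⟨ε₀, hε₀, h₀⟩ := hloc a
  -- Starting at `a - ε₀` rather than `a` leaves room on the left: the left end `c - min ε ε₀` of
  -- the last piece is still at least `a - ε₀`, even if the supremum `c` equals `a`.
  set S : Set ℝ := {x | x ≤ b ∧ Q (a - ε₀) x} with hS
  have haS : a ∈ S := ⟨hab.le, hmono _ _ _ _ le_rfl (by linarith) h₀⟩
  have hbdd : BddAbove S := ⟨b, fun x hx => hx.1⟩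
  set c := sSup S
  have hac : a ≤ c := le_csSup hbdd haS
  obtain ⟨ε, hε, hc⟩ := hloc c
  obtain ⟨x, hxS, hx⟩ := exists_lt_of_lt_csSup ⟨a, haS⟩ (show c - min ε ε₀ < c by
    linarith [lt_min hε hε₀])
  have hxc : x ≤ c := le_csSup hbdd hxS
  have hnew : Q (a - ε₀) (c + ε) :=
    hglue _ x (c - min ε ε₀) _ (by linarith [min_le_right ε ε₀]) hx (by linarith) hxS.2
      (hmono _ _ _ _ (by linarith [min_le_left ε ε₀]) le_rfl hc)
  have hbc : b ≤ c + ε := by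
    by_contra hlt
    have : c + ε ≤ c := le_csSup hbdd ⟨by linarith, hnew⟩
    linarith
  exact hmono _ _ _ _ (by linarith) hbc hnew

end IntervalGluing

/-! ### Linear equations in a Lie group, with parameters -/

section LieGroupODE

universe u

variable {EG : Type u} [NormedAddCommGroup EG] [NormedSpace ℝ EG]
  {G : Type*} [TopologicalSpace G] [ChartedSpace EG G] [Group G]
  {P : Type} [NormedAddCommGroup P] [NormedSpace ℝ P]

/-- `w` solves the equation `∂ₜ w(p, t) w(p, t)⁻¹ = A(p, t)` on `U × J`. -/
def SolvesOn (A : P × ℝ → EG) (w : P × ℝ → G) (U : Set P) (J : Set ℝ) : Prop :=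
  ∀ p ∈ U, ∀ t ∈ J, ContMDiffAt 𝓘(ℝ, P × ℝ) 𝓘(ℝ, EG) ∞ w (p, t) ∧
    rightLogDeriv EG (fun s => w (p, s)) t = A (p, t)

theorem SolvesOn.mono {A : P × ℝ → EG} {w : P × ℝ → G} {U U' : Set P} {J J' : Set ℝ}
    (h : SolvesOn A w U J) (hU : U' ⊆ U) (hJ : J' ⊆ J) : SolvesOn A w U' J' :=
  fun p hp t ht => h p (hU hp) t (hJ ht)

theorem SolvesOn.contMDiffAt_slice {A : P × ℝ → EG} {w : P × ℝ → G} {U : Set P} {J : Set ℝ}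
    (h : SolvesOn A w U J) {p : P} (hp : p ∈ U) {t : ℝ} (ht : t ∈ J) :
    ContMDiffAt 𝓘(ℝ, ℝ) 𝓘(ℝ, EG) ∞ (fun s => w (p, s)) t :=
  ContMDiffAt.comp (g := w) (f := fun s => (p, s)) t (h p hp t ht).1
    (contDiff_const.prodMk contDiff_id).contMDiff.contMDiffAt

theorem SolvesOn.contMDiffAt_param {A : P × ℝ → EG} {w : P × ℝ → G} {U : Set P} {J : Set ℝ}
    (h : SolvesOn A w U J) {t : ℝ} (ht : t ∈ J) {p : P} (hp : p ∈ U) :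
    ContMDiffAt 𝓘(ℝ, P) 𝓘(ℝ, EG) ∞ (fun p => w (p, t)) p :=
  ContMDiffAt.comp (g := w) (f := fun p => (p, t)) p (h p hp t ht).1
    (contDiff_id.prodMk contDiff_const).contMDiff.contMDiffAt

variable [LieGroup 𝓘(ℝ, EG) ∞ G]

/-- Right multiplication of a solution by a function of the parameter. -/
theorem SolvesOn.mul_param {A : P × ℝ → EG} {w : P × ℝ → G} {U : Set P} {J : Set ℝ}
    (h : SolvesOn A w U J) {g : P → G} (hg : ∀ p ∈ U, ContMDiffAt 𝓘(ℝ, P) 𝓘(ℝ, EG) ∞ g p) :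
    SolvesOn A (fun q => w q * g q.1) U J := fun p hp t ht =>
  ⟨(h p hp t ht).1.mul (ContMDiffAt.comp (g := g) (f := Prod.fst) (p, t) (hg p hp)
    contDiff_fst.contMDiff.contMDiffAt), by
    change rightLogDeriv EG (fun s => w (p, s) * g p) t = _
    rw [rightLogDeriv_mul_const]; exact (h p hp t ht).2⟩

/-- Solutions on overlapping intervals can be glued. -/
theorem SolvesOn.glue {A : P × ℝ → EG} {w₁ w₂ : P × ℝ → G} {U : Set P} (hU : IsOpen U)
    {a b c d : ℝ} (hac : a ≤ c) (hcb : c < b) (hbd : b ≤ d) (h₁ : SolvesOn A w₁ U (Ioo a b))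
    (h₂ : SolvesOn A w₂ U (Ioo c d)) : ∃ w : P × ℝ → G, SolvesOn A w U (Ioo a d) := by
  obtain ⟨s, hs1, hs2⟩ := exists_between hcb
  have hsb : s ∈ Ioo a b := ⟨by linarith, hs2⟩
  have hsd : s ∈ Ioo c d := ⟨hs1, by linarith⟩
  -- A right factor depending on the parameter alone makes the second solution agree with the first
  -- at time `s`; by uniqueness they then agree on the whole overlap.
  set w₃ : P × ℝ → G := fun q => w₂ q * ((w₂ (q.1, s))⁻¹ * w₁ (q.1, s)) with hw₃
  have h₃ : SolvesOn A w₃ U (Ioo c d) :=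
    h₂.mul_param (g := fun p => (w₂ (p, s))⁻¹ * w₁ (p, s)) fun p hp =>
      (h₂.contMDiffAt_param hsd hp).inv.mul (h₁.contMDiffAt_param hsb hp)
  have heq : ∀ p ∈ U, EqOn (fun t => w₁ (p, t)) (fun t => w₃ (p, t)) (Ioo c b) := by
    intro p hp
    have hs1' : Ioo c b ⊆ Ioo a b := Ioo_subset_Ioo_left hac
    have hs2' : Ioo c b ⊆ Ioo c d := Ioo_subset_Ioo_right hbd
    refine eqOn_of_rightLogDeriv_eq (EG := EG) isOpen_Ioo isPreconnected_Ioo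
      (fun t ht => h₁.contMDiffAt_slice hp (hs1' ht))
      (fun t ht => h₃.contMDiffAt_slice hp (hs2' ht)) (fun t ht => ?_)
      (x := s) ⟨hs1, hs2⟩ (by simp [hw₃])
    rw [(h₁ p hp t (hs1' ht)).2, (h₃ p hp t (hs2' ht)).2]
  classical
  set w : P × ℝ → G := fun q => if q.2 < s then w₁ q else w₃ q with hw
  have e1 : ∀ p ∈ U, ∀ t ∈ Ioo a b, w (p, t) = w₁ (p, t) := by
    intro p hp t ht
    by_cases hts : t < s
    · simp [hw, hts]
    · have : t ∈ Ioo c b := ⟨by linarith, ht.2⟩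
      simp only [hw, hts, if_false]
      exact (heq p hp this).symm
  have e2 : ∀ p ∈ U, ∀ t ∈ Ioo c d, w (p, t) = w₃ (p, t) := by
    intro p hp t ht
    by_cases hts : t < s
    · have : t ∈ Ioo c b := ⟨ht.1, by linarith⟩
      simp only [hw, hts, if_true]
      exact heq p hp this
    · simp [hw, hts]
  have key : ∀ (w' : P × ℝ → G) (J : Set ℝ), IsOpen J → SolvesOn A w' U J →
      (∀ p ∈ U, ∀ t ∈ J, w (p, t) = w' (p, t)) → SolvesOn A w U J := by
    intro w' J hJ h' he p hp t ht
    refine ⟨(h' p hp t ht).1.congr_of_eventuallyEq ?_, ?_⟩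
    · filter_upwards [(hU.prod hJ).mem_nhds (show (p, t) ∈ U ×ˢ J from ⟨hp, ht⟩)] with q hq
      exact he q.1 hq.1 q.2 hq.2
    · rw [← (h' p hp t ht).2]
      refine rightLogDeriv_congr ?_
      filter_upwards [hJ.mem_nhds ht] with r hr
      exact he p hp r hr
  refine ⟨w, fun p hp t ht => ?_⟩
  rcases lt_or_ge t b with htb | htb
  · exact key w₁ _ isOpen_Ioo h₁ e1 p hp t ⟨ht.1, htb⟩
  · exact key w₃ _ isOpen_Ioo h₃ e2 p hp t ⟨by linarith, ht.2⟩

variable [FiniteDimensional ℝ EG] [CompleteSpace P]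

/-- Local existence and smoothness of solutions. -/
theorem exists_solvesOn_local {A : P × ℝ → EG} (hA : ContDiff ℝ ∞ A) (p₀ : P) (t₀ : ℝ) :
    ∃ ε > 0, ∃ U : Set P, IsOpen U ∧ p₀ ∈ U ∧ ∃ w : P × ℝ → G,
      SolvesOn A w U (Ioo (t₀ - ε) (t₀ + ε)) := by
  have : CompleteSpace EG := FiniteDimensional.complete ℝ EG
  -- The flow theorem wants a globally smooth vector field, while `rightTrans` is controlled only on
  -- the chart; `ρ` agrees with it near the identity.
  obtain ⟨ρ, hρ, hρe⟩ := exists_contDiff_eventuallyEq (f := rightTrans EG G)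
    (z := oneCoord EG G) (by
      filter_upwards [(oneChart EG G).open_target.mem_nhds oneCoord_mem] with v hv
      exact contDiffAt_rightTrans hv)
  -- The equation made autonomous: the parameter becomes a frozen coordinate and time a coordinate
  -- of unit speed, so that smoothness of the flow includes smooth dependence on both. `hfst` and
  -- `hsnd` recover `p` and `t` from the flow.
  let X : P × ℝ × EG → P × ℝ × EG := fun q => (0, 1, ρ q.2.2 (A (q.1, q.2.1)))
  have hX : ContDiff ℝ ∞ X := by
    refine contDiff_const.prodMk (contDiff_const.prodMk (ContDiff.clm_apply ?_ ?_))
    · exact hρ.comp (contDiff_snd.comp contDiff_snd)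
    · exact hA.comp (contDiff_fst.prodMk (contDiff_fst.comp contDiff_snd))
  obtain ⟨ε, hε, U, hU, φ, hφ, hφ0⟩ := exists_smooth_localFlow hX (p₀, t₀, oneCoord EG G)
  have hU0 : (p₀, t₀, oneCoord EG G) ∈ U := mem_of_mem_nhds hU
  let ι : P → P × ℝ × EG := fun p => (p, t₀, oneCoord EG G)
  have hι : ContDiff ℝ ∞ ι := contDiff_id.prodMk contDiff_const
  let v : P × ℝ → EG := fun q => (φ (q.2 - t₀, ι q.1)).2.2
  have hκ : ContDiff ℝ ∞ (fun q : P × ℝ => (q.2 - t₀, ι q.1)) :=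
    (contDiff_snd.sub contDiff_const).prodMk (hι.comp contDiff_fst)
  have hv : ∀ p t, ι p ∈ U → t ∈ Ioo (t₀ - ε) (t₀ + ε) → ContDiffAt ℝ ∞ v (p, t) := by
    intro p t hp ht
    have h1 := (hφ (t - t₀) ⟨by linarith [ht.1], by linarith [ht.2]⟩ (ι p) hp).1
    have h2 : ContDiffAt ℝ ∞ (fun q : P × ℝ => φ (q.2 - t₀, ι q.1)) (p, t) :=
      ContDiffAt.comp (g := φ) (p, t) h1 hκ.contDiffAt
    exact contDiffAt_snd.comp _ (contDiffAt_snd.comp _ h2)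
  have hv0 : v (p₀, t₀) = oneCoord EG G := by
    simp only [v, sub_self, ι]
    rw [hφ0 _ hU0]
  have hgood : ∀ᶠ q : P × ℝ in 𝓝 (p₀, t₀), v q ∈ (oneChart EG G).target ∧
      ρ (v q) = rightTrans EG G (v q) := by
    have hc := (hv p₀ t₀ hU0 ⟨by linarith, by linarith⟩).continuousAt
    refine hc.eventually (p := fun y => y ∈ (oneChart EG G).target ∧ ρ y = rightTrans EG G y) ?_
    rw [hv0]
    exact Filter.Eventually.and ((oneChart EG G).open_target.mem_nhds oneCoord_mem) hρe
  have hUp : ∀ᶠ p in 𝓝 p₀, ι p ∈ U := hι.continuous.continuousAt.eventually hU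
  rw [nhds_prod_eq, eventually_prod_iff] at hgood
  obtain ⟨q1, hq1, q2, hq2, hgood⟩ := hgood
  obtain ⟨δ, hδ, hq2⟩ := Metric.eventually_nhds_iff_ball.1 hq2
  obtain ⟨U', hU', hU'o, hpU'⟩ := eventually_nhds_iff.1 (hq1.and hUp)
  refine ⟨min ε δ, lt_min hε hδ, U', hU'o, hpU', fun q => (oneChart EG G).symm (v q), ?_⟩
  intro p hp t ht
  have htε : t ∈ Ioo (t₀ - ε) (t₀ + ε) :=
    ⟨by linarith [ht.1, min_le_left ε δ], by linarith [ht.2, min_le_left ε δ]⟩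
  have htδ : ∀ s ∈ Ioo (t₀ - min ε δ) (t₀ + min ε δ), q2 s := fun s hs => by
    refine hq2 s ?_
    rw [Real.ball_eq_Ioo]
    exact ⟨by linarith [hs.1, min_le_right ε δ], by linarith [hs.2, min_le_right ε δ]⟩
  have hpU : ι p ∈ U := (hU' p hp).2
  have hg := hgood (hU' p hp).1 (htδ t ht)
  have hsm : ContMDiffAt 𝓘(ℝ, P × ℝ) 𝓘(ℝ, EG) ∞ (fun q => (oneChart EG G).symm (v q)) (p, t) :=
    ContMDiffAt.comp (g := (oneChart EG G).symm) (p, t) (contMDiffAt_oneChart_symm hg.1)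
      (hv p t hpU htε).contMDiffAt
  refine ⟨hsm, ?_⟩
  have hflow : ∀ s ∈ Ioo (-ε) ε, HasDerivAt (fun σ => φ (σ, ι p)) (X (φ (s, ι p))) s :=
    fun s hs => (hφ s hs _ hpU).2
  have h0 : (0 : ℝ) ∈ Ioo (-ε) ε := ⟨by linarith, hε⟩
  have hts : t - t₀ ∈ Ioo (-ε) ε := ⟨by linarith [htε.1], by linarith [htε.2]⟩
  have hfst : (φ (t - t₀, ι p)).1 = p := by
    have key := (convex_Ioo (-ε) ε).norm_image_sub_le_of_norm_hasDerivWithin_le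
      (f := fun σ => (φ (σ, ι p)).1) (f' := fun _ => 0) (C := 0)
      (fun s hs => ((ContinuousLinearMap.fst ℝ P (ℝ × EG)).hasFDerivAt.comp_hasDerivAt s
        (hflow s hs)).hasDerivWithinAt) (fun _ _ => norm_zero.le) h0 hts
    rw [zero_mul, norm_le_zero_iff, sub_eq_zero] at key
    rw [key, hφ0 _ hpU]
  have hsnd : (φ (t - t₀, ι p)).2.1 = t := by
    have key := (convex_Ioo (-ε) ε).norm_image_sub_le_of_norm_hasDerivWithin_le
      (f := fun σ => (φ (σ, ι p)).2.1 - σ) (f' := fun _ => 0) (C := 0)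
      (fun s hs => by
        have h2 := ((ContinuousLinearMap.fst ℝ ℝ EG).comp
          (ContinuousLinearMap.snd ℝ P (ℝ × EG))).hasFDerivAt.comp_hasDerivAt s (hflow s hs)
        have h3 := (h2.sub (hasDerivAt_id s)).hasDerivWithinAt (s := Ioo (-ε) ε)
        exact h3.congr_deriv (by simp [X])) (fun _ _ => norm_zero.le) h0 hts
    rw [zero_mul, norm_le_zero_iff, sub_eq_zero, hφ0 _ hpU] at key
    have : (φ (t - t₀, ι p)).2.1 = (t - t₀) + t₀ := by
      simp only [ι, sub_zero] at key ⊢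
      linarith
    rw [this]; ring
  have hd : HasDerivAt (fun s => v (p, s)) (rightTrans EG G (v (p, t)) (A (p, t))) t := by
    have h2 := ((ContinuousLinearMap.snd ℝ ℝ EG).comp
      (ContinuousLinearMap.snd ℝ P (ℝ × EG))).hasFDerivAt.comp_hasDerivAt _ (hflow _ hts)
    have h3 := HasDerivAt.comp_sub_const t t₀ h2
    refine h3.congr_deriv ?_
    change ρ (v (p, t)) (A ((φ (t - t₀, ι p)).1, (φ (t - t₀, ι p)).2.1)) = _
    rw [hfst, hsnd, hg.2]
  have hslice : ContMDiffAt 𝓘(ℝ, ℝ) 𝓘(ℝ, EG) ∞ (fun s => (oneChart EG G).symm (v (p, s))) t :=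
    ContMDiffAt.comp (g := fun q => (oneChart EG G).symm (v q)) (f := fun s => (p, s)) t hsm
      (contDiff_const.prodMk contDiff_id).contMDiff.contMDiffAt
  refine rightLogDeriv_eq_of_hasDerivAt_oneChart hslice ((oneChart EG G).map_target hg.1) ?_
  rw [(oneChart EG G).right_inv hg.1]
  refine hd.congr_of_eventuallyEq ?_
  filter_upwards [isOpen_Ioo.mem_nhds ht] with s hs
  exact (oneChart EG G).right_inv (hgood (hU' p hp).1 (htδ s hs)).1

/-- Local solutions are glued along the time interval, the parameter neighbourhood being replaced by
an intersection at each gluing. Dividing on the right by the value at time `0` normalises the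
result. -/
theorem exists_solvesOn_Ioo {A : P × ℝ → EG} (hA : ContDiff ℝ ∞ A) (p₀ : P) (T : ℝ) (hT : 0 < T) :
    ∃ U : Set P, IsOpen U ∧ p₀ ∈ U ∧ ∃ w : P × ℝ → G,
      SolvesOn A w U (Ioo (-T) T) ∧ ∀ p, w (p, 0) = 1 := by
  have h := forall_Ioo_of_local (Q := fun a b => ∃ U : Set P, IsOpen U ∧ p₀ ∈ U ∧
      ∃ w : P × ℝ → G, SolvesOn A w U (Ioo a b))
    (fun a b c d hac hdb ⟨U, hU, hp, w, hw⟩ =>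
      ⟨U, hU, hp, w, hw.mono le_rfl (Ioo_subset_Ioo hac hdb)⟩)
    (fun a b c d hac hcb hbd ⟨U, hU, hp, w, hw⟩ ⟨U', hU', hp', w', hw'⟩ =>
      ⟨U ∩ U', hU.inter hU', ⟨hp, hp'⟩, (hw.mono inter_subset_left le_rfl).glue
        (hU.inter hU') hac hcb hbd (hw'.mono inter_subset_right le_rfl)⟩)
    (fun t => by
      obtain ⟨ε, hε, U, hU, hp, w, hw⟩ := exists_solvesOn_local (G := G) hA p₀ t
      exact ⟨ε, hε, U, hU, hp, w, hw⟩) (-T) T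
  obtain ⟨U, hU, hp, w, hw⟩ := h
  have h0 : (0 : ℝ) ∈ Ioo (-T) T := ⟨by linarith, hT⟩
  exact ⟨U, hU, hp, fun q => w q * (w (q.1, 0))⁻¹,
    hw.mul_param (g := fun p => (w (p, 0))⁻¹) fun p hp => (hw.contMDiffAt_param h0 hp).inv,
    fun p => by simp⟩

/-- Global existence and smooth dependence on parameters for the equation
`∂ₜ u(p, t) u(p, t)⁻¹ = A(p, t)`, `u(p, 0) = 1` in a Lie group. -/
theorem exists_solution {A : P × ℝ → EG} (hA : ContDiff ℝ ∞ A) :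
    ∃ u : P × ℝ → G, ContMDiff 𝓘(ℝ, P × ℝ) 𝓘(ℝ, EG) ∞ u ∧ (∀ p, u (p, 0) = 1) ∧
      ∀ p t, rightLogDeriv EG (fun s => u (p, s)) t = A (p, t) := by
  have hpos : ∀ t : ℝ, 0 < |t| + 1 := fun t => by positivity
  choose U hU hpU w hw hw0 using fun (p : P) (t : ℝ) =>
    exists_solvesOn_Ioo (G := G) hA p (|t| + 1) (hpos t)
  have hmem : ∀ t : ℝ, t ∈ Ioo (-(|t| + 1)) (|t| + 1) := fun t =>
    ⟨by linarith [neg_abs_le t], by linarith [le_abs_self t]⟩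
  -- The half-length `|t| + 1` keeps both `0` and `t` inside the interval. All chosen solutions
  -- equal `1` at time `0`, so they agree wherever they are defined together, and the diagonal
  -- choice `q ↦ w q.1 q.2 q` coincides with `w p t` near `(p, t)`.
  have heq : ∀ p t, ∀ q ∈ U p t, ∀ s ∈ Ioo (-(|t| + 1)) (|t| + 1), w q s (q, s) = w p t (q, s) := by
    intro p t q hq s hs
    have hlt : min (|t| + 1) (|s| + 1) > 0 := lt_min (hpos t) (hpos s)
    refine eqOn_of_rightLogDeriv_eq (EG := EG) (u := fun r => w q s (q, r))
      (v := fun r => w p t (q, r))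
      (J := Ioo (-(|s| + 1)) (|s| + 1) ∩ Ioo (-(|t| + 1)) (|t| + 1))
      (isOpen_Ioo.inter isOpen_Ioo) (by rw [Ioo_inter_Ioo]; exact isPreconnected_Ioo)
      (fun r hr => (hw q s).contMDiffAt_slice (hpU q s) hr.1)
      (fun r hr => (hw p t).contMDiffAt_slice hq hr.2)
      (fun r hr => by rw [(hw q s q (hpU q s) r hr.1).2, (hw p t q hq r hr.2).2])
      (x := 0) ⟨⟨by linarith [hpos s], hpos s⟩, ⟨by linarith [hpos t], hpos t⟩⟩
      (by rw [hw0, hw0]) ⟨hmem s, hs⟩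
  refine ⟨fun q => w q.1 q.2 q, fun q => ?_, fun p => hw0 p 0 p, fun p t => ?_⟩
  · obtain ⟨p, t⟩ := q
    refine ((hw p t p (hpU p t) t (hmem t)).1).congr_of_eventuallyEq ?_
    filter_upwards [((hU p t).prod isOpen_Ioo).mem_nhds
      (show (p, t) ∈ U p t ×ˢ Ioo (-(|t| + 1)) (|t| + 1) from ⟨hpU p t, hmem t⟩)] with r hr
    exact heq p t r.1 hr.1 r.2 hr.2
  · rw [← (hw p t p (hpU p t) t (hmem t)).2]
    refine rightLogDeriv_congr ?_
    filter_upwards [isOpen_Ioo.mem_nhds (hmem t)] with s hs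
    exact heq p t p (hpU p t) s hs

end LieGroupODE

/-! ### Smoothness and naturality of pulled-back forms -/

section Pullback

/-- Precomposition is continuous multilinear in the `n` copies of the operator and linear in the
form. The underlying multilinear maps suffice because the result is evaluated on fixed vectors. -/
theorem contDiffAt_continuousAlternatingMap_comp_apply {n : ℕ} {V E F P : Type*}
    [NormedAddCommGroup V] [NormedSpace ℝ V] [NormedAddCommGroup E] [NormedSpace ℝ E]
    [NormedAddCommGroup F] [NormedSpace ℝ F] [NormedAddCommGroup P] [NormedSpace ℝ P]
    {η : P → E [⋀^Fin n]→L[ℝ] F} {L : P → V →L[ℝ] E} {p : P} (hη : ContDiffAt ℝ ∞ η p)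
    (hL : ContDiffAt ℝ ∞ L p) (v : Fin n → V) :
    ContDiffAt ℝ ∞ (fun q => (η q).compContinuousLinearMap (L q) v) p := by
  have h1 : ContDiffAt ℝ ∞ (fun q =>
      ContinuousAlternatingMap.toContinuousMultilinearMapCLM ℝ (η q)) p :=
    ContDiffAt.comp (g := ContinuousAlternatingMap.toContinuousMultilinearMapCLM ℝ) p
      (ContinuousLinearMap.contDiff _).contDiffAt hη
  have h2 : ContDiffAt ℝ ∞ (fun q =>
      ContinuousMultilinearMap.compContinuousLinearMapContinuousMultilinear ℝ
        (fun _ : Fin n => V) (fun _ : Fin n => E) F (fun _ => L q)) p :=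
    (ContinuousMultilinearMap.contDiff _).contDiffAt.comp p (contDiffAt_pi.2 fun _ => hL)
  have h3 := h2.clm_apply h1
  exact (ContinuousMultilinearMap.apply ℝ (fun _ : Fin n => V) F v).contDiff.contDiffAt.comp p h3

variable {n : ℕ}
  {E : Type*} [NormedAddCommGroup E] [NormedSpace ℝ E]
  {M : Type*} [TopologicalSpace M] [ChartedSpace E M]
  {F : Type*} [NormedAddCommGroup F] [NormedSpace ℝ F]
  {V : Type*} [NormedAddCommGroup V] [NormedSpace ℝ V]

/-- The local representation of a form in the preferred chart at `p`. -/
noncomputable def DiffForm.inChart (α : DiffForm n E M F) (p : M) (e : E) : E [⋀^Fin n]→L[ℝ] F :=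
  (α.toFun ((chartAt E p).symm e)).compContinuousLinearMap
    (mfderiv 𝓘(ℝ, E) 𝓘(ℝ, E) (chartAt E p).symm e)

theorem DiffForm.contDiffAt_inChart (α : DiffForm n E M F) (p : M) {e : E}
    (he : e ∈ (chartAt E p).target) : ContDiffAt ℝ ∞ (α.inChart p) e :=
  (α.smooth p).contDiffAt ((chartAt E p).open_target.mem_nhds he)

theorem mfderiv_eq_fderiv_chartAt {S : V → M}
    (hS : ContMDiff 𝓘(ℝ, V) 𝓘(ℝ, E) ∞ S) (q v : V) :
    mfderiv 𝓘(ℝ, V) 𝓘(ℝ, E) S q v = fderiv ℝ (fun r => chartAt E (S q) (S r)) q v := by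
  rw [(hS.contMDiffAt.mdifferentiableAt (by simp)).mfderiv]
  simp [writtenInExtChartAt, extChartAt, fderivWithin_univ]
  rfl

/-- Naturality of pull-back along a reparametrisation, evaluated on vectors. -/
theorem DiffForm.pullback_comp_apply (α : DiffForm n E M F) {S : V → M}
    (hS : ContMDiff 𝓘(ℝ, V) 𝓘(ℝ, E) ∞ S) {U : Type*} [NormedAddCommGroup U] [NormedSpace ℝ U]
    {k : U → V} {x : U} {k' : U →L[ℝ] V} (hk : HasFDerivAt k k' x) (v : Fin n → U) :
    α.pullback (fun r => S (k r)) x v = α.pullback S (k x) (fun i => k' (v i)) := by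
  have h := mfderiv_comp (I := 𝓘(ℝ, U)) (g := S) (f := k) x
    (hS.contMDiffAt.mdifferentiableAt (by simp)) hk.differentiableAt.mdifferentiableAt
  rw [mfderiv_eq_fderiv, hk.fderiv] at h
  change (α.toFun (S (k x))) (fun i => mfderiv 𝓘(ℝ, U) 𝓘(ℝ, E) (S ∘ k) x (v i)) = _
  rw [h]
  rfl

variable [IsManifold 𝓘(ℝ, E) ∞ M]

theorem contDiffAt_chartAt_comp {S : V → M} (hS : ContMDiff 𝓘(ℝ, V) 𝓘(ℝ, E) ∞ S) {p : M} {q : V}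
    (hq : S q ∈ (chartAt E p).source) : ContDiffAt ℝ ∞ (fun r => chartAt E p (S r)) q := by
  have h := (contMDiffOn_chart (I := 𝓘(ℝ, E)) (n := ∞) (x := p)).contMDiffAt
    ((chartAt E p).open_source.mem_nhds hq)
  exact (ContMDiffAt.comp (g := chartAt E p) q h hS.contMDiffAt).contDiffAt

/-- The pull-back of a form, computed in a chart. -/
theorem DiffForm.pullback_eq_inChart (α : DiffForm n E M F) {S : V → M}
    (hS : ContMDiff 𝓘(ℝ, V) 𝓘(ℝ, E) ∞ S) {p : M} {q : V} (hq : S q ∈ (chartAt E p).source) :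
    α.pullback S q = (α.inChart p (chartAt E p (S q))).compContinuousLinearMap
      (fderiv ℝ (fun r => chartAt E p (S r)) q) := by
  have hk := contDiffAt_chartAt_comp hS hq
  have hS' : S =ᶠ[𝓝 q] fun r => (chartAt E p).symm (chartAt E p (S r)) := by
    filter_upwards [hS.continuous.continuousAt.eventually
      ((chartAt E p).open_source.mem_nhds hq)] with r hr
    exact ((chartAt E p).left_inv hr).symm
  have hsymm := (contMDiffOn_chart_symm (I := 𝓘(ℝ, E)) (n := ∞) (x := p)).contMDiffAt
    ((chartAt E p).open_target.mem_nhds ((chartAt E p).map_source hq))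
  have hd : mfderiv 𝓘(ℝ, V) 𝓘(ℝ, E) (fun r => (chartAt E p).symm (chartAt E p (S r))) q =
      (mfderiv 𝓘(ℝ, E) 𝓘(ℝ, E) (chartAt E p).symm (chartAt E p (S q))).comp
        (mfderiv 𝓘(ℝ, V) 𝓘(ℝ, E) (fun r => chartAt E p (S r)) q) :=
    mfderiv_comp (g := (chartAt E p).symm) (f := fun r => chartAt E p (S r)) q
      (hsymm.mdifferentiableAt (by simp)) (hk.contMDiffAt.mdifferentiableAt (by simp))
  let αF : M → E [⋀^Fin n]→L[ℝ] F := α.toFun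
  have hα : αF ((chartAt E p).symm (chartAt E p (S q))) = αF (S q) := by
    rw [(chartAt E p).left_inv hq]
  ext v
  change αF (S q) (fun i => (mfderiv 𝓘(ℝ, V) 𝓘(ℝ, E) S q : V →L[ℝ] E) (v i)) =
    αF ((chartAt E p).symm (chartAt E p (S q))) (fun i =>
      (mfderiv 𝓘(ℝ, E) 𝓘(ℝ, E) (chartAt E p).symm (chartAt E p (S q)) : E →L[ℝ] E)
        (fderiv ℝ (fun r => chartAt E p (S r)) q (v i)))
  rw [hα, hS'.mfderiv_eq]
  congr 1
  funext i
  have := congrArg (fun L : V →L[ℝ] E => L (v i)) hd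
  rw [mfderiv_eq_fderiv] at this
  exact this

theorem DiffForm.pullback_eventuallyEq (α : DiffForm n E M F) {S : V → M}
    (hS : ContMDiff 𝓘(ℝ, V) 𝓘(ℝ, E) ∞ S) (q : V) :
    α.pullback S =ᶠ[𝓝 q] fun r =>
      (α.inChart (S q) (chartAt E (S q) (S r))).compContinuousLinearMap
        (fderiv ℝ (fun r => chartAt E (S q) (S r)) r) := by
  filter_upwards [hS.continuous.continuousAt.eventually
    ((chartAt E (S q)).open_source.mem_nhds (mem_chart_source E (S q)))] with r hr
  exact α.pullback_eq_inChart hS hr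

theorem DiffForm.contDiff_pullback_apply (α : DiffForm n E M F) {S : V → M}
    (hS : ContMDiff 𝓘(ℝ, V) 𝓘(ℝ, E) ∞ S) (v : Fin n → V) :
    ContDiff ℝ ∞ (fun q => α.pullback S q v) := by
  rw [contDiff_iff_contDiffAt]
  intro q
  have hk := contDiffAt_chartAt_comp hS (mem_chart_source E (S q))
  have h1 : ContDiffAt ℝ ∞ (fun r => α.inChart (S q) (chartAt E (S q) (S r))) q :=
    ContDiffAt.comp (g := α.inChart (S q)) q
      (α.contDiffAt_inChart (S q) (mem_chart_target E (S q))) hk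
  have h2 : ContDiffAt ℝ ∞ (fderiv ℝ (fun r => chartAt E (S q) (S r))) q :=
    hk.fderiv_right (m := ∞) (by simp)
  refine (contDiffAt_continuousAlternatingMap_comp_apply h1 h2 v).congr_of_eventuallyEq ?_
  filter_upwards [α.pullback_eventuallyEq hS q] with r hr
  rw [hr]

/-- The exterior derivative commutes with pull-back. -/
theorem DiffForm.extDeriv_pullback (α : DiffForm n E M F) {S : V → M}
    (hS : ContMDiff 𝓘(ℝ, V) 𝓘(ℝ, E) ∞ S) (q : V) :
    extDeriv (α.pullback S) q = (α.extDerivAt (S q)).compContinuousLinearMap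
      (fderiv ℝ (fun r => chartAt E (S q) (S r)) q) := by
  rw [(α.pullback_eventuallyEq hS q).extDeriv_eq]
  exact _root_.extDeriv_pullback (f := fun r => chartAt E (S q) (S r))
    ((α.contDiffAt_inChart (S q) (mem_chart_target E (S q))).differentiableAt (by simp))
    (contDiffAt_chartAt_comp hS (mem_chart_source E (S q))) (by simp [two_le_infty])

theorem DiffForm.differentiableAt_pullback (α : DiffForm n E M F) {S : V → M}
    (hS : ContMDiff 𝓘(ℝ, V) 𝓘(ℝ, E) ∞ S) (q : V) : DifferentiableAt ℝ (α.pullback S) q := by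
  have hk := contDiffAt_chartAt_comp hS (mem_chart_source E (S q))
  have h1 : ContDiffAt ℝ ∞ (fun r => α.inChart (S q) (chartAt E (S q) (S r))) q :=
    ContDiffAt.comp (g := α.inChart (S q)) q
      (α.contDiffAt_inChart (S q) (mem_chart_target E (S q))) hk
  refine DifferentiableAt.congr_of_eventuallyEq ?_ (α.pullback_eventuallyEq hS q)
  exact DifferentiableAt.continuousAlternatingMapCompContinuousLinearMap
    (h1.differentiableAt (by simp))
    ((hk.fderiv_right (m := ∞) (by simp)).differentiableAt (by simp))

end Pullback

/-! ### Zero fake curvature on the plane -/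

section Curvature

variable {EG : Type*} [NormedAddCommGroup EG] [NormedSpace ℝ EG]
  {EH : Type*} [NormedAddCommGroup EH] [NormedSpace ℝ EH]
  {G : Type*} [TopologicalSpace G] [ChartedSpace EG G] [Group G]
  {H : Type*} [TopologicalSpace H] [ChartedSpace EH H] [Group H]
  {X : LieCrossedModule EG EH G H}
  {E : Type*} [NormedAddCommGroup E] [NormedSpace ℝ E]
  {M : Type*} [TopologicalSpace M] [ChartedSpace E M] [IsManifold 𝓘(ℝ, E) ∞ M]

/-- The vanishing of the fake curvature, pulled back to `ℝ²`. -/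
theorem ConnectionDoublet.pullback_fake_curvature (D : ConnectionDoublet X E M) {S : ℝ × ℝ → M}
    (hS : ContMDiff 𝓘(ℝ, ℝ × ℝ) 𝓘(ℝ, E) ∞ S) (x y : ℝ) :
    deriv (fun s => D.θ.pullback S (s, y) ![(0, 1)]) x
      - deriv (fun s => D.θ.pullback S (x, s) ![(1, 0)]) y
      + lieBr G (D.θ.pullback S (x, y) ![(1, 0)]) (D.θ.pullback S (x, y) ![(0, 1)])
      = X.tDot (D.Υ.pullback S (x, y) ![(1, 0), (0, 1)]) := by
  have hd := D.θ.differentiableAt_pullback hS (x, y)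
  have h1 := extDeriv_apply hd ![((1 : ℝ), (0 : ℝ)), (0, 1)]
  let L : ℝ × ℝ →L[ℝ] E := mfderiv 𝓘(ℝ, ℝ × ℝ) 𝓘(ℝ, E) S (x, y)
  let θp : E [⋀^Fin 1]→L[ℝ] EG := D.θ.toFun (S (x, y))
  let Υp : E [⋀^Fin 2]→L[ℝ] EH := D.Υ.toFun (S (x, y))
  have hc : D.θ.extDerivAt (S (x, y)) ![L (1, 0), L (0, 1)]
      + lieBr G (θp ![L (1, 0)]) (θp ![L (0, 1)]) - X.tDot (Υp ![L (1, 0), L (0, 1)]) = 0 :=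
    D.fake_curvature (S (x, y)) (L (1, 0)) (L (0, 1))
  have hvec1 : ∀ v : ℝ × ℝ, (fun i => L (![v] i)) = ![L v] := fun v => by
    funext i; fin_cases i; rfl
  have hvec2 : ∀ v w : ℝ × ℝ, (fun i => L (![v, w] i)) = ![L v, L w] :=
    fun v w => by funext i; fin_cases i <;> rfl
  have e1 : ∀ v, D.θ.pullback S (x, y) ![v] = θp ![L v] :=
    fun v => congrArg θp (hvec1 v)
  have e2 : ∀ v w, D.Υ.pullback S (x, y) ![v, w] = Υp ![L v, L w] :=
    fun v w => congrArg Υp (hvec2 v w)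
  have e3 : extDeriv (D.θ.pullback S) (x, y) ![((1 : ℝ), (0 : ℝ)), (0, 1)] =
      D.θ.extDerivAt (S (x, y)) ![L (1, 0), L (0, 1)] := by
    rw [← hvec2, D.θ.extDeriv_pullback hS]
    have hL : ∀ v, L v = fderiv ℝ (fun r => chartAt E (S (x, y)) (S r)) (x, y) v :=
      fun v => mfderiv_eq_fderiv_chartAt hS (x, y) v
    simp only [hL]
    rfl
  rw [← e1, ← e1, ← e2, ← e3, h1, sub_eq_zero] at hc
  rw [← hc, Fin.sum_univ_two]
  -- The exterior derivative on `(e₁, e₂)` is an alternating sum in which the omitted vector is the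
  -- direction of differentiation; these two identities turn it into `∂ₓ a_y - ∂_y aₓ`.
  have r0 : Fin.removeNth 0 ![((1 : ℝ), (0 : ℝ)), (0, 1)] = ![((0 : ℝ), (1 : ℝ))] := by
    funext i; fin_cases i; rfl
  have r1 : Fin.removeNth 1 ![((1 : ℝ), (0 : ℝ)), (0, 1)] = ![((1 : ℝ), (0 : ℝ))] := by
    funext i; fin_cases i; rfl
  have hs : ∀ v, DifferentiableAt ℝ (fun q => D.θ.pullback S q ![v]) (x, y) := fun v =>
    (D.θ.contDiff_pullback_apply hS ![v]).contDiffAt.differentiableAt (by simp)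
  have dx : deriv (fun s => D.θ.pullback S (s, y) ![(0, 1)]) x =
      fderiv ℝ (fun q => D.θ.pullback S q ![(0, 1)]) (x, y) (1, 0) :=
    (HasFDerivAt.comp_hasDerivAt (l := fun q => D.θ.pullback S q ![(0, 1)])
      (f := fun s => (s, y)) x (hs (0, 1)).hasFDerivAt
      ((hasDerivAt_id x).prodMk (hasDerivAt_const x y))).deriv
  have dy : deriv (fun s => D.θ.pullback S (x, s) ![(1, 0)]) y =
      fderiv ℝ (fun q => D.θ.pullback S q ![(1, 0)]) (x, y) (0, 1) :=
    (HasFDerivAt.comp_hasDerivAt (l := fun q => D.θ.pullback S q ![(1, 0)])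
      (f := fun s => (x, s)) y (hs (1, 0)).hasFDerivAt
      ((hasDerivAt_const y x).prodMk (hasDerivAt_id y))).deriv
  rw [dx, dy, r0, r1]
  simp [sub_eq_add_neg]

end Curvature

/-! ### Differentiating along the adjoint action -/

section AdjointDerivative

variable {EG : Type*} [NormedAddCommGroup EG] [NormedSpace ℝ EG]
  {G : Type*} [TopologicalSpace G] [ChartedSpace EG G] [Group G] [LieGroup 𝓘(ℝ, EG) ∞ G]

theorem lieBr_neg_left (v w : EG) : lieBr G (-v) w = -lieBr G v w := by
  have h : (-v, (0 : EG)) = -(v, 0) := by simp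
  have h' : ((0 : EG), -v) = -(0, v) := by simp
  simp only [lieBr_eq, h, h', map_neg, neg_apply]
  abel

theorem lieBr_add_right (v w w' : EG) : lieBr G v (w + w') = lieBr G v w + lieBr G v w' := by
  have h : (w + w', (0 : EG)) = (w, 0) + (w', 0) := by simp
  have h' : ((0 : EG), w + w') = (0, w) + (0, w') := by simp
  simp only [lieBr_eq, h, h', map_add, add_apply]
  abel

/-- The derivative of `s ↦ Ad(F(s)⁻¹)(ψ(s))`. -/
theorem hasDerivAt_adj_inv_apply {F : ℝ → G} {x : ℝ} (hF : ContMDiffAt 𝓘(ℝ, ℝ) 𝓘(ℝ, EG) ∞ F x)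
    {ψ : ℝ → EG} {ψ' : EG} (hψ : HasDerivAt ψ ψ' x) :
    HasDerivAt (fun s => adj EG (F s)⁻¹ (ψ s))
      (adj EG (F x)⁻¹ (ψ' - lieBr G (rightLogDeriv EG F x) (ψ x))) x := by
  -- Since `F(s)⁻¹ = F(x)⁻¹ c(s)` and `c(x) = 1`, only the derivative of `Ad` at the identity is
  -- needed.
  set c : ℝ → G := fun s => (F s * (F x)⁻¹)⁻¹ with hc
  have hF1 := contMDiffAt_mul_const hF (F x)⁻¹
  have hcs : ContMDiffAt 𝓘(ℝ, ℝ) 𝓘(ℝ, EG) ∞ c x := hF1.inv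
  have hc1 : c x = 1 := by simp [hc]
  have hcd : rightLogDeriv EG c x = -rightLogDeriv EG F x := by
    rw [hc, rightLogDeriv_inv hF1, rightLogDeriv_mul_const]
    simp [adj_one]
  have hv : HasDerivAt (fun s => oneChart EG G (c s)) (-rightLogDeriv EG F x) x := by
    have := hasDerivAt_rightLogDeriv hcs
    rw [hcd] at this
    simpa [hc1] using this
  have hA := ((contDiffAt_adj hcs).differentiableAt (by simp)).hasDerivAt
  have h1 := hA.clm_apply hψ
  have h2 := (hA.clm_apply (hasDerivAt_const x (ψ x))).unique (hasDerivAt_adj hcs hc1 hv (ψ x))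
  rw [map_zero, add_zero] at h2
  rw [h2, hc1, adj_one] at h1
  have h3 := (adj EG (F x)⁻¹).hasFDerivAt.comp_hasDerivAt x h1
  refine (h3.congr_deriv ?_).congr_of_eventuallyEq (.of_forall fun s => ?_)
  · congr 1
    rw [lieBr_neg_left]
    simp [sub_eq_add_neg, add_comm]
  · change _ = adj EG (F x)⁻¹ (adj EG (c s) (ψ s))
    rw [← adj_mul]
    simp [hc]

end AdjointDerivative

/-! ### Infinitesimal form of the crossed module axioms -/

section CrossedModuleCalculus

variable {EG : Type*} [NormedAddCommGroup EG] [NormedSpace ℝ EG]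
  {EH : Type*} [NormedAddCommGroup EH] [NormedSpace ℝ EH]
  {G : Type*} [TopologicalSpace G] [ChartedSpace EG G] [Group G]
  {H : Type*} [TopologicalSpace H] [ChartedSpace EH H] [Group H]
  (X : LieCrossedModule EG EH G H)

namespace LieCrossedModule

theorem contMDiff_m (a : G) : ContMDiff 𝓘(ℝ, EH) 𝓘(ℝ, EH) ∞ (X.m a).toMonoidHom :=
  X.smooth_m.comp (contMDiff_const.prodMk contMDiff_id)

/-- `ṁ(a)` as a continuous linear map. -/
noncomputable def mLin (a : G) : EH →L[ℝ] EH := dHom EH EH (X.m a).toMonoidHom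

/-- `ṫ` as a continuous linear map. -/
noncomputable def tLin : EH →L[ℝ] EG := dHom EH EG X.t

/-- By the Peiffer identity, `m(t(A))` is conjugation by `A`. -/
theorem mLin_t (A : H) (Y : EH) : X.mLin (X.t A) Y = adj EH A Y := by
  rw [mLin, adj]
  congr 2
  ext x
  simp [X.peiffer]

variable [LieGroup 𝓘(ℝ, EH) ∞ H]

theorem mDot_eq (a : G) (Y : EH) : X.mDot a Y = X.mLin a Y :=
  mfderiv_one_eq_dHom (X.contMDiff_m a) Y

theorem mLin_mul (a b : G) (Y : EH) : X.mLin (a * b) Y = X.mLin a (X.mLin b Y) := by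
  rw [mLin, mLin, mLin, ← dHom_comp (X.contMDiff_m b) (X.contMDiff_m a)]
  congr 2
  ext x
  simp

theorem contDiffAt_mLin [LieGroup 𝓘(ℝ, EG) ∞ G] {P : Type*} [NormedAddCommGroup P]
    [NormedSpace ℝ P] {u : P → G} {p : P} (hu : ContMDiffAt 𝓘(ℝ, P) 𝓘(ℝ, EG) ∞ u p) :
    ContDiffAt ℝ ∞ (fun p => X.mLin (u p)) p := by
  refine contDiffAt_dHom (Θ := fun p => (X.m (u p)).toMonoidHom) ?_
  have h1 : ContMDiffAt (𝓘(ℝ, P).prod 𝓘(ℝ, EH)) 𝓘(ℝ, EG) ∞ (fun q : P × H => u q.1) (p, 1) :=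
    ContMDiffAt.comp (f := Prod.fst) (p, (1 : H)) hu contMDiffAt_fst
  exact X.smooth_m.contMDiffAt.comp _ (h1.prodMk contMDiffAt_snd)

variable [LieGroup 𝓘(ℝ, EG) ∞ G]

theorem tDot_eq (Y : EH) : X.tDot Y = X.tLin Y := mfderiv_one_eq_dHom X.smooth_t Y

/-- Equivariance says that `t ∘ m(a)` is `t` followed by conjugation by `a`; take differentials at
`1`. -/
theorem tLin_mLin (a : G) (Y : EH) : X.tLin (X.mLin a Y) = adj EG a (X.tLin Y) := by
  rw [tLin, mLin, adj, ← dHom_comp (X.contMDiff_m a) X.smooth_t,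
    ← dHom_comp X.smooth_t (contMDiff_conj a)]
  congr 2
  ext x
  simp [X.equivariance]

end LieCrossedModule

end CrossedModuleCalculus

/-! ### Solutions on the plane satisfy the cocycle relations -/

section PlaneTransport

variable {EG : Type*} [NormedAddCommGroup EG] [NormedSpace ℝ EG]
  {EH : Type*} [NormedAddCommGroup EH] [NormedSpace ℝ EH]
  {G : Type*} [TopologicalSpace G] [ChartedSpace EG G] [Group G]
  {H : Type*} [TopologicalSpace H] [ChartedSpace EH H] [Group H]
  {X : LieCrossedModule EG EH G H}

variable (X) in
/-- The components of a connection doublet with zero fake curvature on the plane. -/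
structure PlaneDoublet where
  ax : ℝ × ℝ → EG
  ay : ℝ × ℝ → EG
  b : ℝ × ℝ → EH
  smooth_ax : ContDiff ℝ ∞ ax
  smooth_ay : ContDiff ℝ ∞ ay
  smooth_b : ContDiff ℝ ∞ b
  curvature : ∀ x y, deriv (fun s => ay (s, y)) x - deriv (fun s => ax (x, s)) y
    + lieBr G (ax (x, y)) (ay (x, y)) = X.tDot (b (x, y))

/-- Smooth solutions of the differential equations defining the cocycle of a doublet, where the
equation for `W` is integrated once. -/
structure PlaneTransport (D : PlaneDoublet X) where
  f : ℝ → ℝ → ℝ → G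
  g : ℝ → ℝ → ℝ → G
  W : ℝ → ℝ → ℝ → ℝ → H
  smooth_f : ContMDiff 𝓘(ℝ, ℝ × ℝ × ℝ) 𝓘(ℝ, EG) ∞ (fun p : ℝ × ℝ × ℝ => f p.1 p.2.1 p.2.2)
  smooth_g : ContMDiff 𝓘(ℝ, ℝ × ℝ × ℝ) 𝓘(ℝ, EG) ∞ (fun p : ℝ × ℝ × ℝ => g p.1 p.2.1 p.2.2)
  smooth_W : ContMDiff 𝓘(ℝ, ℝ × ℝ × ℝ × ℝ) 𝓘(ℝ, EH) ∞
    (fun p : ℝ × ℝ × ℝ × ℝ => W p.1 p.2.1 p.2.2.1 p.2.2.2)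
  f_eq : ∀ x₀ y x, rightLogDeriv EG (fun s => f s x₀ y) x = -D.ax (x, y)
  f_init : ∀ x₀ y, f x₀ x₀ y = 1
  g_eq : ∀ x y₀ y, rightLogDeriv EG (fun s => g x s y₀) y = -D.ay (x, y)
  g_init : ∀ x y₀, g x y₀ y₀ = 1
  W_eq : ∀ x x₀ y y₀, rightLogDeriv EH (fun r => W x x₀ r y₀) y =
    -∫ ξ in x₀..x, X.mLin ((g x₀ y y₀)⁻¹ * (f ξ x₀ y)⁻¹) (D.b (ξ, y))
  W_init : ∀ x x₀ y₀, W x x₀ y₀ y₀ = 1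

namespace PlaneTransport

variable {D : PlaneDoublet X} (T : PlaneTransport D)

section Slices

variable {P : Type*} [NormedAddCommGroup P] [NormedSpace ℝ P]

theorem contMDiff_f {k₁ k₂ k₃ : P → ℝ} (h₁ : ContDiff ℝ ∞ k₁) (h₂ : ContDiff ℝ ∞ k₂)
    (h₃ : ContDiff ℝ ∞ k₃) :
    ContMDiff 𝓘(ℝ, P) 𝓘(ℝ, EG) ∞ (fun p => T.f (k₁ p) (k₂ p) (k₃ p)) :=
  T.smooth_f.comp (h₁.prodMk (h₂.prodMk h₃)).contMDiff

theorem contMDiff_g {k₁ k₂ k₃ : P → ℝ} (h₁ : ContDiff ℝ ∞ k₁) (h₂ : ContDiff ℝ ∞ k₂)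
    (h₃ : ContDiff ℝ ∞ k₃) :
    ContMDiff 𝓘(ℝ, P) 𝓘(ℝ, EG) ∞ (fun p => T.g (k₁ p) (k₂ p) (k₃ p)) :=
  T.smooth_g.comp (h₁.prodMk (h₂.prodMk h₃)).contMDiff

theorem contMDiff_W {k₁ k₂ k₃ k₄ : P → ℝ} (h₁ : ContDiff ℝ ∞ k₁) (h₂ : ContDiff ℝ ∞ k₂)
    (h₃ : ContDiff ℝ ∞ k₃) (h₄ : ContDiff ℝ ∞ k₄) :
    ContMDiff 𝓘(ℝ, P) 𝓘(ℝ, EH) ∞ (fun p => T.W (k₁ p) (k₂ p) (k₃ p) (k₄ p)) :=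
  T.smooth_W.comp (h₁.prodMk (h₂.prodMk (h₃.prodMk h₄))).contMDiff

end Slices

/-- As functions of the leftmost argument both sides solve the same equation, and they agree at
`x'`. The other relations follow the same pattern. -/
theorem f_mul [LieGroup 𝓘(ℝ, EG) ∞ G] (x'' x' x y : ℝ) :
    T.f x'' x y = T.f x'' x' y * T.f x' x y := by
  have h := eq_of_rightLogDeriv_eq (EG := EG) (u := fun s => T.f s x y)
    (v := fun s => T.f s x' y * T.f x' x y) (x := x')
    (T.contMDiff_f contDiff_id contDiff_const contDiff_const)
    ((T.contMDiff_f contDiff_id contDiff_const contDiff_const).mul contMDiff_const)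
    (fun s => by rw [rightLogDeriv_mul_const, T.f_eq, T.f_eq]) (by simp [T.f_init])
  exact congrFun h x''

theorem g_mul [LieGroup 𝓘(ℝ, EG) ∞ G] (x y'' y' y : ℝ) :
    T.g x y'' y = T.g x y'' y' * T.g x y' y := by
  have h := eq_of_rightLogDeriv_eq (EG := EG) (u := fun s => T.g x s y)
    (v := fun s => T.g x s y' * T.g x y' y) (x := y')
    (T.contMDiff_g contDiff_const contDiff_id contDiff_const)
    ((T.contMDiff_g contDiff_const contDiff_id contDiff_const).mul contMDiff_const)
    (fun s => by rw [rightLogDeriv_mul_const, T.g_eq, T.g_eq]) (by simp [T.g_init])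
  exact congrFun h y''

theorem W_init_x [LieGroup 𝓘(ℝ, EH) ∞ H] (x₀ y y₀ : ℝ) : T.W x₀ x₀ y y₀ = 1 := by
  have h := eq_of_rightLogDeriv_eq (EG := EH) (u := fun s => T.W x₀ x₀ s y₀)
    (v := fun _ => 1) (x := y₀)
    (T.contMDiff_W contDiff_const contDiff_const contDiff_id contDiff_const) contMDiff_const
    (fun s => by rw [T.W_eq, rightLogDeriv_const]; simp) (T.W_init _ _ _)
  exact congrFun h y

variable [LieGroup 𝓘(ℝ, EG) ∞ G] [LieGroup 𝓘(ℝ, EH) ∞ H]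

theorem contDiff_integrand {P : Type*} [NormedAddCommGroup P] [NormedSpace ℝ P]
    {u : P → G} (hu : ContMDiff 𝓘(ℝ, P) 𝓘(ℝ, EG) ∞ u) {k : P → ℝ × ℝ} (hk : ContDiff ℝ ∞ k) :
    ContDiff ℝ ∞ (fun p => X.mLin (u p) (D.b (k p))) :=
  contDiff_iff_contDiffAt.2 fun _ =>
    (X.contDiffAt_mLin hu.contMDiffAt).clm_apply (D.smooth_b.comp hk).contDiffAt

theorem continuous_integrand (a : G) (x₀ y : ℝ) :
    Continuous fun ξ => X.mLin (a * (T.f ξ x₀ y)⁻¹) (D.b (ξ, y)) :=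
  (contDiff_integrand (contMDiff_const.mul
    (T.contMDiff_f contDiff_id contDiff_const contDiff_const).inv)
    (contDiff_id.prodMk contDiff_const)).continuous

variable [CompleteSpace EH]

theorem hasDerivAt_W (x₀ y₀ x y : ℝ) :
    HasDerivAt (fun s => rightLogDeriv EH (fun r => T.W s x₀ r y₀) y)
      (-(X.mLin ((T.g x₀ y y₀)⁻¹ * (T.f x x₀ y)⁻¹) (D.b (x, y)))) x := by
  simp_rw [T.W_eq]
  exact ((T.continuous_integrand _ x₀ y).integral_hasStrictDerivAt x₀ x).hasDerivAt.neg

/-- Both sides are compared as functions of `y''`. The automorphism `m(g(x;y',y)⁻¹)` enters the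
integrand through its differential, where `g_mul` merges the two factors `g`; no curvature condition
is needed. -/
theorem W_vertical (x' x y'' y' y : ℝ) :
    T.W x' x y'' y = X.m (T.g x y' y)⁻¹ (T.W x' x y'' y') * T.W x' x y' y := by
  have hW : ContMDiff 𝓘(ℝ, ℝ) 𝓘(ℝ, EH) ∞ (fun s => T.W x' x s y') :=
    T.contMDiff_W contDiff_const contDiff_const contDiff_id contDiff_const
  have h := eq_of_rightLogDeriv_eq (EG := EH) (u := fun s => T.W x' x s y)
    (v := fun s => (X.m (T.g x y' y)⁻¹).toMonoidHom (T.W x' x s y') * T.W x' x y' y) (x := y')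
    (T.contMDiff_W contDiff_const contDiff_const contDiff_id contDiff_const)
    (((X.contMDiff_m _).comp hW).mul contMDiff_const)
    (fun s => by
      rw [rightLogDeriv_mul_const, rightLogDeriv_hom (X.contMDiff_m _) hW.contMDiffAt, T.W_eq,
        T.W_eq, map_neg, neg_inj]
      change _ = X.mLin (T.g x y' y)⁻¹ _
      rw [← ContinuousLinearMap.intervalIntegral_comp_comm _
        ((T.continuous_integrand _ x s).intervalIntegrable _ _)]
      simp_rw [← X.mLin_mul, T.g_mul x s y' y, mul_inv_rev, mul_assoc]) (by simp [T.W_init])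
  exact congrFun h y''

/-- As functions of `y'`, both sides have the same logarithmic derivative. With `φ = ∂_y f f⁻¹`,
that of the right-hand side is `Ad(g⁻¹)(a_y(x) - Ad(f⁻¹)(φ + a_y)(x'))`. By Maurer–Cartan, `∂ₓ φ =
-∂_y aₓ - [aₓ, φ]`, so the `x`-derivative of `Ad(f⁻¹)(φ + a_y)` is `Ad(f⁻¹)` of `∂ₓ a_y - ∂_y aₓ +
[aₓ, a_y] = ṫ(b)`. Integrating from `x` to `x'` gives the image under `ṫ` of the equation for `W`.
-/
theorem target_matching [CompleteSpace EG] (x' x y' y : ℝ) :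
    X.t (T.W x' x y' y) = (T.g x y' y)⁻¹ * (T.f x' x y')⁻¹ * T.g x' y' y * T.f x' x y := by
  set φ : ℝ × ℝ → EG := fun q => rightLogDeriv EG (fun r => T.f q.1 x r) q.2 with hφ
  have hfs : ContMDiff 𝓘(ℝ, ℝ × ℝ) 𝓘(ℝ, EG) ∞ (fun q : ℝ × ℝ => T.f q.1 x q.2) :=
    T.contMDiff_f contDiff_fst contDiff_const contDiff_snd
  have hφs : ContDiff ℝ ∞ φ := contDiff_rightLogDeriv hfs
  have hfx : ∀ s, ContMDiff 𝓘(ℝ, ℝ) 𝓘(ℝ, EG) ∞ (fun r => T.f r x s) := fun s =>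
    T.contMDiff_f contDiff_id contDiff_const contDiff_const
  have hfy : ∀ s, ContMDiff 𝓘(ℝ, ℝ) 𝓘(ℝ, EG) ∞ (fun r => T.f s x r) := fun s =>
    T.contMDiff_f contDiff_const contDiff_const contDiff_id
  have hgy : ∀ s, ContMDiff 𝓘(ℝ, ℝ) 𝓘(ℝ, EG) ∞ (fun r => T.g s r y) := fun s =>
    T.contMDiff_g contDiff_const contDiff_id contDiff_const
  have hWy : ∀ s, ContMDiff 𝓘(ℝ, ℝ) 𝓘(ℝ, EH) ∞ (fun r => T.W s x r y) := fun s =>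
    T.contMDiff_W contDiff_const contDiff_const contDiff_id contDiff_const
  -- the logarithmic derivative of the right-hand side
  have hK : ∀ ξ r, rightLogDeriv EG
      (fun r => (T.g x r y)⁻¹ * (T.f ξ x r)⁻¹ * T.g ξ r y * T.f ξ x y) r =
      adj EG (T.g x r y)⁻¹ (D.ay (x, r) - adj EG (T.f ξ x r)⁻¹ (φ (ξ, r) + D.ay (ξ, r))) := by
    intro ξ r
    have h1 := (hgy x).inv.contMDiffAt (x := r)
    have h2 := (hfy ξ).inv.contMDiffAt (x := r)
    have h3 := (hgy ξ).contMDiffAt (x := r)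
    have h12 : ContMDiffAt 𝓘(ℝ, ℝ) 𝓘(ℝ, EG) ∞ (fun r => (T.g x r y)⁻¹ * (T.f ξ x r)⁻¹) r :=
      h1.mul h2
    rw [rightLogDeriv_mul_const, rightLogDeriv_mul h12 h3, rightLogDeriv_mul h1 h2,
      rightLogDeriv_inv (hgy x).contMDiffAt, rightLogDeriv_inv (hfy ξ).contMDiffAt, T.g_eq, T.g_eq,
      adj_mul]
    simp only [map_neg, map_sub, map_add, hφ]
    abel
  have hderiv : ∀ ξ r, HasDerivAt
      (fun s => adj EG (T.f s x r)⁻¹ (φ (s, r) + D.ay (s, r)))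
      (adj EG (T.f ξ x r)⁻¹ (X.tLin (D.b (ξ, r)))) ξ := by
    intro ξ r
    have d1 : HasDerivAt (fun s => φ (s, r)) (deriv (fun s => φ (s, r)) ξ) ξ :=
      ((hφs.comp (contDiff_id.prodMk contDiff_const)).differentiable (by simp) ξ).hasDerivAt
    have d2 : HasDerivAt (fun s => D.ay (s, r)) (deriv (fun s => D.ay (s, r)) ξ) ξ :=
      ((D.smooth_ay.comp (contDiff_id.prodMk contDiff_const)).differentiable
        (by simp) ξ).hasDerivAt
    have d3 : HasDerivAt (fun s => D.ax (ξ, s)) (deriv (fun s => D.ax (ξ, s)) r) r :=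
      ((D.smooth_ax.comp (contDiff_const.prodMk contDiff_id)).differentiable
        (by simp) r).hasDerivAt
    have hmc := maurer_cartan hfs (α := fun q => -D.ax q) (φ := φ) (x := ξ) (y := r)
      (fun a b => T.f_eq x b a) (fun a b => rfl) d3.neg d1
    have h := hasDerivAt_adj_inv_apply (hfx r).contMDiffAt (d1.add d2)
    refine h.congr_deriv ?_
    congr 1
    rw [T.f_eq, ← X.tDot_eq, ← D.curvature]
    simp only [Pi.add_apply]
    rw [lieBr_add_right, ← hmc, lieBr_neg_left]
    abel
  have hW : ∀ r, rightLogDeriv EG (fun r => X.t (T.W x' x r y)) r =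
      adj EG (T.g x r y)⁻¹ (D.ay (x, r) - adj EG (T.f x' x r)⁻¹ (φ (x', r) + D.ay (x', r))) := by
    intro r
    have hcont : Continuous fun ξ => adj EG (T.f ξ x r)⁻¹ (X.tLin (D.b (ξ, r))) :=
      ContDiff.continuous (𝕜 := ℝ) (n := ∞) <| contDiff_iff_contDiffAt.2 fun ξ =>
        (contDiffAt_adj (hfx r).inv.contMDiffAt).clm_apply
          (X.tLin.contDiff.comp (D.smooth_b.comp
            (contDiff_id.prodMk contDiff_const))).contDiffAt
    have hint := intervalIntegral.integral_eq_sub_of_hasDerivAt (a := x) (b := x')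
      (fun ξ _ => hderiv ξ r) (hcont.intervalIntegrable _ _)
    -- At the lower limit `f(x, x; r) = 1` for all `r`, so only `a_y(x, r)` survives there.
    have hφ0 : φ (x, r) = 0 := by
      simp only [hφ, T.f_init, rightLogDeriv_const]
    rw [hφ0, T.f_init, inv_one, adj_one, zero_add, ContinuousLinearMap.id_apply] at hint
    rw [rightLogDeriv_hom X.smooth_t (hWy x').contMDiffAt, T.W_eq, map_neg]
    change -X.tLin _ = _
    rw [← ContinuousLinearMap.intervalIntegral_comp_comm _
        ((T.continuous_integrand _ x r).intervalIntegrable _ _)]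
    simp_rw [X.tLin_mLin, adj_mul]
    rw [ContinuousLinearMap.intervalIntegral_comp_comm (adj EG (T.g x r y)⁻¹)
      (hcont.intervalIntegrable _ _), hint,
      ← map_neg, neg_sub]
  have h := eq_of_rightLogDeriv_eq (EG := EG) (u := fun r => X.t (T.W x' x r y))
    (v := fun r => (T.g x r y)⁻¹ * (T.f x' x r)⁻¹ * T.g x' r y * T.f x' x y) (x := y)
    (X.smooth_t.comp (hWy x'))
    ((((hgy x).inv.mul (hfy x').inv).mul (hgy x')).mul contMDiff_const)
    (fun r => by rw [hW, hK]) (by simp [T.W_init, T.g_init])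
  exact congrFun h y'

/-- The logarithmic derivative of the product twists the second term by `Ad(W(x',x))`, which is
`ṁ(t(W(x',x)))` by Peiffer. Target matching and `f_mul` collapse the accumulated group element to
`g(x)⁻¹ f(ξ,x)⁻¹`, so the two terms are integrals of one integrand over adjacent intervals. -/
theorem W_horizontal [CompleteSpace EG] (x'' x' x y' y : ℝ) :
    T.W x'' x y' y = T.W x' x y' y * X.m (T.f x' x y)⁻¹ (T.W x'' x' y' y) := by
  have hW : ∀ s s₀, ContMDiff 𝓘(ℝ, ℝ) 𝓘(ℝ, EH) ∞ (fun r => T.W s s₀ r y) := fun s s₀ =>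
    T.contMDiff_W contDiff_const contDiff_const contDiff_id contDiff_const
  have hm : ContMDiff 𝓘(ℝ, ℝ) 𝓘(ℝ, EH) ∞
      (fun r => (X.m (T.f x' x y)⁻¹).toMonoidHom (T.W x'' x' r y)) :=
    (X.contMDiff_m (T.f x' x y)⁻¹).comp (hW x'' x')
  have h := eq_of_rightLogDeriv_eq (EG := EH) (u := fun r => T.W x'' x r y)
    (v := fun r => T.W x' x r y * (X.m (T.f x' x y)⁻¹).toMonoidHom (T.W x'' x' r y)) (x := y)
    (hW x'' x) ((hW x' x).mul hm)
    (fun r => by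
      rw [rightLogDeriv_mul (hW x' x).contMDiffAt hm.contMDiffAt,
        rightLogDeriv_hom (X.contMDiff_m _) (hW x'' x').contMDiffAt, T.W_eq, T.W_eq, T.W_eq,
        ← X.mLin_t]
      change _ = _ + X.mLin _ (X.mLin _ _)
      rw [← X.mLin_mul, map_neg, ← ContinuousLinearMap.intervalIntegral_comp_comm _
        ((T.continuous_integrand _ x' r).intervalIntegrable _ _), ← neg_add, neg_inj,
        ← intervalIntegral.integral_add_adjacent_intervals
        ((T.continuous_integrand _ x r).intervalIntegrable x x')
        ((T.continuous_integrand _ x r).intervalIntegrable x' x'')]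
      congr 1
      refine intervalIntegral.integral_congr fun ξ _ => ?_
      rw [← X.mLin_mul, T.target_matching, T.f_mul ξ x' x]
      congr 2
      group) (by simp [T.W_init])
  exact congrFun h y'

/-- The cocycle defined by the solutions of the differential equations. -/
def toCocycle [CompleteSpace EG] : Cocycle X where
  f := T.f
  g := T.g
  W := T.W
  smooth_f := T.smooth_f
  smooth_g := T.smooth_g
  smooth_W := T.smooth_W
  target_matching := T.target_matching
  f_mul := T.f_mul
  g_mul := T.g_mul
  W_horizontal := T.W_horizontal
  W_vertical := T.W_vertical

end PlaneTransport

end PlaneTransport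

/-! ### Existence and uniqueness of the associated cocycle -/

section PlaneCocycles

variable {EG : Type*} [NormedAddCommGroup EG] [NormedSpace ℝ EG]
  {EH : Type*} [NormedAddCommGroup EH] [NormedSpace ℝ EH]
  {G : Type*} [TopologicalSpace G] [ChartedSpace EG G] [Group G] [LieGroup 𝓘(ℝ, EG) ∞ G]
  {H : Type*} [TopologicalSpace H] [ChartedSpace EH H] [Group H] [LieGroup 𝓘(ℝ, EH) ∞ H]
  {X : LieCrossedModule EG EH G H} {D : PlaneDoublet X}
  {a : ℝ × ℝ → (ℝ × ℝ) [⋀^Fin 1]→L[ℝ] EG} {B : ℝ × ℝ → (ℝ × ℝ) [⋀^Fin 2]→L[ℝ] EH}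

namespace PlaneTransport

theorem isAssociated_toCocycle [CompleteSpace EG] [CompleteSpace EH] (T : PlaneTransport D)
    (hx : ∀ q, a q ![(1, 0)] = D.ax q) (hy : ∀ q, a q ![(0, 1)] = D.ay q)
    (hB : ∀ q, B q ![(1, 0), (0, 1)] = D.b q) : T.toCocycle.IsAssociated a B where
  f_eq x₀ y x := by rw [hx]; exact T.f_eq x₀ y x
  f_init := T.f_init
  g_eq x y₀ y := by rw [hy]; exact T.g_eq x y₀ y
  g_init := T.g_init
  W_eq x₀ y₀ x y := by rw [hB, X.mDot_eq]; exact T.hasDerivAt_W x₀ y₀ x y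
  W_init_x := T.W_init_x
  W_init_y := T.W_init

/-- The maps `f` and `g` are settled first, since they enter the equation for `W`. That equation
then fixes the `x`-derivative of `∂_y W W⁻¹`, which vanishes at `x = x₀` because `W` is `1` there.
So `∂_y W W⁻¹` is determined, and then `W` by its value at `y = y₀`. -/
theorem eq_toCocycle [CompleteSpace EG] [CompleteSpace EH] (T : PlaneTransport D)
    (hx : ∀ q, a q ![(1, 0)] = D.ax q) (hy : ∀ q, a q ![(0, 1)] = D.ay q)
    (hB : ∀ q, B q ![(1, 0), (0, 1)] = D.b q) {c : Cocycle X} (h : c.IsAssociated a B) :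
    c = T.toCocycle := by
  have hf : ∀ x x₀ y, c.f x x₀ y = T.f x x₀ y := fun x x₀ y =>
    congrFun (eq_of_rightLogDeriv_eq (EG := EG) (u := fun s => c.f s x₀ y)
      (v := fun s => T.f s x₀ y) (x := x₀)
      (c.smooth_f.comp (contDiff_id.prodMk (contDiff_const (c := (x₀, y)))).contMDiff)
      (T.contMDiff_f contDiff_id contDiff_const contDiff_const)
      (fun s => by rw [h.f_eq, T.f_eq, hx]) (by rw [h.f_init, T.f_init])) x
  have hg : ∀ x y y₀, c.g x y y₀ = T.g x y y₀ := fun x y y₀ =>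
    congrFun (eq_of_rightLogDeriv_eq (EG := EG) (u := fun s => c.g x s y₀)
      (v := fun s => T.g x s y₀) (x := y₀)
      (c.smooth_g.comp ((contDiff_const (c := x)).prodMk
        (contDiff_id.prodMk (contDiff_const (c := y₀)))).contMDiff)
      (T.contMDiff_g contDiff_const contDiff_id contDiff_const)
      (fun s => by rw [h.g_eq, T.g_eq, hy]) (by rw [h.g_init, T.g_init])) y
  have hR : ∀ x x₀ y y₀, rightLogDeriv EH (fun r => c.W x x₀ r y₀) y =
      rightLogDeriv EH (fun r => T.W x x₀ r y₀) y := fun x x₀ y y₀ => by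
    have h1 := fun s => h.W_eq x₀ y₀ s y
    have h2 := fun s => T.hasDerivAt_W x₀ y₀ s y
    refine congrFun (eq_of_fderiv_eq (𝕜 := ℝ)
      (f := fun s => rightLogDeriv EH (fun r => c.W s x₀ r y₀) y)
      (g := fun s => rightLogDeriv EH (fun r => T.W s x₀ r y₀) y)
      (fun s => (h1 s).differentiableAt) (fun s => (h2 s).differentiableAt) (fun s => ?_) x₀ ?_) x
    · rw [(h1 s).hasFDerivAt.fderiv, (h2 s).hasFDerivAt.fderiv, hf, hg, hB, X.mDot_eq]
    · simp only [h.W_init_x, T.W_init_x]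
  have hW : ∀ x x₀ y y₀, c.W x x₀ y y₀ = T.W x x₀ y y₀ := fun x x₀ y y₀ =>
    congrFun (eq_of_rightLogDeriv_eq (EG := EH) (u := fun s => c.W x x₀ s y₀)
      (v := fun s => T.W x x₀ s y₀) (x := y₀)
      (c.smooth_W.comp ((contDiff_const (c := x)).prodMk ((contDiff_const (c := x₀)).prodMk
        (contDiff_id.prodMk (contDiff_const (c := y₀))))).contMDiff)
      (T.contMDiff_W contDiff_const contDiff_const contDiff_id contDiff_const)
      (fun s => hR x x₀ s y₀) (by rw [h.W_init_y, T.W_init])) y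
  exact Cocycle.ext (by funext x x₀ y; exact hf x x₀ y) (by funext x y y₀; exact hg x y y₀)
    (by funext x x₀ y y₀; exact hW x x₀ y y₀)

end PlaneTransport

/-- The equations of parallel transport on the plane have solutions. -/
theorem PlaneDoublet.exists_planeTransport [FiniteDimensional ℝ EG] [FiniteDimensional ℝ EH]
    (D : PlaneDoublet X) : Nonempty (PlaneTransport D) := by
  obtain ⟨u, hu, hu0, hu'⟩ := exists_solution (G := G) (A := fun q : ℝ × ℝ => -D.ax (q.2, q.1))
    (D.smooth_ax.comp (contDiff_snd.prodMk contDiff_fst)).neg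
  obtain ⟨v, hv, hv0, hv'⟩ := exists_solution (G := G) (A := fun q : ℝ × ℝ => -D.ay q)
    D.smooth_ay.neg
  -- The solution `u` starts at time `0`; the right factor moves the starting point to `x₀` without
  -- affecting the equation. The same device serves `g` and `W`.
  let f : ℝ → ℝ → ℝ → G := fun x x₀ y => u (y, x) * (u (y, x₀))⁻¹
  let g : ℝ → ℝ → ℝ → G := fun x y y₀ => v (x, y) * (v (x, y₀))⁻¹
  have hf : ContMDiff 𝓘(ℝ, ℝ × ℝ × ℝ) 𝓘(ℝ, EG) ∞ (fun p : ℝ × ℝ × ℝ => f p.1 p.2.1 p.2.2) := by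
    have h1 : ContMDiff 𝓘(ℝ, ℝ × ℝ × ℝ) 𝓘(ℝ, EG) ∞ (fun p : ℝ × ℝ × ℝ => u (p.2.2, p.1)) :=
      hu.comp (ContDiff.contMDiff (by fun_prop))
    have h2 : ContMDiff 𝓘(ℝ, ℝ × ℝ × ℝ) 𝓘(ℝ, EG) ∞ (fun p : ℝ × ℝ × ℝ => u (p.2.2, p.2.1)) :=
      hu.comp (ContDiff.contMDiff (by fun_prop))
    exact h1.mul h2.inv
  have hg : ContMDiff 𝓘(ℝ, ℝ × ℝ × ℝ) 𝓘(ℝ, EG) ∞ (fun p : ℝ × ℝ × ℝ => g p.1 p.2.1 p.2.2) := by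
    have h1 : ContMDiff 𝓘(ℝ, ℝ × ℝ × ℝ) 𝓘(ℝ, EG) ∞ (fun p : ℝ × ℝ × ℝ => v (p.1, p.2.1)) :=
      hv.comp (ContDiff.contMDiff (by fun_prop))
    have h2 : ContMDiff 𝓘(ℝ, ℝ × ℝ × ℝ) 𝓘(ℝ, EG) ∞ (fun p : ℝ × ℝ × ℝ => v (p.1, p.2.2)) :=
      hv.comp (ContDiff.contMDiff (by fun_prop))
    exact h1.mul h2.inv
  -- the integrand, as a function of `((x₀, y, y₀), ξ)`
  let b : (ℝ × ℝ × ℝ) × ℝ → EH := fun q =>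
    X.mLin ((g q.1.1 q.1.2.1 q.1.2.2)⁻¹ * (f q.2 q.1.1 q.1.2.1)⁻¹) (D.b (q.2, q.1.2.1))
  have hb : ContDiff ℝ ∞ b := by
    have h1 : ContMDiff 𝓘(ℝ, (ℝ × ℝ × ℝ) × ℝ) 𝓘(ℝ, EG) ∞
        (fun q : (ℝ × ℝ × ℝ) × ℝ => f q.2 q.1.1 q.1.2.1) :=
      ContMDiff.comp (g := fun p : ℝ × ℝ × ℝ => f p.1 p.2.1 p.2.2)
        (f := fun q : (ℝ × ℝ × ℝ) × ℝ => (q.2, q.1.1, q.1.2.1)) hf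
        (ContDiff.contMDiff (by fun_prop))
    have h2 : ContMDiff 𝓘(ℝ, (ℝ × ℝ × ℝ) × ℝ) 𝓘(ℝ, EG) ∞
        (fun q : (ℝ × ℝ × ℝ) × ℝ => g q.1.1 q.1.2.1 q.1.2.2) :=
      ContMDiff.comp (g := fun p : ℝ × ℝ × ℝ => g p.1 p.2.1 p.2.2)
        (f := fun q : (ℝ × ℝ × ℝ) × ℝ => (q.1.1, q.1.2.1, q.1.2.2)) hg
        (ContDiff.contMDiff (by fun_prop))
    exact PlaneTransport.contDiff_integrand (h2.inv.mul h1.inv) (k := fun q => (q.2, q.1.2.1))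
      (by fun_prop)
  have hI := contDiff_parametric_intervalIntegral hb
  -- The parameters are `(x, x₀, y₀)` and the time is `y`, which also enters the integrand.
  obtain ⟨w, hw, hw0, hw'⟩ := exists_solution (G := H)
    (A := fun q : (ℝ × ℝ × ℝ) × ℝ => -∫ ξ in q.1.2.1..q.1.1, b ((q.1.2.1, q.2, q.1.2.2), ξ))
    (ContDiff.neg (hI.comp (g := fun q : (ℝ × ℝ × ℝ) × ℝ × ℝ => ∫ ξ in q.2.1..q.2.2, b (q.1, ξ))
      (f := fun q : (ℝ × ℝ × ℝ) × ℝ => ((q.1.2.1, q.2, q.1.2.2), (q.1.2.1, q.1.1)))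
      (by fun_prop)))
  refine ⟨{
    f := f
    g := g
    W := fun x x₀ y y₀ => w ((x, x₀, y₀), y) * (w ((x, x₀, y₀), y₀))⁻¹
    smooth_f := hf
    smooth_g := hg
    smooth_W := ?_
    f_eq := fun x₀ y x => ?_
    f_init := fun x₀ y => mul_inv_cancel _
    g_eq := fun x y₀ y => ?_
    g_init := fun x y₀ => mul_inv_cancel _
    W_eq := fun x x₀ y y₀ => ?_
    W_init := fun x x₀ y₀ => mul_inv_cancel _ }⟩
  · have h1 : ContMDiff 𝓘(ℝ, ℝ × ℝ × ℝ × ℝ) 𝓘(ℝ, EH) ∞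
        (fun p : ℝ × ℝ × ℝ × ℝ => w ((p.1, p.2.1, p.2.2.2), p.2.2.1)) :=
      hw.comp (ContDiff.contMDiff (by fun_prop))
    have h2 : ContMDiff 𝓘(ℝ, ℝ × ℝ × ℝ × ℝ) 𝓘(ℝ, EH) ∞
        (fun p : ℝ × ℝ × ℝ × ℝ => w ((p.1, p.2.1, p.2.2.2), p.2.2.2)) :=
      hw.comp (ContDiff.contMDiff (by fun_prop))
    exact h1.mul h2.inv
  · exact (rightLogDeriv_mul_const (fun s => u (y, s)) _ x).trans (hu' y x)
  · exact (rightLogDeriv_mul_const (fun s => v (x, s)) _ y).trans (hv' x y)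
  · exact (rightLogDeriv_mul_const (fun s => w ((x, x₀, y₀), s)) _ y).trans (hw' (x, x₀, y₀) y)

end PlaneCocycles

/-! ### Comparison with the Schreiber–Waldorf transports -/

section Comparison

variable {EG : Type*} [NormedAddCommGroup EG] [NormedSpace ℝ EG]
  {EH : Type*} [NormedAddCommGroup EH] [NormedSpace ℝ EH]
  {G : Type*} [TopologicalSpace G] [ChartedSpace EG G] [Group G]
  {H : Type*} [TopologicalSpace H] [ChartedSpace EH H] [Group H]
  {X : LieCrossedModule EG EH G H}
  {E : Type*} [NormedAddCommGroup E] [NormedSpace ℝ E]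
  {M : Type*} [TopologicalSpace M] [ChartedSpace E M]
  {p₀ p₁ : M} {γ₀ γ₁ : Curve E p₀ p₁}

namespace ConnectionDoublet

theorem IsSWSolution₂.unique [LieGroup 𝓘(ℝ, EH) ∞ H]
    {D : ConnectionDoublet X E M} {φ : Cutoff} {S : Surface γ₀ γ₁}
    {u v : ℝ → H} (hu : D.IsSWSolution₂ φ S u) (hv : D.IsSWSolution₂ φ S v) : u = v :=
  eq_of_rightLogDeriv_eq hu.smooth hv.smooth (fun s => by rw [hu.eq, hv.eq])
    (hu.init.trans hv.init.symm)

/-- The components of the pull-back of a connection doublet to the plane. -/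
noncomputable def planeDoublet [IsManifold 𝓘(ℝ, E) ∞ M]
    (D : ConnectionDoublet X E M) (S : Surface γ₀ γ₁) :
    PlaneDoublet X where
  ax q := D.θ.pullback S.toFun q ![(1, 0)]
  ay q := D.θ.pullback S.toFun q ![(0, 1)]
  b q := D.Υ.pullback S.toFun q ![(1, 0), (0, 1)]
  smooth_ax := D.θ.contDiff_pullback_apply S.smooth _
  smooth_ay := D.θ.contDiff_pullback_apply S.smooth _
  smooth_b := D.Υ.contDiff_pullback_apply S.smooth _
  curvature := D.pullback_fake_curvature S.smooth

/-- The edge `x = 1` lies in the region where the surface is constantly `p₁`, so `y ↦ Σ(1, y)` has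
zero velocity. -/
theorem planeDoublet_ay_one [IsManifold 𝓘(ℝ, E) ∞ M] (D : ConnectionDoublet X E M)
    (S : Surface γ₀ γ₁) (y : ℝ) :
    (D.planeDoublet S).ay (1, y) = 0 := by
  obtain ⟨ε, h0, -, -, h1, -⟩ := S.sitting
  have hS : (fun s : ℝ => S.toFun (1, s)) = fun _ => p₁ := by
    funext s
    exact h1 1 s (by linarith)
  have h := D.θ.pullback_comp_apply S.smooth
    (((hasDerivAt_const y (1 : ℝ)).prodMk (hasDerivAt_id y)).hasFDerivAt) ![1]
  have hv : (fun i => ContinuousLinearMap.toSpanSingleton ℝ ((0 : ℝ), (1 : ℝ)) (![(1 : ℝ)] i)) =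
      ![((0 : ℝ), (1 : ℝ))] := by
    funext i
    fin_cases i
    simp
  rw [hv] at h
  refine h.symm.trans ?_
  simp only [id]
  rw [hS]
  simp only [DiffForm.pullback, mfderiv_const]
  exact ContinuousAlternatingMap.map_coord_zero (D.θ.toFun p₁) 0 rfl

variable [LieGroup 𝓘(ℝ, EG) ∞ G]

theorem IsSWSolution₁.unique {D : ConnectionDoublet X E M} {γ : Curve E p₀ p₁} {u v : ℝ → G}
    (hu : D.IsSWSolution₁ γ u) (hv : D.IsSWSolution₁ γ v) : u = v :=
  eq_of_rightLogDeriv_eq hu.smooth hv.smooth (fun s => by rw [hu.eq, hv.eq])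
    (hu.init.trans hv.init.symm)

/-- Uniqueness makes the choice in the definition of the transport immaterial, so any solution
computes it. -/
theorem IsSWSolution₁.swTransport₁_eq {D : ConnectionDoublet X E M} {γ : Curve E p₀ p₁}
    {u : ℝ → G} (hu : D.IsSWSolution₁ γ u) : D.swTransport₁ γ = u 1 :=
  congrFun ((Classical.epsilon_spec (p := fun u : ℝ → G => D.IsSWSolution₁ γ u) ⟨u, hu⟩).unique hu)
    1

variable [IsManifold 𝓘(ℝ, E) ∞ M]

theorem exists_isSWSolution₁ [FiniteDimensional ℝ EG]
    (D : ConnectionDoublet X E M) (γ : Curve E p₀ p₁) :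
    ∃ u : ℝ → G, D.IsSWSolution₁ γ u := by
  obtain ⟨u, hu, hu0, hu'⟩ := exists_solution (G := G)
    (A := fun q : ℝ × ℝ => -D.θ.pullback γ.toFun q.2 ![1])
    ((D.θ.contDiff_pullback_apply γ.smooth ![1]).comp contDiff_snd).neg
  exact ⟨fun s => u (0, s), hu.comp (contDiff_const.prodMk contDiff_id).contMDiff, hu' 0, hu0 0⟩

/-- The transport along a reparametrised horizontal line of a surface. -/
theorem swTransport₁_eq_f {D : ConnectionDoublet X E M} {S : Surface γ₀ γ₁}
    (T : PlaneTransport (D.planeDoublet S)) {q₀ q₁ : M} (γ : Curve E q₀ q₁) {k : ℝ → ℝ}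
    (hk : ContDiff ℝ ∞ k) (y : ℝ) (hγ : γ.toFun = fun x => S.toFun (k x, y)) :
    D.swTransport₁ γ = T.f (k 1) (k 0) y := by
  have hf : ContMDiff 𝓘(ℝ, ℝ) 𝓘(ℝ, EG) ∞ (fun s => T.f s (k 0) y) :=
    T.contMDiff_f contDiff_id contDiff_const contDiff_const
  -- Under `k`, the logarithmic derivative of `f` and the pulled-back form are both multiplied by
  -- `k'(x)`, so `f` composed with `k` solves the equation along the reparametrised line. No
  -- monotonicity of `k` is needed.
  refine IsSWSolution₁.swTransport₁_eq (u := fun x => T.f (k x) (k 0) y)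
    ⟨T.contMDiff_f hk contDiff_const contDiff_const, fun x => ?_, T.f_init _ _⟩
  have hd : HasDerivAt k (deriv k x) x := (hk.differentiable (by simp) x).hasDerivAt
  rw [rightLogDeriv_comp (u := fun s => T.f s (k 0) y) hf.contMDiffAt hk.contDiffAt hd, T.f_eq, hγ,
    D.θ.pullback_comp_apply S.smooth (hd.prodMk (hasDerivAt_const x y)).hasFDerivAt, smul_neg]
  have hv : (fun i => ContinuousLinearMap.toSpanSingleton ℝ (deriv k x, (0 : ℝ)) (![(1 : ℝ)] i)) =
      fun i : Fin 1 => deriv k x • ![((1 : ℝ), (0 : ℝ))] i := by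
    funext i
    fin_cases i
    simp
  rw [hv]
  have h := (D.θ.pullback S.toFun (k x, y)).toMultilinearMap.map_smul_univ (fun _ => deriv k x)
    ![((1 : ℝ), (0 : ℝ))]
  rw [Fin.prod_univ_one] at h
  exact congrArg Neg.neg h.symm

/-- The parameter of the tail curve runs from `ξ` to `1`, so the transport is `f(1, ξ; y)` whatever
the cutoff. Its form `f(ξ, 1; y)⁻¹` is the one occurring in the equation for `W` with base point `x₀
= 1`. -/
theorem swTransport₁_tailCurve {D : ConnectionDoublet X E M} {S : Surface γ₀ γ₁}
    (T : PlaneTransport (D.planeDoublet S)) (φ : Cutoff) (ξ y : ℝ) :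
    D.swTransport₁ (S.tailCurve φ ξ y) = (T.f ξ 1 y)⁻¹ := by
  obtain ⟨ε, h0, h1, h2, h3⟩ := φ.sitting
  rw [swTransport₁_eq_f T (S.tailCurve φ ξ y) (k := fun x => ξ + (1 - ξ) * φ.toFun x)
    (contDiff_const.add (contDiff_const.mul φ.smooth)) y rfl]
  rw [h2 0 h0, h3 1 (by linarith)]
  have h := T.f_mul 1 ξ 1 y
  rw [T.f_init] at h
  simpa using eq_inv_of_mul_eq_one_left h.symm

variable [LieGroup 𝓘(ℝ, EH) ∞ H]

theorem isCocycleOf_toCocycle [CompleteSpace EG] [CompleteSpace EH] {D : ConnectionDoublet X E M}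
    {S : Surface γ₀ γ₁} (T : PlaneTransport (D.planeDoublet S)) : D.IsCocycleOf S T.toCocycle :=
  T.isAssociated_toCocycle (fun _ => rfl) (fun _ => rfl) (fun _ => rfl)

theorem IsCocycleOf.eq_toCocycle [CompleteSpace EG] [CompleteSpace EH]
    {D : ConnectionDoublet X E M} {S : Surface γ₀ γ₁} (T : PlaneTransport (D.planeDoublet S))
    {c : Cocycle X} (hc : D.IsCocycleOf S c) : c = T.toCocycle :=
  T.eq_toCocycle (fun _ => rfl) (fun _ => rfl) (fun _ => rfl) hc

theorem cocycle_eq_toCocycle [CompleteSpace EG] [CompleteSpace EH]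
    {D : ConnectionDoublet X E M} {S : Surface γ₀ γ₁} (T : PlaneTransport (D.planeDoublet S)) :
    D.cocycle S = T.toCocycle :=
  IsCocycleOf.eq_toCocycle T (Classical.epsilon_spec
    (p := fun c : Cocycle X => c.IsAssociated (D.θ.pullback S.toFun) (D.Υ.pullback S.toFun))
    ⟨_, isCocycleOf_toCocycle T⟩)

theorem existsUnique_isCocycleOf [FiniteDimensional ℝ EG] [FiniteDimensional ℝ EH]
    (D : ConnectionDoublet X E M) (S : Surface γ₀ γ₁) :
    ∃! c : Cocycle X, D.IsCocycleOf S c := by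
  have : CompleteSpace EG := FiniteDimensional.complete ℝ EG
  have : CompleteSpace EH := FiniteDimensional.complete ℝ EH
  obtain ⟨T⟩ := (D.planeDoublet S).exists_planeTransport
  exact ⟨_, isCocycleOf_toCocycle T, fun c hc => IsCocycleOf.eq_toCocycle T hc⟩

theorem swTransport₁_eq_cocycle_f [FiniteDimensional ℝ EG] [FiniteDimensional ℝ EH]
    (D : ConnectionDoublet X E M) (S : Surface γ₀ γ₁)
    {q₀ q₁ : M} (γ : Curve E q₀ q₁) {k : ℝ → ℝ}
    (hk : ContDiff ℝ ∞ k) (y : ℝ) (hγ : γ.toFun = fun x => S.toFun (k x, y)) :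
    D.swTransport₁ γ = (D.cocycle S).f (k 1) (k 0) y := by
  have : CompleteSpace EG := FiniteDimensional.complete ℝ EG
  have : CompleteSpace EH := FiniteDimensional.complete ℝ EH
  obtain ⟨T⟩ := (D.planeDoublet S).exists_planeTransport
  rw [swTransport₁_eq_f T γ hk y hγ, cocycle_eq_toCocycle T]
  rfl

theorem continuous_swIntegrand {D : ConnectionDoublet X E M} {S : Surface γ₀ γ₁}
    (T : PlaneTransport (D.planeDoublet S)) (φ : Cutoff) (y : ℝ) :
    Continuous (fun ξ : ℝ => X.mDot (D.swTransport₁ (S.tailCurve φ ξ y))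
      (D.Υ.pullback S.toFun (ξ, y) ![(1, 0), (0, 1)])) := by
  simp_rw [X.mDot_eq, swTransport₁_tailCurve T]
  have h := T.continuous_integrand 1 1 y
  simp only [one_mul] at h
  exact h

/-- The heart of the comparison. The factor `g(1; y, 0)` is trivial because `a_y` vanishes on the
edge `x = 1`; the factor `f(ξ, 1; y)⁻¹` is the transport along the tail curve; and reversing the
limits of `∫` from `1` to `0` removes the sign. -/
theorem isSWSolution₂_W {D : ConnectionDoublet X E M} {S : Surface γ₀ γ₁}
    (T : PlaneTransport (D.planeDoublet S)) (φ : Cutoff) :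
    D.IsSWSolution₂ φ S (fun y => T.W 0 1 y 0) where
  smooth := T.contMDiff_W contDiff_const contDiff_const contDiff_id contDiff_const
  eq y := by
    have hg : (fun s => T.g 1 s 0) = fun _ => 1 :=
      eq_of_rightLogDeriv_eq (EG := EG) (x := 0)
        (T.contMDiff_g contDiff_const contDiff_id contDiff_const) contMDiff_const
        (fun s => by rw [T.g_eq, rightLogDeriv_const, planeDoublet_ay_one, neg_zero])
        (T.g_init _ _)
    have hg' : T.g 1 y 0 = 1 := congrFun hg y
    rw [T.W_eq, hg', ← intervalIntegral.integral_symm]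
    refine intervalIntegral.integral_congr fun ξ _ => ?_
    rw [X.mDot_eq, swTransport₁_tailCurve T, inv_one, one_mul]
    rfl
  init := T.W_init _ _ _

end ConnectionDoublet

end Comparison

end HigherTransport

theorem mainTheorem9
    {EG : Type*} [NormedAddCommGroup EG] [NormedSpace ℝ EG] [FiniteDimensional ℝ EG]
    {EH : Type*} [NormedAddCommGroup EH] [NormedSpace ℝ EH] [FiniteDimensional ℝ EH]
    {G : Type*} [TopologicalSpace G] [ChartedSpace EG G] [Group G] [LieGroup 𝓘(ℝ, EG) ∞ G]
    {H : Type*} [TopologicalSpace H] [ChartedSpace EH H] [Group H] [LieGroup 𝓘(ℝ, EH) ∞ H]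
    (X : LieCrossedModule EG EH G H)
    {E : Type*} [NormedAddCommGroup E] [NormedSpace ℝ E] [FiniteDimensional ℝ E]
    {M : Type*} [TopologicalSpace M] [ChartedSpace E M] [IsManifold 𝓘(ℝ, E) ∞ M]
    (D : ConnectionDoublet X E M) :
    (∀ {p₀ p₁ : M} (γ : Curve E p₀ p₁),
      (∃! c : Cocycle X, D.IsCocycleOf γ.unitSurface c) ∧
      (∃! u : ℝ → G, D.IsSWSolution₁ γ u) ∧
      ∀ y : ℝ, D.swTransport₁ γ = D.transport₁ γ y) ∧
    (∀ {p₀ p₁ : M} {γ₀ γ₁ : Curve E p₀ p₁} (S : Surface γ₀ γ₁),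
      (∃! c : Cocycle X, D.IsCocycleOf S c) ∧
      D.swTransport₁ γ₀ = (D.cocycle S).f 1 0 0 ∧
      D.swTransport₁ γ₁ = (D.cocycle S).f 1 0 1 ∧
      ∀ φ : Cutoff,
        (∃! Z : ℝ → H, D.IsSWSolution₂ φ S Z) ∧
        (∀ y : ℝ, IntervalIntegrable
          (fun ξ : ℝ => X.mDot (D.swTransport₁ (S.tailCurve φ ξ y))
            (D.Υ.pullback S.toFun (ξ, y) ![(1, 0), (0, 1)])) MeasureTheory.volume 0 1) ∧
        D.swTransport₂ φ S = D.transport₂ S) := by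
  refine ⟨fun γ => ⟨D.existsUnique_isCocycleOf γ.unitSurface, ?_, fun y => ?_⟩, fun {_ _ γ₀ γ₁} S =>
    ⟨D.existsUnique_isCocycleOf S, ?_, ?_, fun φ => ?_⟩⟩
  · obtain ⟨u, hu⟩ := D.exists_isSWSolution₁ γ
    exact ⟨u, hu, fun v hv => hv.unique hu⟩
  · exact D.swTransport₁_eq_cocycle_f γ.unitSurface γ (k := id) contDiff_id y rfl
  · obtain ⟨ε, h0, -, -, -, h, -⟩ := S.sitting
    exact D.swTransport₁_eq_cocycle_f S γ₀ (k := id) contDiff_id 0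
      (funext fun x => (h x 0 h0).symm)
  · obtain ⟨ε, h0, -, -, -, -, h⟩ := S.sitting
    exact D.swTransport₁_eq_cocycle_f S γ₁ (k := id) contDiff_id 1
      (funext fun x => (h x 1 (by linarith)).symm)
  · have : CompleteSpace EG := FiniteDimensional.complete ℝ EG
    have : CompleteSpace EH := FiniteDimensional.complete ℝ EH
    obtain ⟨T⟩ := (D.planeDoublet S).exists_planeTransport
    have hT := ConnectionDoublet.isSWSolution₂_W T φ
    refine ⟨⟨_, hT, fun v hv => hv.unique hT⟩, fun y =>
      (ConnectionDoublet.continuous_swIntegrand T φ y).intervalIntegrable 0 1, ?_⟩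
    -- The solution picked in the definition of `swTransport₂` is `y ↦ W(0, 1; y, 0)` by uniqueness;
    -- its value at `1` is `transport₂`.
    have h := (Classical.epsilon_spec (p := fun Z : ℝ → H => D.IsSWSolution₂ φ S Z)
      ⟨_, hT⟩).unique hT
    rw [ConnectionDoublet.transport₂, ConnectionDoublet.cocycle_eq_toCocycle T]
    exact congrFun h 1
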